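/- Let $v,a,t_f>0$ and $x_0,y_0,\theta_0\in\mathbb{R}$. Problem (P3) is to minimize $z_3(t_f)^2-z_1(t_f)z_2(t_f)$ over all pairs consisting of a state $s=(x,y,\theta,z_1,z_2,z_3)\in W^{1,2}([0,t_f];\mathbb{R}^6)$ and a control $u\in L^\infty([0,t_f];\mathbb{R})$ that satisfy, for a.e. $t\in[0,t_f]$, $$\dot x=v\cos\theta,\quad \dot y=v\sin\theta,\quad \dot\theta=\frac{u}{v},\quad \dot z_1=\frac{x^2}{(x^2+y^2)^2},\quad \dot z_2=\frac{y^2}{(x^2+y^2)^2},\quad \dot z_3=\frac{xy}{(x^2+y^2)^2},\quad -va\le u\le va,$$ and $x(0)=x_0$, $y(0)=y_0$, $\theta(0)=\theta_0$, $z_1(0)=z_2(0)=z_3(0)=0$. Suppose that $(s,u)$ is optimal for Problem (P3), and put $\bar z_i=z_i(t_f)$. Then there are functions $\lambda_x,\lambda_y,\lambda_\theta:[0,t_f]\to\mathbb{R}$ that solve, on $[0,t_f]$, $$\dot\lambda_x=\frac{-2\bar z_2x^3+6\bar z_3x^2y+2(\bar z_2-2\bar z_1)xy^2-2\bar z_3y^3}{(x^2+y^2)^3},\qquad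 \lambda_x(t_f)=0,$$ $$\dot\lambda_y=\frac{-2\bar z_1y^3+6\bar z_3y^2x+2(\bar z_1-2\bar z_2)yx^2-2\bar z_3x^3}{(x^2+y^2)^3},\qquad \lambda_y(t_f)=0,$$ $$\dot\lambda_\theta=v(\lambda_x\sin\theta-\lambda_y\cos\theta),\qquad \lambda_\theta(t_f)=0,$$ and the optimal control is a concatenation of finitely many arcs of two kinds: there are $0=\tau_0<\tau_1<\dots<\tau_N=t_f$ such that for each $i<N$ one of the following holds. (i) (Bang arc.) Either $\lambda_\theta<0$ and $\dot\theta=a$ on $(\tau_i,\tau_{i+1})$, and $u=va$ a.e. there; or $\lambda_\theta>0$ and $\dot\theta=-a$ on $(\tau_i,\tau_{i+1})$, and $u=-va$ a.e. there. (ii) (Interior, or singular, arc.) $\lambda_\theta=0$ on $[\tau_i,\tau_{i+1}]$, the functions $\lambda_x,\lambda_y$ have at most finitely many common zeros in $[\tau_i,\tau_{i+1}]$, and at every other $t\in[\tau_i,\tau_{i+1}]$ one has $\theta(t)=\arctan(\lambda_y(t)/\lambda_x(t))$, where $\arctan$ is multivalued: $\theta(t)\in\arctan(\lambda_y(t)/\lambda_x(t))+\pi\mathbb{Z}$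 if $\lambda_x(t)\ne0$, and $\theta(t)\in\frac{\pi}{2}+\pi\mathbb{Z}$ if $\lambda_x(t)=0$. -/

import Mathlib

open MeasureTheory Set

/-- Data of the problem: constant speed `v` of the observer, bound `a` on the turning rate
(curvature bound), terminal time `tf`, initial relative position `(x₀, y₀)` and initial course
`θ₀`. -/
structure ObserverData where
  v : ℝ
  a : ℝ
  tf : ℝ
  x₀ : ℝ
  y₀ : ℝ
  θ₀ : ℝ
  v_pos : 0 < v
  a_pos : 0 < a
  tf_pos : 0 < tf

/-- The state `s = (x, y, θ, z₁, z₂, z₃)`; only the values on `[0, tf]` matter. -/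
structure ObserverState where
  x : ℝ → ℝ
  y : ℝ → ℝ
  θ : ℝ → ℝ
  z₁ : ℝ → ℝ
  z₂ : ℝ → ℝ
  z₃ : ℝ → ℝ

/-- `f` belongs to the Sobolev space `W^{1,2}([0, T]; ℝ)` (through its absolutely continuous
representative) and `f' = g` a.e. on `[0, T]`. -/
def HasW12Deriv (T : ℝ) (f g : ℝ → ℝ) : Prop :=
  MemLp g 2 (volume.restrict (Icc 0 T)) ∧
    ∀ t ∈ Icc 0 T, f t = f 0 + ∫ r in (0 : ℝ)..t, g r

/-- The pair `(s, u) ∈ W^{1,2} × L^∞` is feasible for the bearings-only localization problem with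
prescribed initial course and bounded curvature. The conditions on the `zᵢ` (integrability of their
derivatives) force the path to stay away from the target `(0, 0)`. -/
structure IsFeasible (P : ObserverData) (s : ObserverState) (u : ℝ → ℝ) : Prop where
  control_memLp : MemLp u ⊤ (volume.restrict (Icc 0 P.tf))
  control_bound : ∀ᵐ t ∂(volume.restrict (Icc 0 P.tf)), -(P.v * P.a) ≤ u t ∧ u t ≤ P.v * P.a
  x_ode : HasW12Deriv P.tf s.x (fun t => P.v * Real.cos (s.θ t))
  y_ode : HasW12Deriv P.tf s.y (fun t => P.v * Real.sin (s.θ t))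
  θ_ode : HasW12Deriv P.tf s.θ (fun t => u t / P.v)
  z₁_ode : HasW12Deriv P.tf s.z₁ (fun t => s.x t ^ 2 / (s.x t ^ 2 + s.y t ^ 2) ^ 2)
  z₂_ode : HasW12Deriv P.tf s.z₂ (fun t => s.y t ^ 2 / (s.x t ^ 2 + s.y t ^ 2) ^ 2)
  z₃_ode : HasW12Deriv P.tf s.z₃ (fun t => s.x t * s.y t / (s.x t ^ 2 + s.y t ^ 2) ^ 2)
  x_init : s.x 0 = P.x₀
  y_init : s.y 0 = P.y₀
  θ_init : s.θ 0 = P.θ₀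
  z₁_init : s.z₁ 0 = 0
  z₂_init : s.z₂ 0 = 0
  z₃_init : s.z₃ 0 = 0

/-- The cost to be minimized, `z₃(tf)² - z₁(tf) z₂(tf) = -σ⁴ det F(θ)`, with `F` the Fisher
information matrix. -/
def observerCost (P : ObserverData) (s : ObserverState) : ℝ :=
  s.z₃ P.tf ^ 2 - s.z₁ P.tf * s.z₂ P.tf

/-- `(s, u)` is an optimal solution: feasible, with least cost among all feasible pairs. -/
def IsOptimal (P : ObserverData) (s : ObserverState) (u : ℝ → ℝ) : Prop :=
  IsFeasible P s u ∧
    ∀ (s' : ObserverState) (u' : ℝ → ℝ), IsFeasible P s' u' → observerCost P s ≤ observerCost P s'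

/-- `lx, ly, lθ` solve on `[0, tf]` the adjoint equations along `s` with the transversality
conditions (one-sided derivatives at the end points). -/
structure IsAdjoint (P : ObserverData) (s : ObserverState) (lx ly lθ : ℝ → ℝ) : Prop where
  lx_ode : ∀ t ∈ Icc 0 P.tf, HasDerivWithinAt lx
    ((-2 * s.z₂ P.tf * s.x t ^ 3 + 6 * s.z₃ P.tf * s.x t ^ 2 * s.y t
        + 2 * (s.z₂ P.tf - 2 * s.z₁ P.tf) * s.x t * s.y t ^ 2 - 2 * s.z₃ P.tf * s.y t ^ 3)
      / (s.x t ^ 2 + s.y t ^ 2) ^ 3) (Icc 0 P.tf) t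
  ly_ode : ∀ t ∈ Icc 0 P.tf, HasDerivWithinAt ly
    ((-2 * s.z₁ P.tf * s.y t ^ 3 + 6 * s.z₃ P.tf * s.y t ^ 2 * s.x t
        + 2 * (s.z₁ P.tf - 2 * s.z₂ P.tf) * s.y t * s.x t ^ 2 - 2 * s.z₃ P.tf * s.x t ^ 3)
      / (s.x t ^ 2 + s.y t ^ 2) ^ 3) (Icc 0 P.tf) t
  lθ_ode : ∀ t ∈ Icc 0 P.tf, HasDerivWithinAt lθ
    (P.v * (lx t * Real.sin (s.θ t) - ly t * Real.cos (s.θ t))) (Icc 0 P.tf) t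
  lx_end : lx P.tf = 0
  ly_end : ly P.tf = 0
  lθ_end : lθ P.tf = 0

/-- `α` is a value of the (multivalued) `arctan (q / p)`: a solution of `tan α = q / p`, where
`q / p = ∞` if `p = 0 ≠ q`. There is none if `p = q = 0`. -/
def IsArctanValue (α q p : ℝ) : Prop :=
  (p ≠ 0 ∧ ∃ k : ℤ, α = Real.arctan (q / p) + k * Real.pi) ∨
    (p = 0 ∧ q ≠ 0 ∧ ∃ k : ℤ, α = Real.pi / 2 + k * Real.pi)

/-- On `(c, d)` the switching function `lθ` has no zero and the control is at the corresponding
bound: a bang arc, with `θ' = a` or `θ' = -a`. -/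
def IsBangArc (P : ObserverData) (s : ObserverState) (u lθ : ℝ → ℝ) (c d : ℝ) : Prop :=
  ((∀ t ∈ Ioo c d, lθ t < 0) ∧ (∀ t ∈ Ioo c d, HasDerivAt s.θ P.a t) ∧
      ∀ᵐ t ∂(volume.restrict (Ioo c d)), u t = P.v * P.a) ∨
  ((∀ t ∈ Ioo c d, 0 < lθ t) ∧ (∀ t ∈ Ioo c d, HasDerivAt s.θ (-P.a) t) ∧
      ∀ᵐ t ∂(volume.restrict (Ioo c d)), u t = -(P.v * P.a))

/-- On `[c, d]` the switching function `lθ` vanishes and the course is an arctangent of `ly / lx`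
wherever this quotient is not `0 / 0`, which happens at finitely many times only: an interior
(singular) arc. -/
def IsInteriorArc (s : ObserverState) (lx ly lθ : ℝ → ℝ) (c d : ℝ) : Prop :=
  (∀ t ∈ Icc c d, lθ t = 0) ∧
  {t ∈ Icc c d | lx t = 0 ∧ ly t = 0}.Finite ∧
  ∀ t ∈ Icc c d, ¬(lx t = 0 ∧ ly t = 0) → IsArctanValue (s.θ t) (ly t) (lx t)

/-! Write z = x + iy, l = λ_x + iλ_y and φ = λ_θ. With the terminal values frozen, the adjoint
system reads l' = ∇Q(z), φ' = -v Im(l e^{-iθ}). Here Q = q/|z|⁴, and q = z̄₂x² - 2z̄₃xy + z̄₁y² =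
A|z|² + Re(b z̄²), where z̄ is the conjugate of z. Perturbing u to u + ε(w - u) and integrating by
parts twice shows that the first variation of the cost is ∫ φ (w - u)/v. Hence u minimizes φu
pointwise and is bang-bang off the zeros of φ (`IsOptimal.control_eq`). An interval on which φ
vanishes gives φ' = 0, which is the arctangent law for θ. The common zeros of λ_x and λ_y are
finitely many because ∇Q has no zero.

The substance is that φ changes its sign type finitely often, that is, there is no chattering. By
compactness (`exists_sign_partition`) it suffices that at each time φ has a constant sign (-, + or
0) on a short interval to either side; time reversal leaves only the right side. Two global facts
enter. The form q is positive definite, since the optimal cost is negative: a path that does not lie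
on a line through the target has a positive definite information matrix, and such a path is
feasible. The Hamiltonian v Re(l e^{-iθ}) - Q(z) - a|φ| is constant and equals -Q(z(T)) < 0, so v
Re(l e^{-iθ}) < Q(z) at every zero of φ (`Extremal.re_lt_potential`).

Near a zero of φ put time 0 there. If l(0) = 0, divide l by s; the limit ∇Q(z(0)) is not 0. If the
imaginary part of the (divided) covector times e^{-iθ(0)} is not 0, φ is monotone. Otherwise compare
with the circular arc of turning rate a or -a. Along the circle the corresponding function is
analytic. It is not identically zero: a circle that is singular with a negative energy constant
would make a polynomial in the point of the unit circle vanish, which is excluded by evaluating it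
at a few points (`circle_not_singular`). So it starts with c s^m, c ≠ 0. The true course deviates
from the circle by a lag D ≥ 0, constant on the arcs that turn as the circle does, and φ' = s^j p
with p ≈ c s^m - βD.

The orientation of the circle can be chosen so that β and the slope γ of p on the arcs of the other
kind have opposite signs. This leaves two scalar problems (`SwitchGerm`). In the saddle case β < 0 <
γ, an excursion of φ from 0 never returns. In the oscillator case γ < 0 < β, an energy E is positive
on excursions, E/s^{j+m} does not increase, and yet it tends to 0 along zeros that accumulate at 0.
Both cases give the constant sign. -/

open Filter Topology ComplexConjugate

/-! ### Excursions and one-sided sign germs of real functions. -/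

/-- A function with nonpositive right derivative does not increase. -/
theorem le_of_right_deriv_nonpos {f f' : ℝ → ℝ} {a b : ℝ} (hab : a ≤ b)
    (hc : ContinuousOn f (Icc a b))
    (hd : ∀ x ∈ Ico a b, HasDerivWithinAt f (f' x) (Ici x) x) (h0 : ∀ x ∈ Ico a b, f' x ≤ 0) :
    f b ≤ f a :=
  image_le_of_deriv_right_le_deriv_boundary (B := fun _ => f a) (B' := fun _ => 0) hc hd le_rfl
    continuousOn_const (fun _ _ => hasDerivWithinAt_const _ _ _) h0 (right_mem_Icc.2 hab)

theorem le_of_right_deriv_nonneg {f f' : ℝ → ℝ} {a b : ℝ} (hab : a ≤ b)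
    (hc : ContinuousOn f (Icc a b))
    (hd : ∀ x ∈ Ico a b, HasDerivWithinAt f (f' x) (Ici x) x) (h0 : ∀ x ∈ Ico a b, 0 ≤ f' x) :
    f a ≤ f b := by
  have := le_of_right_deriv_nonpos (f := fun x => -f x) (f' := fun x => -f' x) hab hc.neg
    (fun x hx => (hd x hx).neg) (fun x hx => by linarith [h0 x hx])
  linarith

/-- A continuous function without zeros on a connected set has a constant sign. -/
theorem neg_or_pos_of_ne_zero {f : ℝ → ℝ} {I : Set ℝ} (hI : IsPreconnected I)
    (hc : ContinuousOn f I) (h : ∀ x ∈ I, f x ≠ 0) :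
    (∀ x ∈ I, f x < 0) ∨ (∀ x ∈ I, 0 < f x) := by
  by_contra! hcon
  obtain ⟨⟨x, hx, hx0⟩, y, hy, hy0⟩ := hcon
  obtain ⟨z, hz, hz0⟩ := hI.intermediate_value hy hx hc ⟨hy0, hx0⟩
  exact h z hz hz0

theorem exists_last_zero {f : ℝ → ℝ} {a s : ℝ} (has : a ≤ s) (hc : ContinuousOn f (Icc a s))
    (ha : f a = 0) : ∃ r ∈ Icc a s, f r = 0 ∧ ∀ x ∈ Ioc r s, f x ≠ 0 := by
  have hK : IsCompact (Icc a s ∩ f ⁻¹' {0}) :=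
    isCompact_Icc.of_isClosed_subset
      (hc.preimage_isClosed_of_isClosed isClosed_Icc isClosed_singleton) inter_subset_left
  obtain ⟨r, hr, hmax⟩ := hK.exists_isGreatest ⟨a, left_mem_Icc.2 has, ha⟩
  refine ⟨r, hr.1, hr.2, fun x hx h0 => ?_⟩
  have := hmax ⟨⟨hr.1.1.trans hx.1.le, hx.2⟩, h0⟩
  exact absurd hx.1 (not_lt.2 this)

theorem exists_first_zero {f : ℝ → ℝ} {s b : ℝ} (hsb : s ≤ b) (hc : ContinuousOn f (Icc s b))
    (hb : f b = 0) : ∃ r ∈ Icc s b, f r = 0 ∧ ∀ x ∈ Ico s r, f x ≠ 0 := by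
  have hK : IsCompact (Icc s b ∩ f ⁻¹' {0}) :=
    isCompact_Icc.of_isClosed_subset
      (hc.preimage_isClosed_of_isClosed isClosed_Icc isClosed_singleton) inter_subset_left
  obtain ⟨r, hr, hmin⟩ := hK.exists_isLeast ⟨b, right_mem_Icc.2 hsb, hb⟩
  refine ⟨r, hr.1, hr.2, fun x hx h0 => ?_⟩
  have := hmin ⟨⟨hx.1, hx.2.le.trans hr.1.2⟩, h0⟩
  exact absurd hx.2 (not_lt.2 this)

/-- Between two zeros, a point where `f ≠ 0` lies in an interval of constant sign of `f` bounded by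
zeros. -/
theorem exists_excursion {f : ℝ → ℝ} {a s b : ℝ} (has : a ≤ s) (hsb : s ≤ b)
    (hc : ContinuousOn f (Icc a b)) (ha : f a = 0) (hb : f b = 0) (hs : f s ≠ 0) :
    ∃ r t, a ≤ r ∧ r < s ∧ s < t ∧ t ≤ b ∧ f r = 0 ∧ f t = 0 ∧
      ((∀ x ∈ Ioo r t, f x < 0) ∨ (∀ x ∈ Ioo r t, 0 < f x)) := by
  obtain ⟨r, hr, hr0, hr1⟩ := exists_last_zero has (hc.mono (Icc_subset_Icc le_rfl hsb)) ha
  obtain ⟨t, ht, ht0, ht1⟩ := exists_first_zero hsb (hc.mono (Icc_subset_Icc has le_rfl)) hb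
  have hrs : r < s := lt_of_le_of_ne hr.2 (fun h => hs (h ▸ hr0))
  have hst : s < t := lt_of_le_of_ne ht.1 (fun h => hs (h ▸ ht0))
  refine ⟨r, t, hr.1, hrs, hst, ht.2, hr0, ht0, neg_or_pos_of_ne_zero isPreconnected_Ioo
    (hc.mono fun x hx => ⟨hr.1.trans hx.1.le, hx.2.le.trans ht.2⟩) fun x hx => ?_⟩
  rcases le_or_gt x s with h | h
  · exact hr1 x ⟨hx.1, h⟩
  · exact ht1 x ⟨h.le, hx.2⟩

/-- `f` has a constant sign (`-`, `+` or `0`) on some interval `(0, ε)`. -/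
def HasSignGerm (f : ℝ → ℝ) : Prop :=
  ∃ ε > 0, (∀ s ∈ Ioo 0 ε, f s < 0) ∨ (∀ s ∈ Ioo 0 ε, 0 < f s) ∨ (∀ s ∈ Ioo 0 ε, f s = 0)

/-- If zeros accumulate at 0, a nonzero value near 0 lies in an excursion between two zeros, so
without excursions `f` vanishes near 0; if they do not accumulate, continuity fixes the sign. The
accumulation is passed on to the excluded excursion because the oscillator case uses zeros
arbitrarily close to 0. -/
theorem HasSignGerm.of_no_excursion {f : ℝ → ℝ} {δ : ℝ} (hδ : 0 < δ)
    (hc : ContinuousOn f (Ioo 0 δ))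
    (h : (∀ ε > 0, ∃ s ∈ Ioo 0 ε, f s = 0) → ∀ r t, 0 < r → r < t → t < δ → f r = 0 → f t = 0 →
      ((∀ x ∈ Ioo r t, f x < 0) ∨ (∀ x ∈ Ioo r t, 0 < f x)) → False) : HasSignGerm f := by
  by_cases hacc : ∀ ε > 0, ∃ s ∈ Ioo 0 ε, f s = 0
  · obtain ⟨b, hb, hb0⟩ := hacc δ hδ
    refine ⟨b, hb.1, Or.inr (Or.inr fun s hs => ?_)⟩
    by_contra hne
    obtain ⟨a, ha, ha0⟩ := hacc s hs.1
    obtain ⟨r, t, h1, h2, h3, h4, h5, h6, h7⟩ := exists_excursion ha.2.le hs.2.le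
      (hc.mono fun x hx => ⟨ha.1.trans_le hx.1, hx.2.trans_lt hb.2⟩) ha0 hb0 hne
    exact h hacc r t (ha.1.trans_le h1) (h2.trans h3) (h4.trans_lt hb.2) h5 h6 h7
  · push Not at hacc
    obtain ⟨ε, hε, h0⟩ := hacc
    have hm : 0 < min ε δ := lt_min hε hδ
    refine ⟨min ε δ, hm, ?_⟩
    rcases neg_or_pos_of_ne_zero isPreconnected_Ioo
      (hc.mono (Ioo_subset_Ioo le_rfl (min_le_right ε δ)))
      (fun x hx => h0 x ⟨hx.1, hx.2.trans_le (min_le_left _ _)⟩) with h1 | h1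
    · exact Or.inl h1
    · exact Or.inr (Or.inl h1)

/-! ### The scalar switching problem and its saddle case. -/

/-- Scalar data of a bang-bang switching function `φ` near a zero of second order: `φ' = s ^ j p`,
where `p` is `c s ^ m` minus `β D`, with the time `D` lost to other arcs than those with `φ < 0`;
`p' = Fn` where `φ < 0` and `p' = Fp ≈ γ` where `φ > 0`. -/
structure SwitchGerm (ε β γ c C : ℝ) (j m : ℕ) (φ p D Fn Fn' Fp Fp' : ℝ → ℝ) : Prop where
  ε_pos : 0 < ε
  C_pos : 0 < C
  m_pos : 1 ≤ m
  cont : ContinuousOn φ (Icc 0 ε)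
  zero : φ 0 = 0
  deriv : ∀ s ∈ Ioo 0 ε, HasDerivAt φ (s ^ j * p s) s
  lip : ∀ s ∈ Ioo 0 ε, ∀ t ∈ Ioo 0 ε, |p s - p t| ≤ C * |s - t|
  D_nonneg : ∀ s ∈ Ioo 0 ε, 0 ≤ D s
  D_const : ∀ s t, 0 < s → s < t → t < ε → (∀ r ∈ Ioo s t, φ r < 0) → D t = D s
  p_est : ∀ s ∈ Ioo 0 ε, |p s - c * s ^ m + β * D s| ≤ C * (s * D s + s ^ (m + 1))
  neg_deriv : ∀ s t, 0 < s → s < t → t < ε → (∀ r ∈ Ioo s t, φ r < 0) → ∀ r ∈ Ico s t,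
    HasDerivWithinAt p (Fn r) (Ici r) r ∧ HasDerivWithinAt Fn (Fn' r) (Ici r) r
  pos_deriv : ∀ s t, 0 < s → s < t → t < ε → (∀ r ∈ Ioo s t, 0 < φ r) → ∀ r ∈ Ico s t,
    HasDerivWithinAt p (Fp r) (Ici r) r ∧ HasDerivWithinAt Fp (Fp' r) (Ici r) r
  Fn_cont : ContinuousOn Fn (Ioo 0 ε)
  Fp_cont : ContinuousOn Fp (Ioo 0 ε)
  Fn_est : ∀ s ∈ Ioo 0 ε, |Fn s - c * m * s ^ (m - 1)| ≤ C * (D s + s ^ m)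
  Fn'_est : ∀ s ∈ Ioo 0 ε, |s * Fn' s - c * m * (m - 1) * s ^ (m - 1)| ≤ C * (D s + s ^ m)
  Fp_est : ∀ s ∈ Ioo 0 ε, |Fp s - γ| ≤ |γ| / 2
  Fp'_est : ∀ s ∈ Ioo 0 ε, |Fp' s| ≤ C

namespace SwitchGerm

variable {ε β γ c C : ℝ} {j m : ℕ} {φ p D Fn Fn' Fp Fp' : ℝ → ℝ}

theorem p_cont (h : SwitchGerm ε β γ c C j m φ p D Fn Fn' Fp Fp') : ContinuousOn p (Ioo 0 ε) := by
  have hL : LipschitzOnWith ⟨C, h.C_pos.le⟩ p (Ioo 0 ε) := by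
    refine LipschitzOnWith.of_dist_le_mul fun s hs t ht => ?_
    rw [Real.dist_eq, Real.dist_eq]; exact h.lip s hs t ht
  exact hL.continuousOn

theorem φ_cont (h : SwitchGerm ε β γ c C j m φ p D Fn Fn' Fp Fp') : ContinuousOn φ (Ioo 0 ε) :=
  h.cont.mono Ioo_subset_Icc_self

/-- `φ` stays on the side to which it moves. -/
theorem exists_right_pos (h : SwitchGerm ε β γ c C j m φ p D Fn Fn' Fp Fp') {s : ℝ}
    (hs : s ∈ Ioo 0 ε) (h0 : φ s = 0) (hp : 0 < p s) :
    ∃ t, s < t ∧ t < ε ∧ ∀ r ∈ Ioo s t, 0 < φ r := by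
  have hev : ∀ᶠ r in 𝓝 s, 0 < p r ∧ r < ε :=
    ((h.p_cont.continuousAt (isOpen_Ioo.mem_nhds hs)).eventually (lt_mem_nhds hp)).and
      (gt_mem_nhds hs.2)
  obtain ⟨η, hη, hball⟩ := Metric.eventually_nhds_iff.1 hev
  have hin : ∀ r, s ≤ r → r < s + η → 0 < p r ∧ r < ε := fun r h1 h2 =>
    hball (by rw [Real.dist_eq, abs_lt]; constructor <;> linarith)
  refine ⟨s + η / 2, by linarith, (hin _ (by linarith) (by linarith)).2, fun r hr => ?_⟩
  have hr' : r < s + η := by linarith [hr.2]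
  obtain ⟨x, hx, hx'⟩ := exists_hasDerivAt_eq_slope φ (fun s => s ^ j * p s) hr.1
    (h.φ_cont.mono fun y hy => ⟨hs.1.trans_le hy.1, (hin y hy.1 (hy.2.trans_lt hr')).2⟩)
    (fun y hy => h.deriv y ⟨hs.1.trans hy.1, (hin y hy.1.le (hy.2.trans hr')).2⟩)
  have hpos : 0 < x ^ j * p x :=
    mul_pos (pow_pos (hs.1.trans hx.1) _) (hin x hx.1.le (hx.2.trans hr')).1
  rw [hx', h0, sub_zero] at hpos
  exact (div_pos_iff_of_pos_right (sub_pos.2 hr.1)).1 hpos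

theorem exists_right_neg (h : SwitchGerm ε β γ c C j m φ p D Fn Fn' Fp Fp') {s : ℝ}
    (hs : s ∈ Ioo 0 ε) (h0 : φ s = 0) (hp : p s < 0) :
    ∃ t, s < t ∧ t < ε ∧ ∀ r ∈ Ioo s t, φ r < 0 := by
  have hev : ∀ᶠ r in 𝓝 s, p r < 0 ∧ r < ε :=
    ((h.p_cont.continuousAt (isOpen_Ioo.mem_nhds hs)).eventually (gt_mem_nhds hp)).and
      (gt_mem_nhds hs.2)
  obtain ⟨η, hη, hball⟩ := Metric.eventually_nhds_iff.1 hev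
  have hin : ∀ r, s ≤ r → r < s + η → p r < 0 ∧ r < ε := fun r h1 h2 =>
    hball (by rw [Real.dist_eq, abs_lt]; constructor <;> linarith)
  refine ⟨s + η / 2, by linarith, (hin _ (by linarith) (by linarith)).2, fun r hr => ?_⟩
  have hr' : r < s + η := by linarith [hr.2]
  obtain ⟨x, hx, hx'⟩ := exists_hasDerivAt_eq_slope φ (fun s => s ^ j * p s) hr.1
    (h.φ_cont.mono fun y hy => ⟨hs.1.trans_le hy.1, (hin y hy.1 (hy.2.trans_lt hr')).2⟩)
    (fun y hy => h.deriv y ⟨hs.1.trans hy.1, (hin y hy.1.le (hy.2.trans hr')).2⟩)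
  have hneg : x ^ j * p x < 0 :=
    mul_neg_of_pos_of_neg (pow_pos (hs.1.trans hx.1) _) (hin x hx.1.le (hx.2.trans hr')).1
  rw [hx', h0, sub_zero] at hneg
  by_contra! hcon
  exact absurd hneg (not_lt.2 (div_nonneg hcon (sub_pos.2 hr.1).le))

/-- Were `p s` positive, `φ` would rise from 0 directly after `s`. Combined with `p_est`, this sign
at the left end of an excursion bounds the lag `D` there. -/
theorem p_nonpos_of_neg (h : SwitchGerm ε β γ c C j m φ p D Fn Fn' Fp Fp') {s t : ℝ}
    (hs : 0 < s) (hst : s < t) (ht : t < ε) (h0 : φ s = 0) (hneg : ∀ r ∈ Ioo s t, φ r < 0) :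
    p s ≤ 0 := by
  by_contra! hp
  obtain ⟨t', h1, h2, h3⟩ := h.exists_right_pos ⟨hs, hst.trans ht⟩ h0 hp
  obtain ⟨r, hr1, hr2⟩ := exists_between (lt_min hst h1)
  exact absurd (h3 r ⟨hr1, hr2.trans_le (min_le_right _ _)⟩)
    (not_lt.2 (hneg r ⟨hr1, hr2.trans_le (min_le_left _ _)⟩).le)

theorem p_nonneg_of_pos (h : SwitchGerm ε β γ c C j m φ p D Fn Fn' Fp Fp') {s t : ℝ}
    (hs : 0 < s) (hst : s < t) (ht : t < ε) (h0 : φ s = 0) (hpos : ∀ r ∈ Ioo s t, 0 < φ r) :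
    0 ≤ p s := by
  by_contra! hp
  obtain ⟨t', h1, h2, h3⟩ := h.exists_right_neg ⟨hs, hst.trans ht⟩ h0 hp
  obtain ⟨r, hr1, hr2⟩ := exists_between (lt_min hst h1)
  exact absurd (h3 r ⟨hr1, hr2.trans_le (min_le_right _ _)⟩)
    (not_lt.2 (hpos r ⟨hr1, hr2.trans_le (min_le_left _ _)⟩).le)

/-- If `p` has a constant sign near `0`, so has `φ`. -/
theorem hasSignGerm_of_p_pos (h : SwitchGerm ε β γ c C j m φ p D Fn Fn' Fp Fp') {δ : ℝ}
    (hδ : 0 < δ) (hδε : δ ≤ ε) (hp : ∀ s ∈ Ioo 0 δ, 0 < p s) : HasSignGerm φ := by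
  refine ⟨δ, hδ, Or.inr (Or.inl fun s hs => ?_)⟩
  obtain ⟨x, hx, hx'⟩ := exists_hasDerivAt_eq_slope φ (fun s => s ^ j * p s) hs.1
    (h.cont.mono (Icc_subset_Icc le_rfl (hs.2.le.trans hδε)))
    (fun y hy => h.deriv y ⟨hy.1, hy.2.trans (hs.2.trans_le hδε)⟩)
  have hpos : 0 < x ^ j * p x := mul_pos (pow_pos hx.1 _) (hp x ⟨hx.1, hx.2.trans hs.2⟩)
  rw [hx', h.zero, sub_zero] at hpos
  exact (div_pos_iff_of_pos_right (sub_pos.2 hs.1)).1 hpos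

theorem hasSignGerm_of_p_neg (h : SwitchGerm ε β γ c C j m φ p D Fn Fn' Fp Fp') {δ : ℝ}
    (hδ : 0 < δ) (hδε : δ ≤ ε) (hp : ∀ s ∈ Ioo 0 δ, p s < 0) : HasSignGerm φ := by
  refine ⟨δ, hδ, Or.inl fun s hs => ?_⟩
  obtain ⟨x, hx, hx'⟩ := exists_hasDerivAt_eq_slope φ (fun s => s ^ j * p s) hs.1
    (h.cont.mono (Icc_subset_Icc le_rfl (hs.2.le.trans hδε)))
    (fun y hy => h.deriv y ⟨hy.1, hy.2.trans (hs.2.trans_le hδε)⟩)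
  have hneg : x ^ j * p x < 0 := mul_neg_of_pos_of_neg (pow_pos hx.1 _)
    (hp x ⟨hx.1, hx.2.trans hs.2⟩)
  rw [hx', h.zero, sub_zero] at hneg
  by_contra! hcon
  exact absurd hneg (not_lt.2 (div_nonneg hcon (sub_pos.2 hs.1).le))

/-- Saddle case: the zeros of `φ` do not accumulate, unless `φ = 0`. -/
theorem hasSignGerm_saddle (h : SwitchGerm ε β γ c C j m φ p D Fn Fn' Fp Fp') (hβ : β < 0)
    (hγ : 0 < γ) (hc : c ≠ 0) : HasSignGerm φ := by
  have hC := h.C_pos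
  -- For `c < 0` every excursion is ruled out: on it `p` has the sign of `φ` and its slope has that
  -- sign too, so `φ` moves away from 0 and cannot return. For `c > 0` both `c s ^ m` and `-β D` are
  -- nonnegative and `p` is positive outright.
  rcases lt_or_gt_of_ne hc with hc | hc
  · -- `c < 0`
    have hm0 : (0 : ℝ) < m := by exact_mod_cast h.m_pos
    -- At the start of a negative excursion `p ≤ 0`; absorbing the errors of `p_est` by half of `-β`
    -- and by 1 gives `(-β / 2) D ≤ (-c + 1) s ^ m`. The last condition on `δ` then makes `Fn ≤ 0`
    -- wherever `D ≤ K s ^ m`.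
    set K := 2 * (-c + 1) / (-β) with hK
    have hKpos : 0 < K := div_pos (by linarith) (by linarith)
    obtain ⟨δ, hδ, hδε, hδ1, hδ2, hδ3⟩ : ∃ δ > 0, δ ≤ ε ∧ C * δ ≤ -β / 2 ∧ C * δ ≤ 1 ∧
        C * (K + 1) * δ ≤ -c * m := by
      refine ⟨min (min ε (-β / 2 / C)) (min (1 / C) (-c * m / (C * (K + 1)))), ?_, ?_, ?_, ?_, ?_⟩
      · have : 0 < -c * m := mul_pos (by linarith) hm0
        have h2 : 0 < -β := by linarith
        have := h.ε_pos
        positivity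
      · exact (min_le_left _ _).trans (min_le_left _ _)
      · rw [mul_comm, ← le_div_iff₀ hC]; exact (min_le_left _ _).trans (min_le_right _ _)
      · rw [mul_comm, ← le_div_iff₀ hC]; exact (min_le_right _ _).trans (min_le_left _ _)
      · rw [mul_comm, ← le_div_iff₀ (by positivity)]
        exact (min_le_right _ _).trans (min_le_right _ _)
    refine HasSignGerm.of_no_excursion hδ (h.φ_cont.mono (Ioo_subset_Ioo le_rfl hδε)) ?_
    intro _ r t hr hrt ht hφr hφt hsign
    have htε := ht.trans_le hδε
    have hint : ∀ x ∈ Icc r t, x ∈ Ioo 0 ε := fun x hx =>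
      ⟨hr.trans_le hx.1, hx.2.trans_lt htε⟩
    obtain ⟨x₀, hx₀⟩ := exists_between hrt
    have hpc : ∀ x ∈ Ioo r t, ContinuousOn p (Icc r x) := fun x hx =>
      h.p_cont.mono fun y hy => hint y ⟨hy.1, hy.2.trans hx.2.le⟩
    have hφc : ContinuousOn φ (Icc x₀ t) := h.φ_cont.mono fun y hy => hint y ⟨hx₀.1.le.trans hy.1, hy.2⟩
    have hφd : ∀ x ∈ Ico x₀ t, HasDerivWithinAt φ (x ^ j * p x) (Ici x) x := fun x hx =>
      (h.deriv x (hint x ⟨hx₀.1.le.trans hx.1, hx.2.le⟩)).hasDerivWithinAt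
    rcases hsign with hneg | hpos
    · have hp0 := h.p_nonpos_of_neg hr hrt htε hφr hneg
      have hrI := hint r ⟨le_rfl, hrt.le⟩
      have hDr : D r ≤ K * r ^ m := by
        have h1 := abs_le.1 (h.p_est r hrI)
        have h2 := h.D_nonneg r hrI
        have h3 : C * r ≤ -β / 2 := (mul_le_mul_of_nonneg_left (hrt.trans ht).le hC.le).trans hδ1
        have h4 : C * r ≤ 1 := (mul_le_mul_of_nonneg_left (hrt.trans ht).le hC.le).trans hδ2
        have h5 := mul_le_mul_of_nonneg_right h3 h2
        have h6 := mul_le_mul_of_nonneg_right h4 (pow_pos hr m).le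
        rw [hK, div_mul_eq_mul_div, le_div_iff₀ (by linarith)]
        have h7 := h1.2
        have h8 := h1.1
        rw [pow_succ] at h7 h8
        nlinarith
      have hp : ∀ x ∈ Ioo r t, p x ≤ 0 := by
        intro x hx
        refine le_trans (le_of_right_deriv_nonpos hx.1.le (hpc x hx)
          (fun y hy => (h.neg_deriv r t hr hrt htε hneg y ⟨hy.1, hy.2.trans hx.2⟩).1) ?_) hp0
        intro y hy
        have hyI := hint y ⟨hy.1, (hy.2.trans hx.2).le⟩
        have hyt : y < δ := (hy.2.trans hx.2).trans ht
        have hDy : D y ≤ K * y ^ m := by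
          rcases eq_or_lt_of_le hy.1 with h1 | h1
          · rw [← h1]; exact hDr
          -- The lag is frozen while `φ < 0`, so its bound at `r` persists throughout the excursion.
          · rw [h.D_const r y hr h1 hyI.2 fun z hz => hneg z ⟨hz.1, hz.2.trans (hy.2.trans hx.2)⟩]
            exact hDr.trans (mul_le_mul_of_nonneg_left (pow_le_pow_left₀ hr.le hy.1 m) hKpos.le)
        have h1 := (abs_le.1 (h.Fn_est y hyI)).2
        obtain ⟨k, rfl⟩ : ∃ k, m = k + 1 := ⟨m - 1, by have := h.m_pos; omega⟩
        simp only [Nat.add_sub_cancel] at h1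
        have hyk : 0 < y ^ k := pow_pos hyI.1 k
        have h2 : C * (K + 1) * y ≤ -c * ((k + 1 : ℕ) : ℝ) :=
          (mul_le_mul_of_nonneg_left hyt.le (by positivity)).trans hδ3
        have h3 := mul_le_mul_of_nonneg_right h2 hyk.le
        have h4 := mul_le_mul_of_nonneg_left hDy hC.le
        rw [pow_succ] at h1 h4
        nlinarith
      have h1 := le_of_right_deriv_nonpos hx₀.2.le hφc hφd fun x hx =>
        mul_nonpos_of_nonneg_of_nonpos (pow_nonneg (hr.le.trans (hx₀.1.le.trans hx.1)) _)
          (hp x ⟨hx₀.1.trans_le hx.1, hx.2⟩)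
      linarith [hneg x₀ hx₀]
    · have hp0 := h.p_nonneg_of_pos hr hrt htε hφr hpos
      have hp : ∀ x ∈ Ioo r t, 0 ≤ p x := by
        intro x hx
        refine le_trans hp0 (le_of_right_deriv_nonneg hx.1.le (hpc x hx)
          (fun y hy => (h.pos_deriv r t hr hrt htε hpos y ⟨hy.1, hy.2.trans hx.2⟩).1) ?_)
        intro y hy
        have h1 := (abs_le.1 (h.Fp_est y (hint y ⟨hy.1, (hy.2.trans hx.2).le⟩))).1
        rw [abs_of_pos hγ] at h1
        linarith
      have h1 := le_of_right_deriv_nonneg hx₀.2.le hφc hφd fun x hx =>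
        mul_nonneg (pow_nonneg (hr.le.trans (hx₀.1.le.trans hx.1)) _)
          (hp x ⟨hx₀.1.trans_le hx.1, hx.2⟩)
      linarith [hpos x₀ hx₀]
  · -- `c > 0`
    have hβ' : 0 < -β := by linarith
    have hε := h.ε_pos
    refine h.hasSignGerm_of_p_pos (δ := min ε (min (-β / C) (c / C))) (by positivity)
      (min_le_left _ _) fun s hs => ?_
    have hsI : s ∈ Ioo 0 ε := ⟨hs.1, hs.2.trans_le (min_le_left _ _)⟩
    have h1 : C * s < -β := by
      rw [mul_comm, ← lt_div_iff₀ hC]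
      exact hs.2.trans_le ((min_le_right _ _).trans (min_le_left _ _))
    have h2 : C * s < c := by
      rw [mul_comm, ← lt_div_iff₀ hC]
      exact hs.2.trans_le ((min_le_right _ _).trans (min_le_right _ _))
    have h3 := (abs_le.1 (h.p_est s hsI)).1
    have h4 := mul_le_mul_of_nonneg_right h1.le (h.D_nonneg s hsI)
    have h5 := mul_lt_mul_of_pos_right h2 (pow_pos hs.1 m)
    rw [pow_succ] at h3
    nlinarith

end SwitchGerm

/-! ### The oscillator case: exchange between speed and height on an excursion, and growth of the
energy. -/

namespace SwitchGerm

variable {ε β γ c C : ℝ} {j m : ℕ} {φ p D Fn Fn' Fp Fp' : ℝ → ℝ}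

/-- On an excursion with `φ > 0` the speed `|p|` is nearly conserved. -/
theorem abs_p_le_of_zero (h : SwitchGerm ε β γ c C j m φ p D Fn Fn' Fp Fp') {δ : ℝ}
    (hδε : δ ≤ ε) (hγ : γ < 0) (hc : 0 < c) (hup : ∀ s ∈ Ioo 0 δ, p s ≤ 2 * c * s ^ m)
    (hacc : ∀ ε > 0, ∃ s ∈ Ioo 0 ε, φ s = 0) {s : ℝ} (hs : s ∈ Ioo 0 δ) (h0 : φ s = 0) :
    |p s| ≤ 4 * c * s ^ m := by
  have hsm : 0 < s ^ m := pow_pos hs.1 m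
  rcases le_or_gt 0 (p s) with hp | hp
  · rw [abs_of_nonneg hp]
    nlinarith [hup s hs]
  have hsε : s < ε := hs.2.trans_le hδε
  -- Two earlier zeros of `φ` give, by Rolle, a zero of `p` before `s`. With `ξ` the last zero of
  -- `p` and `r` the last zero of `φ` before `ξ`, the interval `(r, s)` is a positive excursion that
  -- rises up to `ξ` and falls after it.
  obtain ⟨σ₂, hσ₂, hφ₂⟩ := hacc s hs.1
  obtain ⟨σ₁, hσ₁, hφ₁⟩ := hacc σ₂ hσ₂.1
  have hin : ∀ x, σ₁ ≤ x → x ≤ s → x ∈ Ioo 0 ε := fun x h1 h2 =>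
    ⟨hσ₁.1.trans_le h1, h2.trans_lt hsε⟩
  obtain ⟨a, ha, hpa⟩ : ∃ a ∈ Ioo σ₁ σ₂, p a = 0 := by
    obtain ⟨a, ha, ha'⟩ := exists_hasDerivAt_eq_zero hσ₁.2
      (h.φ_cont.mono fun x hx => hin x hx.1 (hx.2.trans hσ₂.2.le)) (hφ₁.trans hφ₂.symm)
      (fun x hx => h.deriv x (hin x hx.1.le (hx.2.le.trans hσ₂.2.le)))
    exact ⟨a, ha, (mul_eq_zero.1 ha').resolve_left (pow_pos (hσ₁.1.trans ha.1) j).ne'⟩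
  have has : a ≤ s := ha.2.le.trans hσ₂.2.le
  obtain ⟨ξ, hξ, hpξ, hξne⟩ := exists_last_zero has
    (h.p_cont.mono fun x hx => hin x (ha.1.le.trans hx.1) hx.2) hpa
  have hσξ : σ₁ < ξ := ha.1.trans_le hξ.1
  have hξ0 : 0 < ξ := hσ₁.1.trans hσξ
  have hξs : ξ < s := lt_of_le_of_ne hξ.2 fun he => hp.ne (he ▸ hpξ)
  have hpneg : ∀ x ∈ Ioc ξ s, p x < 0 := by
    rcases neg_or_pos_of_ne_zero isPreconnected_Ioc
      (h.p_cont.mono fun x hx => hin x (hσξ.le.trans hx.1.le) hx.2) hξne with h1 | h1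
    · exact h1
    · exact absurd hp (not_lt.2 (h1 s ⟨hξs, le_rfl⟩).le)
  have hφpos : ∀ x ∈ Ico ξ s, 0 < φ x := by
    intro x hx
    obtain ⟨y, hy, hy'⟩ := exists_hasDerivAt_eq_slope φ (fun s => s ^ j * p s) hx.2
      (h.φ_cont.mono fun y hy => hin y (hσξ.le.trans (hx.1.trans hy.1)) hy.2)
      (fun y hy => h.deriv y (hin y (hσξ.le.trans (hx.1.trans hy.1.le)) hy.2.le))
    have hneg : y ^ j * p y < 0 := mul_neg_of_pos_of_neg
      (pow_pos (hξ0.trans (hx.1.trans_lt hy.1)) _) (hpneg y ⟨hx.1.trans_lt hy.1, hy.2.le⟩)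
    rw [hy', h0, zero_sub] at hneg
    by_contra! hcon
    exact absurd hneg (not_lt.2 (div_nonneg (by linarith) (sub_pos.2 hx.2).le))
  have hφξ := hφpos ξ ⟨le_rfl, hξs⟩
  obtain ⟨r, hr, hφr, hrne⟩ := exists_last_zero hσξ.le
    (h.φ_cont.mono fun x hx => hin x hx.1 (hx.2.trans hξs.le)) hφ₁
  have hrξ : r < ξ := lt_of_le_of_ne hr.2 fun he => hφξ.ne' (he ▸ hφr)
  have hr0 : 0 < r := hσ₁.1.trans_le hr.1
  have hexc : ∀ x ∈ Ioo r s, 0 < φ x := by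
    intro x hx
    rcases le_or_gt ξ x with h1 | h1
    · exact hφpos x ⟨h1, hx.2⟩
    rcases neg_or_pos_of_ne_zero isPreconnected_Ioc
      (h.φ_cont.mono fun x hx => hin x (hr.1.trans hx.1.le) (hx.2.trans hξs.le)) hrne with h2 | h2
    · exact absurd (h2 ξ ⟨hrξ, le_rfl⟩) (not_lt.2 hφξ.le)
    · exact h2 x ⟨hx.1, h1.le⟩
  have hder := h.pos_deriv r s hr0 (hrξ.trans hξs) hsε hexc
  have hinr : ∀ x, r ≤ x → x ≤ s → x ∈ Ioo 0 ε := fun x h1 h2 => hin x (hr.1.trans h1) h2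
  have hpr := h.p_nonneg_of_pos hr0 (hrξ.trans hξs) hsε hφr hexc
  have hFp : ∀ x, r ≤ x → x ≤ s → Fp x ≤ γ / 2 ∧ 3 * γ / 2 ≤ Fp x := by
    intro x h1 h2
    have := abs_le.1 (h.Fp_est x (hinr x h1 h2))
    rw [abs_of_neg hγ] at this
    constructor <;> linarith [this.1, this.2]
  have hpnn : ∀ x ∈ Icc r ξ, 0 ≤ p x := by
    intro x hx
    rw [← hpξ]
    exact le_of_right_deriv_nonpos hx.2
      (h.p_cont.mono fun y hy => hinr y (hx.1.trans hy.1) (hy.2.trans hξs.le))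
      (fun y hy => (hder y ⟨hx.1.trans hy.1, hy.2.trans hξs⟩).1)
      (fun y hy => by linarith [(hFp y (hx.1.trans hy.1) (hy.2.le.trans hξs.le)).1])
  have hξj : 0 < ξ ^ j := pow_pos hξ0 j
  -- With `Fp = γ` and `j = 0` the quantity `p² / 2 - γ φ` would be conserved. Here `Fp` lies
  -- between `3γ/2` and `γ/2`, and `x ^ j` is below `ξ ^ j` on the rise and above it on the fall. So
  -- `k = -γ / (2 ξ ^ j)` on the rise and `3k` on the fall make `p² / 2 + k φ` nonincreasing;
  -- together they give `p(s)² ≤ 3 p(r)²`.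
  have hV : ∀ k : ℝ, ∀ a b, r ≤ a → a ≤ b → b ≤ s →
      (∀ x ∈ Ico a b, p x * Fp x + k * (x ^ j * p x) ≤ 0) →
      p b ^ 2 / 2 + k * φ b ≤ p a ^ 2 / 2 + k * φ a := by
    intro k a b h1 h2 h3 h4
    refine le_of_right_deriv_nonpos (f := fun x => p x ^ 2 / 2 + k * φ x)
      (f' := fun x => p x * Fp x + k * (x ^ j * p x)) h2 ?_ ?_ h4
    · have hsub : Icc a b ⊆ Ioo 0 ε := fun y hy => hinr y (h1.trans hy.1) (hy.2.trans h3)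
      exact (((h.p_cont.mono hsub).pow 2).div_const 2).add
        (continuousOn_const.mul (h.φ_cont.mono hsub))
    · intro x hx
      have h5 := (hder x ⟨h1.trans hx.1, hx.2.trans_le h3⟩).1
      have h6 := (h.deriv x (hinr x (h1.trans hx.1) (hx.2.le.trans h3))).hasDerivWithinAt (s := Ici x)
      refine (((h5.pow 2).div_const 2).add (h6.const_mul k)).congr_deriv ?_
      simp; ring
  have hV1 := hV (-γ / 2 / ξ ^ j) r ξ le_rfl hrξ.le hξs.le fun x hx => by
    have h1 := (hFp x hx.1 (hx.2.le.trans hξs.le)).1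
    have h2 : x ^ j / ξ ^ j ≤ 1 := by
      rw [div_le_one hξj]; exact pow_le_pow_left₀ (hr0.le.trans hx.1) hx.2.le j
    have h3 := hpnn x ⟨hx.1, hx.2.le⟩
    have h4 : p x * Fp x + -γ / 2 / ξ ^ j * (x ^ j * p x)
        = p x * (Fp x + -γ / 2 * (x ^ j / ξ ^ j)) := by ring
    rw [h4]
    exact mul_nonpos_of_nonneg_of_nonpos h3 (by nlinarith)
  have hV2 := hV (3 * (-γ / 2 / ξ ^ j)) ξ s hrξ.le hξs.le le_rfl fun x hx => by
    have h1 := (hFp x (hrξ.le.trans hx.1) hx.2.le).2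
    have h2 : 1 ≤ x ^ j / ξ ^ j := by
      rw [one_le_div hξj]; exact pow_le_pow_left₀ hξ0.le hx.1 j
    have h3 : p x ≤ 0 := by
      rcases eq_or_lt_of_le hx.1 with h4 | h4
      · rw [← h4, hpξ]
      · exact (hpneg x ⟨h4, hx.2.le⟩).le
    have h4 : p x * Fp x + 3 * (-γ / 2 / ξ ^ j) * (x ^ j * p x)
        = p x * (Fp x + 3 * (-γ / 2) * (x ^ j / ξ ^ j)) := by ring
    rw [h4]
    exact mul_nonpos_of_nonpos_of_nonneg h3 (by nlinarith)
  rw [hpξ, hφr] at hV1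
  rw [h0, hpξ] at hV2
  have hpr2 := hup r ⟨hr0, (hrξ.trans hξs).trans hs.2⟩
  have hrs : r ^ m ≤ s ^ m := pow_le_pow_left₀ hr0.le (hrξ.trans hξs).le m
  have hle : p r ≤ 2 * c * s ^ m := hpr2.trans (mul_le_mul_of_nonneg_left hrs (by linarith))
  refine abs_le_of_sq_le_sq ?_ (by positivity)
  have h5 : p r ^ 2 ≤ (2 * c * s ^ m) ^ 2 := pow_le_pow_left₀ hpr hle 2
  nlinarith

/-- The energy of the oscillation of `φ`. -/
noncomputable def energy (j : ℕ) (φ p Fn Fp : ℝ → ℝ) (x : ℝ) : ℝ :=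
  x ^ j * p x ^ 2 / 2 - Fn x * min (φ x) 0 - Fp x * max (φ x) 0

/-- On the side where `p' = F` the energy is `x ^ j p² / 2 - F φ`, and since `φ' = x ^ j p` the
terms `x ^ j p F` cancel. There remains `j x ^ (j - 1) p² / 2 - F' φ`, which the hypotheses bound by
`K / x` times the energy. Which formula applies at `x` depends on the sign of `φ` directly to the
right of `x`. -/
theorem exists_energy_deriv (h : SwitchGerm ε β γ c C j m φ p D Fn Fn' Fp Fp') {K x : ℝ}
    (hjK : (j : ℝ) ≤ K) (hx : x ∈ Ioo 0 ε)
    (hn : φ x < 0 → x * Fn' x ≤ K * Fn x) (hp : 0 < φ x → K * Fp x ≤ x * Fp' x) :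
    ∃ d, HasDerivWithinAt (energy j φ p Fn Fp) d (Ici x) x ∧ x * d ≤ K * energy j φ p Fn Fp x := by
  have hxj : x * ((j : ℝ) * x ^ (j - 1)) = j * x ^ j := by
    rcases j with _ | k
    · simp
    · simp [pow_succ]; ring
  have hsq : (j : ℝ) * (x ^ j * p x ^ 2 / 2) ≤ K * (x ^ j * p x ^ 2 / 2) :=
    mul_le_mul_of_nonneg_right hjK (by have := pow_pos hx.1 j; positivity)
  have hφd := (h.deriv x hx).hasDerivWithinAt (s := Ici x)
  have hpow : HasDerivWithinAt (fun x : ℝ => x ^ j) (j * x ^ (j - 1)) (Ici x) x :=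
    (hasDerivAt_pow j x).hasDerivWithinAt
  have hneg : ∀ t, x < t → t < ε → (∀ r ∈ Ioo x t, φ r < 0) → φ x ≤ 0 →
      ∃ d, HasDerivWithinAt (energy j φ p Fn Fp) d (Ici x) x ∧
        x * d ≤ K * energy j φ p Fn Fp x := by
    intro t hxt ht hr hφ0
    obtain ⟨h1, h2⟩ := h.neg_deriv x t hx.1 hxt ht hr x ⟨le_rfl, hxt⟩
    have hev : ∀ y ∈ Ico x t, energy j φ p Fn Fp y = y ^ j * p y ^ 2 / 2 - Fn y * φ y := by
      intro y hy
      have hy0 : φ y ≤ 0 := by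
        rcases eq_or_lt_of_le hy.1 with h3 | h3
        · rwa [← h3]
        · exact (hr y ⟨h3, hy.2⟩).le
      simp [energy, min_eq_left hy0, max_eq_right hy0]
    refine ⟨(j * x ^ (j - 1)) * p x ^ 2 / 2 - Fn' x * φ x, ?_, ?_⟩
    · have h3 := ((hpow.mul (h1.pow 2)).div_const 2).sub (h2.mul hφd)
      refine (h3.congr_deriv ?_).congr_of_eventuallyEq ?_ (hev x ⟨le_rfl, hxt⟩)
      · simp; ring
      · filter_upwards [Ico_mem_nhdsGE hxt] with y hy using hev y hy
    · rw [hev x ⟨le_rfl, hxt⟩]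
      have h4 : x * (j * x ^ (j - 1) * p x ^ 2 / 2 - Fn' x * φ x)
          = j * (x ^ j * p x ^ 2 / 2) + (x * Fn' x) * (-φ x) := by
        linear_combination (p x ^ 2 / 2) * hxj
      rw [h4]
      have h5 : (x * Fn' x) * (-φ x) ≤ K * Fn x * (-φ x) := by
        rcases eq_or_lt_of_le hφ0 with h6 | h6
        · simp [h6]
        · exact mul_le_mul_of_nonneg_right (hn h6) (by linarith)
      linarith
  have hpos : ∀ t, x < t → t < ε → (∀ r ∈ Ioo x t, 0 < φ r) → 0 ≤ φ x →
      ∃ d, HasDerivWithinAt (energy j φ p Fn Fp) d (Ici x) x ∧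
        x * d ≤ K * energy j φ p Fn Fp x := by
    intro t hxt ht hr hφ0
    obtain ⟨h1, h2⟩ := h.pos_deriv x t hx.1 hxt ht hr x ⟨le_rfl, hxt⟩
    have hev : ∀ y ∈ Ico x t, energy j φ p Fn Fp y = y ^ j * p y ^ 2 / 2 - Fp y * φ y := by
      intro y hy
      have hy0 : 0 ≤ φ y := by
        rcases eq_or_lt_of_le hy.1 with h3 | h3
        · rwa [← h3]
        · exact (hr y ⟨h3, hy.2⟩).le
      simp [energy, min_eq_right hy0, max_eq_left hy0]
    refine ⟨(j * x ^ (j - 1)) * p x ^ 2 / 2 - Fp' x * φ x, ?_, ?_⟩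
    · have h3 := ((hpow.mul (h1.pow 2)).div_const 2).sub (h2.mul hφd)
      refine (h3.congr_deriv ?_).congr_of_eventuallyEq ?_ (hev x ⟨le_rfl, hxt⟩)
      · simp; ring
      · filter_upwards [Ico_mem_nhdsGE hxt] with y hy using hev y hy
    · rw [hev x ⟨le_rfl, hxt⟩]
      have h4 : x * (j * x ^ (j - 1) * p x ^ 2 / 2 - Fp' x * φ x)
          = j * (x ^ j * p x ^ 2 / 2) - (x * Fp' x) * φ x := by
        linear_combination (p x ^ 2 / 2) * hxj
      rw [h4]
      have h5 : K * Fp x * φ x ≤ (x * Fp' x) * φ x := by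
        rcases eq_or_lt_of_le hφ0 with h6 | h6
        · simp [← h6]
        · exact mul_le_mul_of_nonneg_right (hp h6) h6.le
      linarith
  have hφc : ContinuousAt φ x := (h.deriv x hx).continuousAt
  have hpc : ContinuousAt p x := h.p_cont.continuousAt (isOpen_Ioo.mem_nhds hx)
  rcases lt_trichotomy (φ x) 0 with h0 | h0 | h0
  · obtain ⟨η, hη, hball⟩ := Metric.eventually_nhds_iff.1
      ((hφc.eventually (gt_mem_nhds h0)).and (gt_mem_nhds hx.2))
    have hin : ∀ r, x ≤ r → r < x + η → φ r < 0 ∧ r < ε := fun r h1 h2 =>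
      hball (by rw [Real.dist_eq, abs_lt]; constructor <;> linarith)
    exact hneg (x + η / 2) (by linarith) (hin _ (by linarith) (by linarith)).2
      (fun r hr => (hin r hr.1.le (by linarith [hr.2])).1) h0.le
  · rcases lt_trichotomy (p x) 0 with h1 | h1 | h1
    · obtain ⟨t, h2, h3, h4⟩ := h.exists_right_neg hx h0 h1
      exact hneg t h2 h3 h4 h0.le
    -- When `φ` and `p` both vanish, no sign to the right is available, and `φ` may oscillate. But
    -- `p` is Lipschitz, so `p²` is of second order, and `φ` is `o(y - x)`; hence the energy has
    -- derivative 0.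
    · refine ⟨0, ?_, by simp [energy, h0, h1]⟩
      have hφo : φ =o[𝓝 x] fun y => y - x := by
        have := hasDerivAt_iff_isLittleO.1 (h.deriv x hx)
        simpa [h0, h1] using this
      have hpO : p =O[𝓝 x] fun y => y - x := by
        refine Asymptotics.IsBigO.of_bound C ?_
        filter_upwards [isOpen_Ioo.mem_nhds hx] with y hy
        have := h.lip y hy x hx
        rwa [h1, sub_zero] at this
      have hp1 : p =o[𝓝 x] fun _ => (1 : ℝ) := by
        rw [Asymptotics.isLittleO_one_iff]
        simpa [ContinuousAt, h1] using hpc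
      have hFn1 : Fn =O[𝓝 x] fun _ => (1 : ℝ) :=
        (h.Fn_cont.continuousAt (isOpen_Ioo.mem_nhds hx)).tendsto.isBigO_one ℝ
      have hFp1 : Fp =O[𝓝 x] fun _ => (1 : ℝ) :=
        (h.Fp_cont.continuousAt (isOpen_Ioo.mem_nhds hx)).tendsto.isBigO_one ℝ
      have hmin : (fun y => min (φ y) 0) =O[𝓝 x] φ := by
        refine Asymptotics.IsBigO.of_bound 1 (Eventually.of_forall fun y => ?_)
        rw [one_mul, Real.norm_eq_abs, Real.norm_eq_abs]
        rcases le_total (φ y) 0 with h2 | h2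
        · rw [min_eq_left h2]
        · rw [min_eq_right h2, abs_zero]; exact abs_nonneg _
      have hmax : (fun y => max (φ y) 0) =O[𝓝 x] φ := by
        refine Asymptotics.IsBigO.of_bound 1 (Eventually.of_forall fun y => ?_)
        rw [one_mul, Real.norm_eq_abs, Real.norm_eq_abs]
        rcases le_total (φ y) 0 with h2 | h2
        · rw [max_eq_right h2, abs_zero]; exact abs_nonneg _
        · rw [max_eq_left h2]
      have hpw : (fun y : ℝ => y ^ j / 2) =O[𝓝 x] fun _ => (1 : ℝ) :=
        (show ContinuousAt (fun y : ℝ => y ^ j / 2) x by fun_prop).tendsto.isBigO_one ℝ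
      have t1 := hpw.mul_isLittleO (hp1.mul_isBigO hpO)
      have t2 := hFn1.mul_isLittleO (hmin.trans_isLittleO hφo)
      have t3 := hFp1.mul_isLittleO (hmax.trans_isLittleO hφo)
      simp only [one_mul] at t1 t2 t3
      have t4 := (t1.sub t2).sub t3
      refine HasDerivAt.hasDerivWithinAt (hasDerivAt_iff_isLittleO.2 ?_)
      refine t4.congr (fun y => ?_) (fun y => rfl)
      simp [energy, h0, h1]; ring
    · obtain ⟨t, h2, h3, h4⟩ := h.exists_right_pos hx h0 h1
      exact hpos t h2 h3 h4 h0.ge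
  · obtain ⟨η, hη, hball⟩ := Metric.eventually_nhds_iff.1
      ((hφc.eventually (lt_mem_nhds h0)).and (gt_mem_nhds hx.2))
    have hin : ∀ r, x ≤ r → r < x + η → 0 < φ r ∧ r < ε := fun r h1 h2 =>
      hball (by rw [Real.dist_eq, abs_lt]; constructor <;> linarith)
    exact hpos (x + η / 2) (by linarith) (hin _ (by linarith) (by linarith)).2
      (fun r hr => (hin r hr.1.le (by linarith [hr.2])).1) h0.le

theorem energy_cont (h : SwitchGerm ε β γ c C j m φ p D Fn Fn' Fp Fp') :
    ContinuousOn (energy j φ p Fn Fp) (Ioo 0 ε) := by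
  have h1 := h.p_cont
  have h2 := h.φ_cont
  have h3 := h.Fn_cont
  have h4 := h.Fp_cont
  unfold energy
  fun_prop

/-- If the logarithmic growth of the energy is at most that of `x ^ k`, then `energy / x ^ k` does
not increase. -/
theorem energy_div_le (h : SwitchGerm ε β γ c C j m φ p D Fn Fn' Fp Fp') {k : ℕ} {a b : ℝ}
    (hjk : j ≤ k) (ha : 0 < a) (hab : a ≤ b) (hb : b < ε)
    (hn : ∀ x ∈ Ico a b, φ x < 0 → x * Fn' x ≤ k * Fn x)
    (hp : ∀ x ∈ Ico a b, 0 < φ x → k * Fp x ≤ x * Fp' x) :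
    energy j φ p Fn Fp b / b ^ k ≤ energy j φ p Fn Fp a / a ^ k := by
  have hex : ∀ x ∈ Ico a b, ∃ d, HasDerivWithinAt (energy j φ p Fn Fp) d (Ici x) x ∧
      x * d ≤ k * energy j φ p Fn Fp x := fun x hx =>
    h.exists_energy_deriv (by exact_mod_cast hjk) ⟨ha.trans_le hx.1, hx.2.trans hb⟩ (hn x hx)
      (hp x hx)
  choose! d hd1 hd2 using hex
  have hsub : Icc a b ⊆ Ioo 0 ε := fun x hx => ⟨ha.trans_le hx.1, hx.2.trans_lt hb⟩
  refine le_of_right_deriv_nonpos (f := fun x => energy j φ p Fn Fp x / x ^ k)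
    (f' := fun x => (d x * x ^ k - energy j φ p Fn Fp x * (k * x ^ (k - 1))) / (x ^ k) ^ 2) hab ?_
    ?_ ?_
  · exact (h.energy_cont.mono hsub).div (by fun_prop) fun x hx => (pow_pos (hsub hx).1 k).ne'
  · intro x hx
    exact (hd1 x hx).div (hasDerivAt_pow k x).hasDerivWithinAt (pow_pos (ha.trans_le hx.1) k).ne'
  · intro x hx
    have hx0 : 0 < x := ha.trans_le hx.1
    refine div_nonpos_of_nonpos_of_nonneg ?_ (by positivity)
    have hxk : x * ((k : ℝ) * x ^ (k - 1)) = k * x ^ k := by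
      rcases k with _ | i
      · simp
      · simp [pow_succ]; ring
    have h1 := mul_le_mul_of_nonneg_right (hd2 x hx) (pow_pos hx0 k).le
    have h2 : x * (d x * x ^ k - energy j φ p Fn Fp x * (k * x ^ (k - 1))) ≤ 0 := by
      have : x * (d x * x ^ k - energy j φ p Fn Fp x * (k * x ^ (k - 1)))
          = x * d x * x ^ k - k * energy j φ p Fn Fp x * x ^ k := by
        linear_combination (-energy j φ p Fn Fp x) * hxk
      linarith
    by_contra! hcon
    exact absurd (mul_pos hx0 hcon) (not_lt.2 h2)

set_option maxHeartbeats 1000000 in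
/-- Oscillator case: the zeros of `φ` do not accumulate, unless `φ = 0`. -/
theorem hasSignGerm_oscillator (h : SwitchGerm ε β γ c C j m φ p D Fn Fn' Fp Fp') (hβ : 0 < β)
    (hγ : γ < 0) (hc : c ≠ 0) : HasSignGerm φ := by
  have hC := h.C_pos
  have hε := h.ε_pos
  have hm1 : (1 : ℝ) ≤ m := by exact_mod_cast h.m_pos
  -- For `c < 0` both `c s ^ m` and `-β D` push `p` down, so `p < 0`. Only `c > 0` needs the energy.
  rcases lt_or_gt_of_ne hc with hc | hc
  · have hc' : 0 < -c := by linarith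
    refine h.hasSignGerm_of_p_neg (δ := min ε (min (β / C) (-c / C))) (by positivity)
      (min_le_left _ _) fun s hs => ?_
    have hsI : s ∈ Ioo 0 ε := ⟨hs.1, hs.2.trans_le (min_le_left _ _)⟩
    have h1 : C * s < β := by
      rw [mul_comm, ← lt_div_iff₀ hC]
      exact hs.2.trans_le ((min_le_right _ _).trans (min_le_left _ _))
    have h2 : C * s < -c := by
      rw [mul_comm, ← lt_div_iff₀ hC]
      exact hs.2.trans_le ((min_le_right _ _).trans (min_le_right _ _))
    have h3 := (abs_le.1 (h.p_est s hsI)).2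
    have h4 := mul_le_mul_of_nonneg_right h1.le (h.D_nonneg s hsI)
    have h5 := mul_lt_mul_of_pos_right h2 (pow_pos hs.1 m)
    rw [pow_succ] at h3
    nlinarith
  -- At a zero of `φ` one has `|p| ≤ 4 c s ^ m`, and `hDp` yields `β / 2 * D ≤ 2 c s ^ m + 4 c s ^
  -- m`.
  set K := 12 * c / β with hK
  have hKpos : 0 < K := by positivity
  have hγ' : 0 < -γ := by linarith
  obtain ⟨δ, hδ, hδε, hδ1, hδ2, hδ3, hδ4⟩ : ∃ δ > 0, δ ≤ ε ∧ C * δ ≤ β / 2 ∧ C * δ ≤ c ∧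
      C * δ ≤ -γ / 2 ∧ C * (K + 1) * δ ≤ c / 2 := by
    refine ⟨min (min ε (β / 2 / C)) (min (c / C) (min (-γ / 2 / C) (c / 2 / (C * (K + 1))))),
      by positivity, (min_le_left _ _).trans (min_le_left _ _), ?_, ?_, ?_, ?_⟩
    · rw [mul_comm, ← le_div_iff₀ hC]; exact (min_le_left _ _).trans (min_le_right _ _)
    · rw [mul_comm, ← le_div_iff₀ hC]; exact (min_le_right _ _).trans (min_le_left _ _)
    · rw [mul_comm, ← le_div_iff₀ hC]
      exact (min_le_right _ _).trans ((min_le_right _ _).trans (min_le_left _ _))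
    · rw [mul_comm, ← le_div_iff₀ (by positivity)]
      exact (min_le_right _ _).trans ((min_le_right _ _).trans (min_le_right _ _))
  have hDp : ∀ s ∈ Ioo 0 δ, β / 2 * D s ≤ 2 * c * s ^ m - p s := by
    intro s hs
    have hsI : s ∈ Ioo 0 ε := ⟨hs.1, hs.2.trans_le hδε⟩
    have h1 := (mul_le_mul_of_nonneg_left hs.2.le hC.le).trans hδ1
    have h2 := (mul_le_mul_of_nonneg_left hs.2.le hC.le).trans hδ2
    have h3 := (abs_le.1 (h.p_est s hsI)).2
    have h4 := mul_le_mul_of_nonneg_right h1 (h.D_nonneg s hsI)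
    have h5 := mul_le_mul_of_nonneg_right h2 (pow_pos hs.1 m).le
    rw [pow_succ] at h3
    nlinarith
  have hup : ∀ s ∈ Ioo 0 δ, p s ≤ 2 * c * s ^ m := fun s hs => by
    have h1 := hDp s hs
    have h2 := mul_nonneg (half_pos hβ).le (h.D_nonneg s ⟨hs.1, hs.2.trans_le hδε⟩)
    linarith
  refine HasSignGerm.of_no_excursion hδ (h.φ_cont.mono (Ioo_subset_Ioo le_rfl hδε)) ?_
  intro hacc r t hr hrt ht hφr hφt hsign
  have hzero : ∀ s ∈ Ioo 0 δ, φ s = 0 → |p s| ≤ 4 * c * s ^ m := fun s hs h0 =>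
    h.abs_p_le_of_zero hδε hγ hc hup hacc hs h0
  -- The point `x` belongs to a negative arc that starts at a zero `s` of `φ`; `D` is bounded there
  -- and frozen afterwards. Hence `Fn` is close to `c m x ^ (m - 1)`, with logarithmic growth about
  -- `(m - 1) / x`, below the exponent `j + m` allowed to the energy.
  have hFn : ∀ x ∈ Ioo 0 δ, φ x < 0 → 0 < Fn x ∧ x * Fn' x ≤ (j + m : ℕ) * Fn x := by
    intro x hx hφx
    have hxI : x ∈ Ioo 0 ε := ⟨hx.1, hx.2.trans_le hδε⟩
    obtain ⟨σ, hσ, hφσ⟩ := hacc x hx.1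
    obtain ⟨s, hs, hφs, hne⟩ := exists_last_zero hσ.2.le
      (h.φ_cont.mono fun y hy => ⟨hσ.1.trans_le hy.1, hy.2.trans_lt hxI.2⟩) hφσ
    have hs0 : 0 < s := hσ.1.trans_le hs.1
    have hsx : s < x := lt_of_le_of_ne hs.2 fun he => hφx.ne (he ▸ hφs)
    have hneg : ∀ y ∈ Ioc s x, φ y < 0 := by
      rcases neg_or_pos_of_ne_zero isPreconnected_Ioc
        (h.φ_cont.mono fun y hy => ⟨hs0.trans hy.1, hy.2.trans_lt hxI.2⟩) hne with h1 | h1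
      · exact h1
      · exact absurd hφx (not_lt.2 (h1 x ⟨hsx, le_rfl⟩).le)
    have hsδ : s ∈ Ioo 0 δ := ⟨hs0, hsx.trans hx.2⟩
    have hDx : D x ≤ K * x ^ m := by
      rw [h.D_const s x hs0 hsx hxI.2 fun y hy => hneg y ⟨hy.1, hy.2.le⟩, hK, div_mul_eq_mul_div,
        le_div_iff₀ hβ]
      have h1 := hDp s hsδ
      have h2 := (abs_le.1 (hzero s hsδ hφs)).1
      have h3 : s ^ m ≤ x ^ m := pow_le_pow_left₀ hs0.le hsx.le m
      nlinarith
    obtain ⟨k, rfl⟩ : ∃ k, m = k + 1 := ⟨m - 1, by have := h.m_pos; omega⟩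
    have h1 := abs_le.1 (h.Fn_est x hxI)
    have h2 := (abs_le.1 (h.Fn'_est x hxI)).2
    simp only [Nat.add_sub_cancel] at h1 h2
    have hxk : 0 < x ^ k := pow_pos hx.1 k
    have h3 : C * (D x + x ^ (k + 1)) ≤ c / 2 * x ^ k := by
      have h4 := mul_le_mul_of_nonneg_right
        ((mul_le_mul_of_nonneg_left hx.2.le (by positivity : 0 ≤ C * (K + 1))).trans hδ4) hxk.le
      have h5 := mul_le_mul_of_nonneg_left hDx hC.le
      rw [pow_succ] at h5 ⊢
      nlinarith
    have hcx : 0 < c * x ^ k := mul_pos hc hxk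
    have hFpos : c / 2 * x ^ k ≤ Fn x := by nlinarith
    refine ⟨by linarith, ?_⟩
    have h4 : ((k + 1 : ℕ) : ℝ) * Fn x ≤ ((j + (k + 1) : ℕ) : ℝ) * Fn x :=
      mul_le_mul_of_nonneg_right (by exact_mod_cast (by omega)) (by linarith)
    refine le_trans ?_ h4
    set M : ℝ := ((k + 1 : ℕ) : ℝ)
    have h5 : M * (c * M * x ^ k - c / 2 * x ^ k) ≤ M * Fn x :=
      mul_le_mul_of_nonneg_left (by linarith [h1.1]) (by linarith)
    have h6 : c * x ^ k ≤ M * (c * x ^ k) := by nlinarith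
    nlinarith
  -- `Fp` stays below `γ / 2 < 0`, while `x * Fp'` is as small as `x`.
  have hFp : ∀ x ∈ Ioo 0 δ, Fp x < 0 ∧ ((j + m : ℕ) : ℝ) * Fp x ≤ x * Fp' x := by
    intro x hx
    have hxI : x ∈ Ioo 0 ε := ⟨hx.1, hx.2.trans_le hδε⟩
    have h1 := (abs_le.1 (h.Fp_est x hxI)).2
    rw [abs_of_neg hγ] at h1
    have h2 := (abs_le.1 (h.Fp'_est x hxI)).1
    have h3 := (mul_le_mul_of_nonneg_left hx.2.le hC.le).trans hδ3
    have h4 : (1 : ℝ) ≤ ((j + m : ℕ) : ℝ) := by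
      have := h.m_pos
      exact_mod_cast (by omega : 1 ≤ j + m)
    have h5 := mul_le_mul_of_nonneg_left h2 hx.1.le
    exact ⟨by linarith, by nlinarith⟩
  obtain ⟨s, hs⟩ := exists_between hrt
  have hsδ : s ∈ Ioo 0 δ := ⟨hr.trans hs.1, hs.2.trans ht⟩
  have hEs : 0 < energy j φ p Fn Fp s := by
    have h1 : 0 ≤ s ^ j * p s ^ 2 / 2 := by have := pow_pos hsδ.1 j; positivity
    rcases hsign with h2 | h2
    · have h3 := h2 s hs
      rw [energy, min_eq_left h3.le, max_eq_right h3.le]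
      nlinarith [mul_pos (hFn s hsδ h3).1 (neg_pos.2 h3)]
    · have h3 := h2 s hs
      rw [energy, min_eq_right h3.le, max_eq_left h3.le]
      nlinarith [mul_pos (neg_pos.2 (hFp s hsδ).1) h3]
  have hN : 0 < energy j φ p Fn Fp s / s ^ (j + m) := div_pos hEs (pow_pos hsδ.1 _)
  -- At a zero `σ` only the kinetic term is left, so the normalized energy is at most `(4 c σ ^ m)²
  -- / (2 σ ^ m) = 8 c² σ ^ m`. Taking `σ` this small puts it below its value at `s`, although it
  -- does not increase from `σ` to `s`.
  obtain ⟨σ, hσ, hφσ⟩ := hacc (min s (min 1 (energy j φ p Fn Fp s / s ^ (j + m) / (8 * c ^ 2))))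
    (by have := hsδ.1; positivity)
  have hσs : σ < s := hσ.2.trans_le (min_le_left _ _)
  have hσ1 : σ < 1 := hσ.2.trans_le ((min_le_right _ _).trans (min_le_left _ _))
  have hσ2 : σ * (8 * c ^ 2) < energy j φ p Fn Fp s / s ^ (j + m) := by
    rw [← lt_div_iff₀ (by positivity)]
    exact hσ.2.trans_le ((min_le_right _ _).trans (min_le_right _ _))
  have hσδ : σ ∈ Ioo 0 δ := ⟨hσ.1, hσs.trans hsδ.2⟩
  have hle := h.energy_div_le (k := j + m) (by omega) hσ.1 hσs.le (hsδ.2.trans_le hδε)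
    (fun x hx hφx => (hFn x ⟨hσ.1.trans_le hx.1, hx.2.trans hsδ.2⟩ hφx).2)
    (fun x hx _ => (hFp x ⟨hσ.1.trans_le hx.1, hx.2.trans hsδ.2⟩).2)
  have hEσ : energy j φ p Fn Fp σ / σ ^ (j + m) ≤ 8 * c ^ 2 * σ ^ m := by
    have hσm := pow_pos hσ.1 m
    have hσj := pow_pos hσ.1 j
    rw [energy, hφσ, div_le_iff₀ (pow_pos hσ.1 _), pow_add]
    have h1 : p σ ^ 2 ≤ (4 * c * σ ^ m) ^ 2 := by
      rw [← sq_abs]; exact pow_le_pow_left₀ (abs_nonneg _) (hzero σ hσδ hφσ) 2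
    have h2 := mul_le_mul_of_nonneg_left h1 hσj.le
    simp only [min_self, max_self, mul_zero, sub_zero]
    nlinarith
  have hσm : σ ^ m ≤ σ := by
    simpa using pow_le_pow_of_le_one hσ.1.le hσ1.le h.m_pos
  have h8 := mul_le_mul_of_nonneg_left hσm (by positivity : 0 ≤ 8 * c ^ 2)
  have h9 := hle.trans hEσ
  linarith

end SwitchGerm

/-! ### Rotations, leading terms of analytic functions, and the derivative of the switching
function. -/

/-- The unit complex number `exp (-i x)`. -/
noncomputable def rot (x : ℝ) : ℂ := Complex.exp (-(x * Complex.I))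

theorem norm_rot (x : ℝ) : ‖rot x‖ = 1 := by
  have : -((x : ℂ) * Complex.I) = ((-x : ℝ) : ℂ) * Complex.I := by push_cast; ring
  rw [rot, this, Complex.norm_exp_ofReal_mul_I]

theorem rot_add (x y : ℝ) : rot (x + y) = rot x * rot y := by
  simp only [rot, ← Complex.exp_add]; congr 1; push_cast; ring

theorem hasDerivAt_rot (x : ℝ) : HasDerivAt rot (-Complex.I * rot x) x := by
  have h1 : HasDerivAt (fun y : ℝ => -((y : ℂ) * Complex.I)) (-(1 * Complex.I)) x :=
    ((Complex.ofRealCLM.hasDerivAt (x := x)).mul_const Complex.I).neg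
  exact h1.cexp.congr_deriv (by simp only [rot]; ring)

theorem continuous_rot : Continuous rot := by unfold rot; fun_prop

theorem analyticAt_rot (x : ℝ) : AnalyticAt ℝ rot x := by
  have h1 : AnalyticAt ℝ (fun y : ℝ => -((y : ℂ) * Complex.I)) x :=
    ((Complex.ofRealCLM.analyticAt x).mul analyticAt_const).neg
  have h2 : AnalyticAt ℝ Complex.exp (-((x : ℂ) * Complex.I)) :=
    analyticAt_cexp.restrictScalars
  exact AnalyticAt.comp (f := fun y : ℝ => -((y : ℂ) * Complex.I)) h2 h1

theorem norm_rot_sub_le (x y : ℝ) : ‖rot x - rot y‖ ≤ |x - y| := by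
  have h1 : rot x - rot y = rot y * (Complex.exp (Complex.I * ((y - x : ℝ) : ℂ)) - 1) := by
    rw [mul_sub, mul_one, rot, rot, ← Complex.exp_add]
    congr 2; push_cast; ring
  rw [h1, norm_mul, norm_rot, one_mul, abs_sub_comm]
  exact Real.norm_exp_I_mul_ofReal_sub_one_le

theorem norm_rot_neg_sub_le {D : ℝ} (h0 : 0 ≤ D) (h1 : D ≤ 1) :
    ‖rot (-D) - 1 - Complex.I * D‖ ≤ D ^ 2 := by
  have h2 : -(((-D : ℝ) : ℂ) * Complex.I) = Complex.I * D := by push_cast; ring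
  have h3 : ‖Complex.I * (D : ℂ)‖ = D := by simp [abs_of_nonneg h0]
  rw [rot, h2]
  have := Complex.norm_exp_sub_one_sub_id_le (x := Complex.I * D) (by rw [h3]; exact h1)
  rwa [h3] at this

/-- Leading term of a nonzero analytic function and of its first two derivatives. -/
theorem AnalyticAt.exists_leading_term {f : ℝ → ℝ} (hf : AnalyticAt ℝ f 0) (h0 : f 0 = 0)
    (hne : ¬ ∀ᶠ s in 𝓝 0, f s = 0) : ∃ m : ℕ, ∃ c C : ℝ, 1 ≤ m ∧ c ≠ 0 ∧ 0 < C ∧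
      ∀ᶠ s in 𝓝 (0 : ℝ), |f s - c * s ^ m| ≤ C * |s| ^ (m + 1) ∧
        |deriv f s - c * m * s ^ (m - 1)| ≤ C * |s| ^ m ∧
        |s * deriv (deriv f) s - c * m * (m - 1) * s ^ (m - 1)| ≤ C * |s| ^ m := by
  obtain ⟨m, g, hg, hg0, hfg⟩ := hf.exists_eventuallyEq_pow_smul_nonzero_iff.2 hne
  simp only [sub_zero, smul_eq_mul] at hfg
  have hm : 1 ≤ m := by
    by_contra! hm
    obtain rfl : m = 0 := by omega
    have := hfg.self_of_nhds
    simp [h0] at this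
    exact hg0 this.symm
  obtain ⟨k, rfl⟩ : ∃ k, m = k + 1 := ⟨m - 1, by omega⟩
  set B := |deriv g 0| + |deriv (deriv g) 0| + 1 with hB
  have hB1 : ∀ᶠ s in 𝓝 (0 : ℝ), |deriv g s| ≤ B := by
    have : ContinuousAt (fun s => |deriv g s|) 0 := hg.deriv.continuousAt.abs
    filter_upwards [this.eventually (gt_mem_nhds (show |deriv g 0| < B by
      rw [hB]; linarith [abs_nonneg (deriv (deriv g) 0)]))] with s hs using hs.le
  have hB2 : ∀ᶠ s in 𝓝 (0 : ℝ), |deriv (deriv g) s| ≤ B := by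
    have : ContinuousAt (fun s => |deriv (deriv g) s|) 0 := hg.deriv.deriv.continuousAt.abs
    filter_upwards [this.eventually (gt_mem_nhds (show |deriv (deriv g) 0| < B by
      rw [hB]; linarith [abs_nonneg (deriv g 0)]))] with s hs using hs.le
  have hgl : ∀ᶠ s in 𝓝 (0 : ℝ), |g s - g 0| ≤ B * |s| := by
    have h1 := hasDerivAt_iff_isLittleO.1 hg.differentiableAt.hasDerivAt
    filter_upwards [h1.def (c := 1) one_pos] with s hs
    simp only [sub_zero, smul_eq_mul, Real.norm_eq_abs, one_mul] at hs
    have h2 : |g s - g 0| ≤ |g s - g 0 - s * deriv g 0| + |s * deriv g 0| := by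
      have := abs_add_le (g s - g 0 - s * deriv g 0) (s * deriv g 0)
      simpa using this
    rw [abs_mul] at h2
    have := mul_nonneg (abs_nonneg s) (abs_nonneg (deriv (deriv g) 0))
    rw [hB]
    nlinarith
  have hd1 : ∀ᶠ s in 𝓝 (0 : ℝ),
      deriv f s = (k + 1) * s ^ k * g s + s ^ (k + 1) * deriv g s := by
    filter_upwards [hfg.eventually_nhds, hg.eventually_analyticAt] with s hs hgs
    rw [EventuallyEq.deriv_eq (f := fun s => s ^ (k + 1) * g s) hs]
    have : HasDerivAt (fun s => s ^ (k + 1) * g s) _ s :=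
      (hasDerivAt_pow (k + 1) s).mul hgs.differentiableAt.hasDerivAt
    rw [this.deriv]
    simp
  have hd2 : ∀ᶠ s in 𝓝 (0 : ℝ), s * deriv (deriv f) s = (k + 1) * k * s ^ k * g s
      + 2 * (k + 1) * s ^ (k + 1) * deriv g s + s ^ (k + 2) * deriv (deriv g) s := by
    filter_upwards [hd1.eventually_nhds, hg.eventually_analyticAt] with s hs hgs
    rw [EventuallyEq.deriv_eq
      (f := fun s => (k + 1) * s ^ k * g s + s ^ (k + 1) * deriv g s) hs]
    have : HasDerivAt (fun s => (k + 1) * s ^ k * g s + s ^ (k + 1) * deriv g s) _ s :=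
      ((((hasDerivAt_pow k s).const_mul ((k : ℝ) + 1)).mul
      hgs.differentiableAt.hasDerivAt).add ((hasDerivAt_pow (k + 1) s).mul
      hgs.deriv.differentiableAt.hasDerivAt))
    have h2 : s * ((k : ℝ) * s ^ (k - 1)) = k * s ^ k := by
      rcases k with _ | i
      · simp
      · simp [pow_succ]; ring
    rw [this.deriv]
    simp only [Nat.add_sub_cancel]
    push_cast
    linear_combination ((k + 1) * g s) * h2
  refine ⟨k + 1, g 0, (k + 1) ^ 2 * B + 2 * (k + 1) * B + B, by omega, hg0, by positivity, ?_⟩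
  have hs1 : ∀ᶠ s in 𝓝 (0 : ℝ), |s| ≤ 1 := by
    filter_upwards [Metric.closedBall_mem_nhds (0 : ℝ) one_pos] with s hs
    simpa using hs
  filter_upwards [hfg, hd1, hd2, hB1, hB2, hgl, hs1] with s e1 e2 e3 b1 b2 b3 b4
  have hk : (0 : ℝ) ≤ k := Nat.cast_nonneg k
  have hBp : 0 < B := by positivity
  have hsk : 0 ≤ |s| ^ k := by positivity
  have hkm : ((k + 1 : ℕ) : ℝ) = k + 1 := by push_cast; ring
  refine ⟨?_, ?_, ?_⟩
  · have : f s - g 0 * s ^ (k + 1) = s ^ (k + 1) * (g s - g 0) := by rw [e1]; ring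
    rw [this, abs_mul, abs_pow]
    calc |s| ^ (k + 1) * |g s - g 0| ≤ |s| ^ (k + 1) * (B * |s|) := by gcongr
      _ = B * |s| ^ (k + 1 + 1) := by ring
      _ ≤ _ := by gcongr; nlinarith [mul_nonneg hk hBp.le, sq_nonneg ((k : ℝ) + 1)]
  · have : deriv f s - g 0 * ((k + 1 : ℕ) : ℝ) * s ^ (k + 1 - 1)
        = (k + 1) * s ^ k * (g s - g 0) + s ^ (k + 1) * deriv g s := by
      rw [e2, hkm, Nat.add_sub_cancel]; ring
    rw [this]
    calc _ ≤ |(k + 1) * s ^ k * (g s - g 0)| + |s ^ (k + 1) * deriv g s| := abs_add_le _ _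
      _ = (k + 1) * |s| ^ k * |g s - g 0| + |s| ^ (k + 1) * |deriv g s| := by
        rw [abs_mul, abs_mul, abs_mul, abs_pow, abs_pow, abs_of_nonneg (by linarith : 0 ≤ (k : ℝ) + 1)]
      _ ≤ (k + 1) * |s| ^ k * (B * |s|) + |s| ^ (k + 1) * B := by gcongr
      _ = ((k + 1) * B + B) * |s| ^ (k + 1) := by ring
      _ ≤ _ := by gcongr; nlinarith [mul_nonneg hk hBp.le, sq_nonneg ((k : ℝ) + 1)]
  · have : s * deriv (deriv f) s - g 0 * ((k + 1 : ℕ) : ℝ) * (((k + 1 : ℕ) : ℝ) - 1) * s ^ (k + 1 - 1)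
        = (k + 1) * k * s ^ k * (g s - g 0) + 2 * (k + 1) * s ^ (k + 1) * deriv g s
          + s ^ (k + 2) * deriv (deriv g) s := by
      rw [e3, hkm, Nat.add_sub_cancel]; ring
    rw [this]
    calc _ ≤ |(k + 1) * k * s ^ k * (g s - g 0)| + |2 * (k + 1) * s ^ (k + 1) * deriv g s|
          + |s ^ (k + 2) * deriv (deriv g) s| := abs_add_three _ _ _
      _ = (k + 1) * k * |s| ^ k * |g s - g 0| + 2 * (k + 1) * |s| ^ (k + 1) * |deriv g s|
          + |s| ^ (k + 2) * |deriv (deriv g) s| := by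
        simp only [abs_mul, abs_pow, abs_of_nonneg (by linarith : 0 ≤ (k : ℝ) + 1), abs_of_nonneg hk,
          abs_two]
      _ ≤ (k + 1) * k * |s| ^ k * (B * |s|) + 2 * (k + 1) * |s| ^ (k + 1) * B
          + |s| ^ (k + 1) * B := by
        have : |s| ^ (k + 2) ≤ |s| ^ (k + 1) := pow_le_pow_of_le_one (abs_nonneg s) b4 (by omega)
        gcongr
      _ = ((k + 1) * k * B + 2 * (k + 1) * B + B) * |s| ^ (k + 1) := by ring
      _ ≤ _ := by gcongr; nlinarith

theorem HasDerivWithinAt.mul_rot {ℓ : ℝ → ℂ} {θ : ℝ → ℝ} {ℓ' : ℂ} {α r : ℝ} {S : Set ℝ}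
    (hℓ : HasDerivWithinAt ℓ ℓ' S r) (hθ : HasDerivWithinAt θ α S r) :
    HasDerivWithinAt (fun s => ℓ s * rot (θ s))
      (ℓ' * rot (θ r) - Complex.I * α * (ℓ r * rot (θ r))) S r := by
  have h1 : HasDerivWithinAt (fun s => rot (θ s)) (α • (-Complex.I * rot (θ r))) S r :=
    (hasDerivAt_rot (θ r)).scomp_hasDerivWithinAt r hθ
  refine (hℓ.mul h1).congr_deriv ?_
  simp only [Complex.real_smul]; ring

theorem hasDerivWithinAt_im {f : ℝ → ℂ} {f' : ℂ} {S : Set ℝ} {r : ℝ}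
    (h : HasDerivWithinAt f f' S r) : HasDerivWithinAt (fun s => (f s).im) f'.im S r :=
  Complex.imCLM.hasFDerivAt.comp_hasDerivWithinAt r h

theorem hasDerivWithinAt_re {f : ℝ → ℂ} {f' : ℂ} {S : Set ℝ} {r : ℝ}
    (h : HasDerivWithinAt f f' S r) : HasDerivWithinAt (fun s => (f s).re) f'.re S r :=
  Complex.reCLM.hasFDerivAt.comp_hasDerivWithinAt r h

/-- `-v Im (ℓ exp (-i θ))` -/
noncomputable def sweep (v : ℝ) (ℓ : ℝ → ℂ) (θ : ℝ → ℝ) (s : ℝ) : ℝ := -v * (ℓ s * rot (θ s)).im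

/-- The derivative of `sweep` if `θ' = α`. -/
noncomputable def sweepDeriv (v α : ℝ) (ℓ ℓ₁ : ℝ → ℂ) (θ : ℝ → ℝ) (s : ℝ) : ℝ :=
  -v * (ℓ₁ s * rot (θ s)).im + α * v * (ℓ s * rot (θ s)).re

/-- The second derivative of `sweep` if `θ' = α`. -/
noncomputable def sweepDeriv₂ (v α : ℝ) (ℓ ℓ₁ ℓ₂ : ℝ → ℂ) (θ : ℝ → ℝ) (s : ℝ) : ℝ :=
  -v * (ℓ₂ s * rot (θ s)).im + 2 * α * v * (ℓ₁ s * rot (θ s)).re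
    + α ^ 2 * v * (ℓ s * rot (θ s)).im

theorem hasDerivWithinAt_sweep {v α r : ℝ} {ℓ ℓ₁ : ℝ → ℂ} {θ : ℝ → ℝ} {S : Set ℝ}
    (hℓ : HasDerivWithinAt ℓ (ℓ₁ r) S r) (hθ : HasDerivWithinAt θ α S r) :
    HasDerivWithinAt (sweep v ℓ θ) (sweepDeriv v α ℓ ℓ₁ θ r) S r := by
  refine ((hasDerivWithinAt_im (hℓ.mul_rot hθ)).const_mul (-v)).congr_deriv ?_
  simp only [sweepDeriv, Complex.sub_im, Complex.mul_im, Complex.mul_re, Complex.I_re, Complex.I_im,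
    Complex.ofReal_re, Complex.ofReal_im]
  ring

theorem hasDerivWithinAt_sweepDeriv {v α r : ℝ} {ℓ ℓ₁ ℓ₂ : ℝ → ℂ} {θ : ℝ → ℝ} {S : Set ℝ}
    (hℓ : HasDerivWithinAt ℓ (ℓ₁ r) S r) (hℓ₁ : HasDerivWithinAt ℓ₁ (ℓ₂ r) S r)
    (hθ : HasDerivWithinAt θ α S r) :
    HasDerivWithinAt (sweepDeriv v α ℓ ℓ₁ θ) (sweepDeriv₂ v α ℓ ℓ₁ ℓ₂ θ r) S r := by
  refine (((hasDerivWithinAt_im (hℓ₁.mul_rot hθ)).const_mul (-v)).add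
    ((hasDerivWithinAt_re (hℓ.mul_rot hθ)).const_mul (α * v))).congr_deriv ?_
  simp only [sweepDeriv₂, Complex.sub_im, Complex.sub_re, Complex.mul_im, Complex.mul_re,
    Complex.I_re, Complex.I_im, Complex.ofReal_re, Complex.ofReal_im]
  ring

theorem norm_mul_rot_sub_le (w z : ℂ) (x y : ℝ) :
    ‖w * rot x - z * rot y‖ ≤ ‖w - z‖ + ‖z‖ * |x - y| := by
  have : w * rot x - z * rot y = (w - z) * rot x + z * (rot x - rot y) := by ring
  rw [this]
  refine (norm_add_le _ _).trans ?_
  rw [norm_mul, norm_mul, norm_rot, mul_one]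
  gcongr
  exact norm_rot_sub_le x y

/-! ### Comparison with a circular arc yields the scalar switching problem. -/

/-- A covector `ℓ` along a path with course `θ`, compared with the covector `L` along the circular
arc with course `θ 0 + a s`; `φ` is the switching function, `φ' = -v s ^ j Im (ℓ exp (-i θ))`. -/
structure CircleComparison (ε v a C : ℝ) (j : ℕ) (ℓ ℓ₁ ℓ₂ L : ℝ → ℂ) (θ φ : ℝ → ℝ) : Prop where
  ε_pos : 0 < ε
  v_pos : 0 < v
  a_pos : 0 < a
  C_nonneg : 0 ≤ C
  ℓ_deriv : ∀ s ∈ Ioo 0 ε, HasDerivAt ℓ (ℓ₁ s) s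
  ℓ₁_deriv : ∀ s ∈ Ioo 0 ε, HasDerivAt ℓ₁ (ℓ₂ s) s
  L_analytic : AnalyticAt ℝ L 0
  lip : ∀ s ∈ Icc 0 ε, ∀ t ∈ Icc 0 ε, |θ s - θ t| ≤ a * |s - t|
  comp : ∀ s ∈ Ioo 0 ε, ‖ℓ s - L s‖ ≤ C * (s * (a * s - (θ s - θ 0)))
  comp₁ : ∀ s ∈ Ioo 0 ε, ‖ℓ₁ s - deriv L s‖ ≤ C * (a * s - (θ s - θ 0))
  comp₂ : ∀ s ∈ Ioo 0 ε, s * ‖ℓ₂ s - deriv (deriv L) s‖ ≤ C * (a * s - (θ s - θ 0))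
  zero : φ 0 = 0
  cont : ContinuousOn φ (Icc 0 ε)
  deriv : ∀ s ∈ Ioo 0 ε, HasDerivAt φ (s ^ j * sweep v ℓ θ s) s
  neg : ∀ s t, 0 < s → s < t → t < ε → (∀ r ∈ Ioo s t, φ r < 0) → θ t - θ s = a * (t - s)
  pos : ∀ s t, 0 < s → s < t → t < ε → (∀ r ∈ Ioo s t, 0 < φ r) → θ t - θ s = -a * (t - s)

theorem hasDerivWithinAt_of_affine {θ : ℝ → ℝ} {α s t r : ℝ} (hr : r ∈ Ico s t)
    (h : ∀ y ∈ Ico s t, θ y - θ s = α * (y - s)) : HasDerivWithinAt θ α (Ici r) r := by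
  have h1 : HasDerivWithinAt (fun y => θ s + α * (y - s)) (α * 1) (Ici r) r :=
    (((hasDerivWithinAt_id r _).sub_const s).const_mul α).const_add (θ s)
  rw [mul_one] at h1
  refine h1.congr_of_eventuallyEq ?_ (by linarith [h r hr])
  filter_upwards [Ico_mem_nhdsGE hr.2] with y hy
  linarith [h y ⟨hr.1.trans hy.1, hy.2⟩]

-- Along the circle the sweep is analytic, and `hnd` provides a leading term `c s ^ m` with `c ≠ 0`.
-- The actual course is behind that of the circle by the lag `D`; as `L 0 * rot (θ 0)` is real, the
-- lag changes the sweep by `-β D` to first order. The sign condition `hA` forces `β γ < 0`, so that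
-- only the saddle and the oscillator occur.
set_option maxHeartbeats 1000000 in
theorem CircleComparison.hasSignGerm {ε v a C : ℝ} {j : ℕ} {ℓ ℓ₁ ℓ₂ L : ℝ → ℂ} {θ φ : ℝ → ℝ}
    (h : CircleComparison ε v a C j ℓ ℓ₁ ℓ₂ L θ φ)
    (h0 : (L 0 * rot (θ 0)).im = 0) (hβ : (L 0 * rot (θ 0)).re ≠ 0)
    (hA : 0 ≤ (_root_.deriv L 0 * rot (θ 0)).im * (L 0 * rot (θ 0)).re)
    (hnd : ¬ ∀ᶠ s in 𝓝[>] 0, (L s * rot (θ 0 + a * s)).im = 0) : HasSignGerm φ := by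
  have hv := h.v_pos
  have ha := h.a_pos
  have hC := h.C_nonneg
  have hε := h.ε_pos
  set η : ℝ → ℝ := fun s => θ 0 + a * s with hη
  set q : ℝ → ℝ := sweep v L η with hq
  have hηd : ∀ s, HasDerivAt η a s := fun s => by
    have := ((hasDerivAt_id s).const_mul a).const_add (θ 0)
    rw [mul_one] at this
    exact this
  have hW0 : AnalyticAt ℝ (fun s => L s * rot (η s)) 0 := by
    have hηa : AnalyticAt ℝ η 0 := analyticAt_const.add (analyticAt_const.mul analyticAt_id)
    exact h.L_analytic.mul (AnalyticAt.comp (g := rot) (f := η) (analyticAt_rot (η 0)) hηa)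
  have hqa : AnalyticAt ℝ q 0 :=
    analyticAt_const.mul ((Complex.imCLM.analyticAt _).comp hW0)
  have hη0 : η 0 = θ 0 := by simp [hη]
  have hq0 : q 0 = 0 := by rw [hq, sweep, hη0, h0, mul_zero]
  obtain ⟨m, c, C', hm, hc, hC', hlead⟩ := hqa.exists_leading_term hq0 (by
    intro hev
    refine hnd ?_
    filter_upwards [hev.filter_mono nhdsWithin_le_nhds] with s hs
    have : -v * (L s * rot (η s)).im = 0 := hs
    exact (mul_eq_zero.1 this).resolve_left (by linarith))
  -- `β` is the rate at which the lag lowers the sweep, and `γ` is the initial slope of the sweep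
  -- under turning rate `-a`. In `β γ` the turning contributes `-a β²`, and by `hA` the other term
  -- is not positive.
  set β := v * (L 0 * rot (θ 0)).re with hβdef
  set γ := -v * (_root_.deriv L 0 * rot (θ 0)).im - a * β with hγdef
  have hβ0 : β ≠ 0 := mul_ne_zero hv.ne' hβ
  have hβγ : β * γ < 0 := by
    have h1 : β * γ = -(v ^ 2 * ((_root_.deriv L 0 * rot (θ 0)).im * (L 0 * rot (θ 0)).re))
        - a * β ^ 2 := by rw [hγdef, hβdef]; ring
    have h2 : 0 < a * β ^ 2 := by positivity
    have h3 := mul_nonneg (sq_nonneg v) hA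
    rw [h1]; linarith
  have hγ0 : γ ≠ 0 := by rintro h1; simp [h1] at hβγ
  -- bounds for the comparison covector
  obtain ⟨B, hB, hbd⟩ : ∃ B > 0, ∀ᶠ s in 𝓝 (0 : ℝ), ‖L s‖ ≤ B ∧ ‖_root_.deriv L s‖ ≤ B ∧
      ‖_root_.deriv (_root_.deriv L) s‖ ≤ B ∧ ‖L s * rot (η s) - L 0 * rot (θ 0)‖ ≤ B * |s| := by
    obtain ⟨b, hb⟩ := (hW0.differentiableAt.hasDerivAt.isBigO_sub).bound
    refine ⟨‖L 0‖ + ‖_root_.deriv L 0‖ + ‖_root_.deriv (_root_.deriv L) 0‖ + |b| + 1, by positivity, ?_⟩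
    have e1 := h.L_analytic.continuousAt.norm.eventually (gt_mem_nhds (lt_add_one ‖L 0‖))
    have e2 := h.L_analytic.deriv.continuousAt.norm.eventually
      (gt_mem_nhds (lt_add_one ‖_root_.deriv L 0‖))
    have e3 := h.L_analytic.deriv.deriv.continuousAt.norm.eventually
      (gt_mem_nhds (lt_add_one ‖_root_.deriv (_root_.deriv L) 0‖))
    have n1 := norm_nonneg (L 0)
    have n2 := norm_nonneg (_root_.deriv L 0)
    have n3 := norm_nonneg (_root_.deriv (_root_.deriv L) 0)
    have n4 := abs_nonneg b
    filter_upwards [e1, e2, e3, hb] with s h1 h2 h3 h4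
    refine ⟨by linarith, by linarith, by linarith, ?_⟩
    rw [sub_zero, Real.norm_eq_abs, hη0] at h4
    refine h4.trans (mul_le_mul_of_nonneg_right ?_ (abs_nonneg s))
    linarith [le_abs_self b]
  set F : ℝ → ℝ := sweepDeriv v (-a) L (_root_.deriv L) η with hF
  have hF0 : F 0 = γ := by
    rw [hF, sweepDeriv, hη0, hγdef, hβdef]; ring
  have hFc : ContinuousAt F 0 := by
    have c1 : ContinuousAt (fun s => rot (η s)) 0 :=
      continuous_rot.continuousAt.comp (hηd 0).continuousAt
    have c2 := Complex.continuous_im.continuousAt.comp (h.L_analytic.deriv.continuousAt.mul c1)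
    have c3 := Complex.continuous_re.continuousAt.comp (h.L_analytic.continuousAt.mul c1)
    exact (continuousAt_const.mul c2).add (continuousAt_const.mul c3)
  have hFev : ∀ᶠ s in 𝓝 (0 : ℝ), |F s - γ| < |γ| / 4 := by
    have : ContinuousAt (fun s => |F s - γ|) 0 := (hFc.sub continuousAt_const).abs
    refine this.eventually (gt_mem_nhds ?_)
    change |F 0 - γ| < |γ| / 4
    rw [hF0, sub_self, abs_zero]; positivity
  obtain ⟨δ₀, hδ₀, hball⟩ := Metric.eventually_nhds_iff.1
    (((hlead.and hbd).and hFev).and h.L_analytic.eventually_analyticAt)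
  set N := C + 2 * B + 2 * a * B + 2 * a * C with hN
  have hNpos : 0 < N := by positivity
  -- As `v + 2 a v + a² v`, this dominates the coefficients of the sweep and of its first two
  -- derivatives together.
  set V := v * (1 + a) ^ 2 with hV
  have hvV : v * (1 + a) ≤ V := by rw [hV]; nlinarith [mul_pos hv ha]
  have hvV' : v ≤ V := by nlinarith [mul_pos hv ha]
  have hVpos : 0 < V := by positivity
  set δ := min (min ε δ₀) (min (min 1 (1 / (2 * a))) (|γ| / 4 / (V * N * (2 * a)))) with hδ
  have hγpos : 0 < |γ| := abs_pos.2 hγ0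
  have hδpos : 0 < δ := by positivity
  have hδε : δ ≤ ε := (min_le_left _ _).trans (min_le_left _ _)
  have hδδ : δ ≤ δ₀ := (min_le_left _ _).trans (min_le_right _ _)
  have hδ1 : δ ≤ 1 := (min_le_right _ _).trans ((min_le_left _ _).trans (min_le_left _ _))
  have hδa : δ * (2 * a) ≤ 1 := by
    rw [← le_div_iff₀ (by positivity)]
    exact (min_le_right _ _).trans ((min_le_left _ _).trans (min_le_right _ _))
  have hδγ : δ * (V * N * (2 * a)) ≤ |γ| / 4 := by
    rw [← le_div_iff₀ (by positivity)]
    exact (min_le_right _ _).trans (min_le_right _ _)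
  have hsε : ∀ s ∈ Ioo 0 δ, s ∈ Ioo 0 ε := fun s hs => ⟨hs.1, hs.2.trans_le hδε⟩
  have hb : ∀ s ∈ Ioo 0 δ, _ := fun s hs => hball (y := s) (by
    rw [Real.dist_eq, sub_zero, abs_of_pos hs.1]; exact hs.2.trans_le hδδ)
  set D : ℝ → ℝ := fun s => a * s - (θ s - θ 0) with hD
  have hDb : ∀ s ∈ Ioo 0 δ, 0 ≤ D s ∧ D s ≤ 2 * a * s := by
    intro s hs
    have h1 := h.lip s ⟨hs.1.le, (hsε s hs).2.le⟩ 0 ⟨le_rfl, hε.le⟩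
    rw [sub_zero, abs_of_pos hs.1] at h1
    have h2 := abs_le.1 h1
    simp only [hD]
    constructor <;> linarith [h2.1, h2.2]
  have hang : ∀ s ∈ Ioo 0 δ, |θ s - η s| = D s := by
    intro s hs
    have h1 : θ s - η s = -(D s) := by simp only [hη, hD]; ring
    rw [h1, abs_neg, abs_of_nonneg (hDb s hs).1]
  have hw0 : ∀ s ∈ Ioo 0 δ, ‖ℓ s * rot (θ s) - L s * rot (η s)‖ ≤ (C + B) * D s := by
    intro s hs
    refine (norm_mul_rot_sub_le _ _ _ _).trans ?_
    rw [hang s hs]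
    have h1 := h.comp s (hsε s hs)
    have h2 := mul_le_mul_of_nonneg_right (hb s hs).1.1.2.1 (hDb s hs).1
    have h3 : C * (s * D s) ≤ C * D s := by
      have := mul_le_mul_of_nonneg_right (hs.2.le.trans hδ1) (hDb s hs).1
      rw [one_mul] at this
      exact mul_le_mul_of_nonneg_left this hC
    linarith
  have hw1 : ∀ s ∈ Ioo 0 δ, ‖ℓ₁ s * rot (θ s) - _root_.deriv L s * rot (η s)‖ ≤ (C + B) * D s := by
    intro s hs
    refine (norm_mul_rot_sub_le _ _ _ _).trans ?_
    rw [hang s hs]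
    have h1 := h.comp₁ s (hsε s hs)
    have h2 := mul_le_mul_of_nonneg_right (hb s hs).1.1.2.2.1 (hDb s hs).1
    linarith
  -- The second derivative is controlled only up to a factor `1 / s`, because `ℓ` may be a covector
  -- that was divided by `s`. This is why `Fn'_est` is stated for `s * Fn'`.
  have hw2 : ∀ s ∈ Ioo 0 δ,
      s * ‖ℓ₂ s * rot (θ s) - _root_.deriv (_root_.deriv L) s * rot (η s)‖ ≤ (C + B) * D s := by
    intro s hs
    refine (mul_le_mul_of_nonneg_left (norm_mul_rot_sub_le _ _ _ _) hs.1.le).trans ?_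
    rw [hang s hs, mul_add]
    have h1 := h.comp₂ s (hsε s hs)
    have h2 := mul_le_mul_of_nonneg_right (hb s hs).1.1.2.2.2.1 (hDb s hs).1
    have h3 : s * (‖_root_.deriv (_root_.deriv L) s‖ * D s) ≤ 1 * (B * D s) :=
      mul_le_mul (hs.2.le.trans hδ1) h2 (mul_nonneg (norm_nonneg _) (hDb s hs).1) zero_le_one
    linarith
  have hn0 : ∀ s ∈ Ioo 0 δ, ‖ℓ s‖ ≤ N ∧ ‖ℓ₁ s‖ ≤ N ∧ ‖ℓ₂ s‖ ≤ N := by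
    intro s hs
    obtain ⟨d0, d1⟩ := hDb s hs
    obtain ⟨b0, b1, b2, -⟩ := (hb s hs).1.1.2
    have hs1 : s ≤ 1 := hs.2.le.trans hδ1
    have hD2 : D s ≤ 2 * a := d1.trans (by nlinarith)
    have hCD : C * D s ≤ C * (2 * a) := mul_le_mul_of_nonneg_left hD2 hC
    have hCa := mul_nonneg hC ha.le
    have hBa := mul_pos hB ha
    refine ⟨?_, ?_, ?_⟩
    · have h1 := norm_le_norm_add_norm_sub' (ℓ s) (L s)
      have h2 := h.comp s (hsε s hs)
      have h3 : C * (s * D s) ≤ C * (1 * D s) := by gcongr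
      linarith
    · have h1 := norm_le_norm_add_norm_sub' (ℓ₁ s) (_root_.deriv L s)
      have h2 := h.comp₁ s (hsε s hs)
      linarith
    · have h1 := norm_le_norm_add_norm_sub' (ℓ₂ s) (_root_.deriv (_root_.deriv L) s)
      have h2 := h.comp₂ s (hsε s hs)
      have h3 : ‖ℓ₂ s - _root_.deriv (_root_.deriv L) s‖ ≤ C * (2 * a) := by
        refine le_of_mul_le_mul_left (h2.trans ?_) hs.1
        have := mul_le_mul_of_nonneg_left d1 hC
        linarith
      linarith
  -- derivatives of the comparison function
  have hLd : ∀ s ∈ Ioo 0 δ, _root_.deriv q s = sweepDeriv v a L (_root_.deriv L) η s := by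
    intro s hs
    have h1 := (hb s hs).2.differentiableAt.hasDerivAt
    have := hasDerivWithinAt_sweep (v := v) (ℓ₁ := _root_.deriv L) h1.hasDerivWithinAt
      (hηd s).hasDerivWithinAt (S := univ)
    exact (hasDerivWithinAt_univ.1 this).deriv
  have hLd2 : ∀ s ∈ Ioo 0 δ, _root_.deriv (_root_.deriv q) s
      = sweepDeriv₂ v a L (_root_.deriv L) (_root_.deriv (_root_.deriv L)) η s := by
    intro s hs
    have h1 := (hb s hs).2.differentiableAt.hasDerivAt
    have h2 := (hb s hs).2.deriv.differentiableAt.hasDerivAt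
    have h3 := hasDerivWithinAt_univ.1 (hasDerivWithinAt_sweepDeriv (v := v) (ℓ₁ := _root_.deriv L)
      (ℓ₂ := _root_.deriv (_root_.deriv L)) h1.hasDerivWithinAt h2.hasDerivWithinAt
      (hηd s).hasDerivWithinAt (S := univ))
    rw [← h3.deriv]
    refine EventuallyEq.deriv_eq ?_
    filter_upwards [isOpen_Ioo.mem_nhds hs] with y hy using hLd y hy
  have him : ∀ z w : ℂ, |z.im - w.im| ≤ ‖z - w‖ := fun z w => by
    rw [← Complex.sub_im]; exact Complex.abs_im_le_norm _
  have hre : ∀ z w : ℂ, |z.re - w.re| ≤ ‖z - w‖ := fun z w => by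
    rw [← Complex.sub_re]; exact Complex.abs_re_le_norm _
  have hsd : ∀ α : ℝ, |α| = a → ∀ s ∈ Ioo 0 δ, |sweepDeriv v α ℓ ℓ₁ θ s
      - sweepDeriv v α L (_root_.deriv L) η s| ≤ V * N * D s := by
    intro α hα s hs
    have e : sweepDeriv v α ℓ ℓ₁ θ s - sweepDeriv v α L (_root_.deriv L) η s
        = -v * ((ℓ₁ s * rot (θ s)).im - (_root_.deriv L s * rot (η s)).im)
          + α * v * ((ℓ s * rot (θ s)).re - (L s * rot (η s)).re) := by
      simp only [sweepDeriv]; ring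
    rw [e]
    refine (abs_add_le _ _).trans ?_
    rw [abs_mul, abs_mul, abs_mul, abs_neg, abs_of_pos hv, hα]
    have h1 := (him _ _).trans (hw1 s hs)
    have h2 := (hre _ _).trans (hw0 s hs)
    have hd := (hDb s hs).1
    have h3 : (C + B) * D s ≤ N * D s := by
      refine mul_le_mul_of_nonneg_right ?_ hd
      have := mul_nonneg hC ha.le
      have := mul_pos hB ha
      linarith
    calc _ ≤ v * (N * D s) + a * v * (N * D s) := by
          gcongr
          · exact h1.trans h3
          · exact h2.trans h3
      _ = v * (1 + a) * (N * D s) := by ring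
      _ ≤ V * (N * D s) := mul_le_mul_of_nonneg_right hvV (mul_nonneg hNpos.le hd)
      _ = _ := by ring
  have hcont : ContinuousOn ℓ (Ioo 0 δ) ∧ ContinuousOn ℓ₁ (Ioo 0 δ) ∧
      ContinuousOn (fun s => rot (θ s)) (Ioo 0 δ) := by
    refine ⟨fun s hs => (h.ℓ_deriv s (hsε s hs)).continuousAt.continuousWithinAt,
      fun s hs => (h.ℓ₁_deriv s (hsε s hs)).continuousAt.continuousWithinAt,
      continuous_rot.comp_continuousOn ?_⟩
    have hL : LipschitzOnWith ⟨a, ha.le⟩ θ (Ioo 0 δ) := by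
      refine LipschitzOnWith.of_dist_le_mul fun s hs t ht => ?_
      rw [Real.dist_eq, Real.dist_eq]
      exact h.lip s ⟨hs.1.le, (hsε s hs).2.le⟩ t ⟨ht.1.le, (hsε t ht).2.le⟩
    exact hL.continuousOn
  have hsdc : ∀ α, ContinuousOn (sweepDeriv v α ℓ ℓ₁ θ) (Ioo 0 δ) := by
    intro α
    obtain ⟨c1, c2, c3⟩ := hcont
    unfold sweepDeriv
    exact (continuousOn_const.mul (Complex.continuous_im.comp_continuousOn (c2.mul c3))).add
      (continuousOn_const.mul (Complex.continuous_re.comp_continuousOn (c1.mul c3)))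
  have hder : ∀ α s t, 0 < s → s < t → t < δ →
      (∀ y ∈ Ico s t, θ y - θ s = α * (y - s)) → ∀ r ∈ Ico s t,
      HasDerivWithinAt (sweep v ℓ θ) (sweepDeriv v α ℓ ℓ₁ θ r) (Ici r) r ∧
      HasDerivWithinAt (sweepDeriv v α ℓ ℓ₁ θ) (sweepDeriv₂ v α ℓ ℓ₁ ℓ₂ θ r) (Ici r) r := by
    intro α s t hs hst ht hθ r hr
    have hrI : r ∈ Ioo 0 ε := hsε r ⟨hs.trans_le hr.1, hr.2.trans ht⟩
    have h1 := hasDerivWithinAt_of_affine hr hθ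
    have h2 := (h.ℓ_deriv r hrI).hasDerivWithinAt (s := Ici r)
    have h3 := (h.ℓ₁_deriv r hrI).hasDerivWithinAt (s := Ici r)
    exact ⟨hasDerivWithinAt_sweep h2 h1, hasDerivWithinAt_sweepDeriv h2 h3 h1⟩
  set Ct := V * N + C' with hCt
  have hCtpos : 0 < Ct := by positivity
  have hVN : V * N ≤ Ct := by rw [hCt]; linarith
  have hmain : SwitchGerm δ β γ c Ct j m φ (sweep v ℓ θ) D (sweepDeriv v a ℓ ℓ₁ θ)
      (sweepDeriv₂ v a ℓ ℓ₁ ℓ₂ θ) (sweepDeriv v (-a) ℓ ℓ₁ θ) (sweepDeriv₂ v (-a) ℓ ℓ₁ ℓ₂ θ) := by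
    refine
      { ε_pos := hδpos
        C_pos := hCtpos
        m_pos := hm
        cont := h.cont.mono (Icc_subset_Icc le_rfl hδε)
        zero := h.zero
        deriv := fun s hs => h.deriv s (hsε s hs)
        lip := ?_
        D_nonneg := fun s hs => (hDb s hs).1
        D_const := ?_
        p_est := ?_
        neg_deriv := ?_
        pos_deriv := ?_
        Fn_cont := hsdc a
        Fp_cont := hsdc (-a)
        Fn_est := ?_
        Fn'_est := ?_
        Fp_est := ?_
        Fp'_est := ?_ }
    · intro s hs t ht
      have h1 : ‖ℓ s - ℓ t‖ ≤ N * ‖s - t‖ :=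
        (convex_Ioo 0 δ).norm_image_sub_le_of_norm_hasDerivWithin_le
          (fun x hx => (h.ℓ_deriv x (hsε x hx)).hasDerivWithinAt) (fun x hx => (hn0 x hx).2.1) ht hs
      rw [Real.norm_eq_abs] at h1
      have h2 := norm_mul_rot_sub_le (ℓ s) (ℓ t) (θ s) (θ t)
      have h3 := h.lip s ⟨hs.1.le, (hsε s hs).2.le⟩ t ⟨ht.1.le, (hsε t ht).2.le⟩
      have e : sweep v ℓ θ s - sweep v ℓ θ t
          = -v * ((ℓ s * rot (θ s)).im - (ℓ t * rot (θ t)).im) := by simp only [sweep]; ring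
      rw [e, abs_mul, abs_neg, abs_of_pos hv]
      calc _ ≤ v * (N * |s - t| + N * (a * |s - t|)) := by
            gcongr
            refine (him _ _).trans (h2.trans ?_)
            gcongr
            exact (hn0 t ht).1
        _ = v * (1 + a) * (N * |s - t|) := by ring
        _ ≤ V * (N * |s - t|) := by gcongr
        _ = V * N * |s - t| := by ring
        _ ≤ _ := by gcongr
    · intro s t hs hst ht hneg
      have := h.neg s t hs hst (ht.trans_le hδε) hneg
      simp only [hD]; linarith
    · intro s hs
      obtain ⟨d0, d1⟩ := hDb s hs
      have hD1 : D s ≤ 1 := d1.trans (by nlinarith [hs.2])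
      obtain ⟨b0, b1, b2, b3⟩ := (hb s hs).1.1.2
      rw [abs_of_pos hs.1] at b3
      have l1 := (hb s hs).1.1.1.1
      rw [abs_of_pos hs.1] at l1
      -- With `rot (-D) ≈ 1 + i D` and `w0` real, the term `i w0 D` contributes exactly `-β D` to
      -- the sweep. The three remaining terms are `O(s D)`, since `D ≤ 2 a s` makes `D²` of that
      -- order.
      set w0 := L 0 * rot (θ 0) with hw0def
      have hw0r : w0 = (w0.re : ℂ) := by
        apply Complex.ext <;> simp [h0]
      have hrot : rot (θ s) = rot (η s) * rot (-(D s)) := by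
        rw [← rot_add]; congr 1; simp only [hη, hD]; ring
      have e1 : ℓ s * rot (θ s) - L s * rot (η s) = (ℓ s - L s) * rot (θ s)
          + (L s * rot (η s)) * (rot (-(D s)) - 1 - Complex.I * D s)
          + (L s * rot (η s) - w0) * (Complex.I * D s) + w0 * (Complex.I * D s) := by
        rw [hrot]; ring
      have e2 : (w0 * (Complex.I * D s)).im = w0.re * D s := by
        rw [hw0r]; simp
      have e3 : sweep v ℓ θ s - c * s ^ m + β * D s
          = -v * ((ℓ s - L s) * rot (θ s)
          + (L s * rot (η s)) * (rot (-(D s)) - 1 - Complex.I * D s)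
          + (L s * rot (η s) - w0) * (Complex.I * D s)).im + (q s - c * s ^ m) := by
        have e4 := congrArg Complex.im e1
        rw [Complex.add_im (_ + _ + _), e2, Complex.sub_im] at e4
        have e5 : q s = -v * (L s * rot (η s)).im := rfl
        have e6 : sweep v ℓ θ s = -v * (ℓ s * rot (θ s)).im := rfl
        rw [e5, e6, hβdef]
        linear_combination (-v) * e4
      rw [e3]
      have n1 : ‖(ℓ s - L s) * rot (θ s)
          + (L s * rot (η s)) * (rot (-(D s)) - 1 - Complex.I * D s)
          + (L s * rot (η s) - w0) * (Complex.I * D s)‖ ≤ N * (s * D s) := by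
        refine (norm_add₃_le).trans ?_
        rw [norm_mul, norm_mul, norm_mul, norm_mul, norm_rot, norm_rot, mul_one, mul_one, norm_mul,
          Complex.norm_I, one_mul, Complex.norm_real, Real.norm_eq_abs, abs_of_nonneg d0]
        have k1 := h.comp s (hsε s hs)
        have k2 := norm_rot_neg_sub_le d0 hD1
        calc _ ≤ C * (s * D s) + B * D s ^ 2 + B * s * D s := by gcongr
          _ ≤ C * (s * D s) + B * (2 * a * s * D s) + B * s * D s := by
            gcongr
            rw [sq]; gcongr
          _ = (C + 2 * a * B + B) * (s * D s) := by ring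
          _ ≤ _ := by
            have := hs.1
            gcongr
            have := mul_nonneg hC ha.le
            linarith
      refine (abs_add_le _ _).trans ?_
      rw [abs_mul, abs_neg, abs_of_pos hv, mul_add]
      have k1 := (Complex.abs_im_le_norm _).trans n1
      have hsD : 0 ≤ s * D s := mul_nonneg hs.1.le d0
      refine add_le_add ?_ ?_
      · calc _ ≤ v * (N * (s * D s)) := by gcongr
          _ ≤ V * (N * (s * D s)) := by gcongr
          _ = V * N * (s * D s) := by ring
          _ ≤ _ := by gcongr
      · refine l1.trans (mul_le_mul_of_nonneg_right ?_ (pow_pos hs.1 _).le)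
        rw [hCt]; nlinarith [mul_pos hVpos hNpos]
    · intro s t hs hst ht hneg r hr
      refine hder a s t hs hst ht (fun y hy => ?_) r hr
      rcases eq_or_lt_of_le hy.1 with e | e
      · rw [e]; ring
      · exact h.neg s y hs e ((hy.2.trans ht).trans_le hδε) fun z hz => hneg z ⟨hz.1, hz.2.trans hy.2⟩
    · intro s t hs hst ht hpos r hr
      refine hder (-a) s t hs hst ht (fun y hy => ?_) r hr
      rcases eq_or_lt_of_le hy.1 with e | e
      · rw [e]; ring
      · exact h.pos s y hs e ((hy.2.trans ht).trans_le hδε) fun z hz => hpos z ⟨hz.1, hz.2.trans hy.2⟩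
    · intro s hs
      have l1 := (hb s hs).1.1.1.2.1
      rw [abs_of_pos hs.1, hLd s hs] at l1
      have l2 := hsd a (abs_of_pos ha) s hs
      have d0 := (hDb s hs).1
      have hsm := pow_pos hs.1 m
      refine (abs_sub_le _ (sweepDeriv v a L (_root_.deriv L) η s) _).trans ?_
      rw [mul_add]
      refine add_le_add (l2.trans (mul_le_mul_of_nonneg_right hVN d0))
        (l1.trans (mul_le_mul_of_nonneg_right ?_ hsm.le))
      rw [hCt]; nlinarith [mul_pos hVpos hNpos]
    · intro s hs
      have l1 := (hb s hs).1.1.1.2.2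
      rw [abs_of_pos hs.1, hLd2 s hs] at l1
      have d0 := (hDb s hs).1
      have hsm := pow_pos hs.1 m
      refine (abs_sub_le _ (s * sweepDeriv₂ v a L (_root_.deriv L)
        (_root_.deriv (_root_.deriv L)) η s) _).trans ?_
      rw [mul_add]
      refine add_le_add (le_trans ?_ (mul_le_mul_of_nonneg_right hVN d0))
        (l1.trans (mul_le_mul_of_nonneg_right ?_ hsm.le))
      · have e : s * sweepDeriv₂ v a ℓ ℓ₁ ℓ₂ θ s
            - s * sweepDeriv₂ v a L (_root_.deriv L) (_root_.deriv (_root_.deriv L)) η s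
            = -v * (s * ((ℓ₂ s * rot (θ s)).im
                - (_root_.deriv (_root_.deriv L) s * rot (η s)).im))
              + s * (2 * a * v * ((ℓ₁ s * rot (θ s)).re - (_root_.deriv L s * rot (η s)).re))
              + s * (a ^ 2 * v * ((ℓ s * rot (θ s)).im - (L s * rot (η s)).im)) := by
          simp only [sweepDeriv₂]; ring
        rw [e]
        refine (abs_add_three _ _ _).trans ?_
        have hs1 : s ≤ 1 := hs.2.le.trans hδ1
        have h0' := (him _ _).trans (hw0 s hs)
        have h1 := (hre _ _).trans (hw1 s hs)
        have h2 := (mul_le_mul_of_nonneg_left (him _ _) hs.1.le).trans (hw2 s hs)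
        have h3 : (C + B) * D s ≤ N * D s := by
          refine mul_le_mul_of_nonneg_right ?_ d0
          have := mul_nonneg hC ha.le
          have := mul_pos hB ha
          linarith
        simp only [abs_mul, abs_neg, abs_of_pos hv, abs_of_pos hs.1, abs_of_pos ha, abs_two, abs_pow]
        have g0 := mul_le_mul hs1 (mul_le_mul_of_nonneg_left (h0'.trans h3)
          (by positivity : 0 ≤ a ^ 2 * v)) (by positivity) zero_le_one
        have g1 := mul_le_mul hs1 (mul_le_mul_of_nonneg_left (h1.trans h3)
          (by positivity : 0 ≤ 2 * a * v)) (by positivity) zero_le_one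
        have g2 := mul_le_mul_of_nonneg_left (h2.trans h3) hv.le
        refine (add_le_add (add_le_add g2 g1) g0).trans_eq ?_
        rw [hV]; ring
      · rw [hCt]; nlinarith [mul_pos hVpos hNpos]
    · intro s hs
      have l1 := (hb s hs).1.2
      have l2 := hsd (-a) (by rw [abs_neg, abs_of_pos ha]) s hs
      have l3 : V * N * D s ≤ |γ| / 4 := by
        refine le_trans ?_ hδγ
        have : V * N * D s ≤ V * N * (2 * a * s) :=
          mul_le_mul_of_nonneg_left (hDb s hs).2 (by positivity)
        have h4 : s * (V * N * (2 * a)) ≤ δ * (V * N * (2 * a)) :=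
          mul_le_mul_of_nonneg_right hs.2.le (by positivity)
        linarith
      refine (abs_sub_le _ (F s) _).trans ?_
      linarith
    · intro s hs
      obtain ⟨n0, n1, n2⟩ := hn0 s hs
      rw [sweepDeriv₂]
      refine (abs_add_three _ _ _).trans ?_
      have k : ∀ z : ℂ, ∀ x, ‖z * rot x‖ = ‖z‖ := fun z x => by rw [norm_mul, norm_rot, mul_one]
      have k0 := (Complex.abs_im_le_norm (ℓ s * rot (θ s))).trans_eq (k _ _)
      have k1 := (Complex.abs_re_le_norm (ℓ₁ s * rot (θ s))).trans_eq (k _ _)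
      have k2 := (Complex.abs_im_le_norm (ℓ₂ s * rot (θ s))).trans_eq (k _ _)
      simp only [abs_mul, abs_neg, abs_of_pos hv, abs_of_pos ha, abs_two, abs_pow]
      calc _ ≤ v * N + 2 * a * v * N + a ^ 2 * v * N := by
            gcongr
            · exact k2.trans n2
            · exact k1.trans n1
            · exact k0.trans n0
        _ = V * N := by rw [hV]; ring
        _ ≤ _ := hVN
  rcases lt_or_gt_of_ne hβ0 with hb' | hb'
  · exact hmain.hasSignGerm_saddle hb' (by nlinarith) hc
  · exact hmain.hasSignGerm_oscillator hb' (by nlinarith) hc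

/-! ### The potential, and why circles are not singular. -/

/-- The potential `q(x, y) / (x² + y²)²` with the quadratic form `q(z) = A |z|² + Re (b z̄²)`. -/
noncomputable def potential (A : ℝ) (b z : ℂ) : ℝ :=
  ((A * (z * conj z) + b * conj z ^ 2) / (z * conj z) ^ 2).re

/-- The gradient of `potential`. -/
noncomputable def gradPotential (A : ℝ) (b z : ℂ) : ℂ :=
  -2 * (A * z ^ 2 * conj z + conj b * z ^ 3) / (z * conj z) ^ 3

theorem mul_conj_ne_zero {z : ℂ} (hz : z ≠ 0) : z * conj z ≠ 0 :=
  mul_ne_zero hz (by simpa using hz)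

/-- A zero would require `A z̄ = -b̄ z`, which the moduli forbid for a positive definite form. This
isolates the zeros of the covector and gives it a nonzero quotient by `s` at such a zero. -/
theorem gradPotential_ne_zero {A : ℝ} {b z : ℂ} (hA : ‖b‖ < A) (hz : z ≠ 0) :
    gradPotential A b z ≠ 0 := by
  intro h0
  have h1 : -2 * ((A : ℂ) * z ^ 2 * conj z + conj b * z ^ 3) = 0 := by
    rcases div_eq_zero_iff.1 h0 with h | h
    · exact h
    · exact absurd h (pow_ne_zero 3 (mul_conj_ne_zero hz))
  have h2 : z ^ 2 * ((A : ℂ) * conj z + conj b * z) = 0 := by linear_combination (-1 / 2 : ℂ) * h1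
  have h3 : (A : ℂ) * conj z = -(conj b * z) := by
    have := (mul_eq_zero.1 h2).resolve_left (pow_ne_zero 2 hz)
    linear_combination this
  have h4 := congrArg norm h3
  rw [norm_neg, norm_mul, norm_mul, Complex.norm_conj, Complex.norm_conj, Complex.norm_real,
    Real.norm_eq_abs] at h4
  have h5 := mul_right_cancel₀ (norm_ne_zero_iff.2 hz) h4
  linarith [le_abs_self A]

theorem contDiffAt_conj {n : WithTop ℕ∞} {z : ℂ} : ContDiffAt ℝ n (fun w : ℂ => conj w) z :=
  Complex.conjCLE.contDiff.contDiffAt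

theorem contDiffAt_gradPotential {A : ℝ} {b z : ℂ} (hz : z ≠ 0) {n : WithTop ℕ∞} :
    ContDiffAt ℝ n (gradPotential A b) z := by
  have hc := contDiffAt_conj (n := n) (z := z)
  have hi : ContDiffAt ℝ n (fun w : ℂ => w) z := contDiffAt_id
  have hn : ContDiffAt ℝ n (fun w : ℂ => -2 * (A * w ^ 2 * conj w + conj b * w ^ 3)) z :=
    contDiffAt_const.mul (((contDiffAt_const.mul (hi.pow 2)).mul hc).add
      (contDiffAt_const.mul (hi.pow 3)))
  exact hn.mul (((hi.mul hc).pow 3).inv (pow_ne_zero 3 (mul_conj_ne_zero hz)))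

theorem hasDerivWithinAt_conj {f : ℝ → ℂ} {f' : ℂ} {S : Set ℝ} {r : ℝ}
    (h : HasDerivWithinAt f f' S r) : HasDerivWithinAt (fun s => conj (f s)) (conj f') S r :=
  Complex.conjCLE.toContinuousLinearMap.hasFDerivAt.comp_hasDerivWithinAt r h

/-- The chain rule for `potential`. -/
theorem hasDerivWithinAt_potential {A : ℝ} {b : ℂ} {f : ℝ → ℂ} {f' : ℂ} {S : Set ℝ} {r : ℝ}
    (h : HasDerivWithinAt f f' S r) (h0 : f r ≠ 0) :
    HasDerivWithinAt (fun s => potential A b (f s)) (gradPotential A b (f r) * conj f').re S r := by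
  have hc := hasDerivWithinAt_conj h
  have hne := mul_conj_ne_zero h0
  have h1 := hasDerivWithinAt_re ((((h.mul hc).const_mul (A : ℂ)).add ((hc.pow 2).const_mul b)).div
    ((h.mul hc).pow 2) (pow_ne_zero 2 hne))
  refine h1.congr_deriv ?_
  have key : ∀ w : ℂ, (w + conj w) = 2 * (w.re : ℂ) := fun w => by
    rw [Complex.add_conj]; push_cast; rfl
  have hz : f r ≠ 0 := h0
  have hz' : conj (f r) ≠ 0 := by simpa using h0
  apply Complex.ofReal_injective
  have two : (2 : ℂ) ≠ 0 := two_ne_zero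
  apply mul_left_cancel₀ two
  rw [← key, ← key]
  simp only [gradPotential, map_div₀, map_mul, map_pow, map_add, map_sub, map_neg, map_ofNat, Complex.conj_conj,
    Complex.conj_ofReal, Pi.mul_apply, Pi.add_apply, Pi.pow_apply]
  push_cast
  field_simp
  simp only [map_ofNat]
  ring

/-- The polynomial that vanishes at `ζ` on the unit circle if the arc through `p + R ζ` of the
circle around `p` with radius `R` is singular. -/
noncomputable def circlePoly (A R C : ℝ) (b p : ℂ) : Polynomial ℂ :=
  Polynomial.C ((A : ℂ) * (p * conj p - R ^ 2)) * (Polynomial.C p + Polynomial.C (R : ℂ) * Polynomial.X)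
      * (Polynomial.C (conj p) * Polynomial.X + Polynomial.C (R : ℂ)) * Polynomial.X ^ 2
    + Polynomial.C (1 / 2 : ℂ) * (Polynomial.C b * (Polynomial.C p - Polynomial.C (R : ℂ) * Polynomial.X)
        * (Polynomial.C (conj p) * Polynomial.X + Polynomial.C (R : ℂ)) ^ 3
      + Polynomial.C (conj b) * (Polynomial.C (conj p) * Polynomial.X - Polynomial.C (R : ℂ))
        * Polynomial.X ^ 2 * (Polynomial.C p + Polynomial.C (R : ℂ) * Polynomial.X) ^ 3)
    + Polynomial.C (C : ℂ) * (Polynomial.C p + Polynomial.C (R : ℂ) * Polynomial.X) ^ 3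
      * (Polynomial.C (conj p) * Polynomial.X + Polynomial.C (R : ℂ)) ^ 3

theorem eval_circlePoly (A R C : ℝ) (b p ζ : ℂ) : (circlePoly A R C b p).eval ζ =
    A * (p * conj p - R ^ 2) * (p + R * ζ) * (conj p * ζ + R) * ζ ^ 2
    + 1 / 2 * (b * (p - R * ζ) * (conj p * ζ + R) ^ 3
      + conj b * (conj p * ζ - R) * ζ ^ 2 * (p + R * ζ) ^ 3)
    + C * (p + R * ζ) ^ 3 * (conj p * ζ + R) ^ 3 := by
  simp [circlePoly]

/-- On the unit circle `conj ζ = 1 / ζ`. Clearing the denominator `|z| ^ 6` and multiplying by a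
power of `ζ` therefore turns the real equation into a polynomial one in `ζ` alone. -/
theorem eval_circlePoly_eq_zero {A R C : ℝ} {b p ζ : ℂ} (hζ : ζ * conj ζ = 1) (hz : p + R * ζ ≠ 0)
    (h : R * (gradPotential A b (p + R * ζ) * conj ζ).re + potential A b (p + R * ζ) + C = 0) :
    (circlePoly A R C b p).eval ζ = 0 := by
  set z := p + R * ζ with hzdef
  set w := conj z with hw
  have hwne : w ≠ 0 := by simpa [hw] using hz
  have hwdef : w = conj p + R * conj ζ := by simp [hw, hzdef]
  have key : ∀ w : ℂ, (w + conj w) = 2 * (w.re : ℂ) := fun w => by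
    rw [Complex.add_conj]; push_cast; rfl
  have h1 : (R : ℂ) * (gradPotential A b z * conj ζ + conj (gradPotential A b z * conj ζ))
      + ((A * (z * w) + b * w ^ 2) / (z * w) ^ 2 + conj ((A * (z * w) + b * w ^ 2) / (z * w) ^ 2))
      + 2 * C = 0 := by
    rw [key, key]
    have := congrArg (fun x : ℝ => 2 * (x : ℂ)) h
    simp only [potential] at this
    push_cast at this
    linear_combination this
  have hcw : conj w = z := by simp [hw]
  simp only [gradPotential, map_div₀, map_mul, map_pow, map_add, map_neg, map_ofNat,
    Complex.conj_conj, Complex.conj_ofReal, ← hw, hcw] at h1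
  have e1 : (R : ℂ) * conj ζ = w - conj p := by rw [hwdef]; ring
  have e2 : (R : ℂ) * ζ = z - p := by rw [hzdef]; ring
  have h2 : -2 * ((A : ℂ) * z ^ 2 * w + conj b * z ^ 3) * (w - conj p)
      + -2 * ((A : ℂ) * w ^ 2 * z + b * w ^ 3) * (z - p)
      + (2 * A * (z * w) + b * w ^ 2 + conj b * z ^ 2) * (z * w) + 2 * C * (z * w) ^ 3 = 0 := by
    rw [← e1, ← e2]
    have h3 := congrArg (fun x => x * (z * w) ^ 3) h1
    simp only [zero_mul] at h3
    rw [← h3]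
    field_simp
    ring
  have e3 : conj p * ζ + R = ζ * w := by rw [hwdef]; linear_combination (-(R : ℂ)) * hζ
  have e4 : conj p * ζ - R = ζ * (2 * conj p - w) := by rw [hwdef]; linear_combination (R : ℂ) * hζ
  have e5 : p - R * ζ = 2 * p - z := by rw [hzdef]; ring
  have e6 : (R : ℂ) ^ 2 = (z - p) * (w - conj p) := by
    rw [← e1, ← e2]; linear_combination (-(R : ℂ) ^ 2) * hζ
  rw [eval_circlePoly, e3, e4, e5, e6, ← hzdef]
  linear_combination (ζ ^ 3 / 2) * h2

/-- No arc of a circle is singular with a negative energy constant. -/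
theorem circle_not_singular {A R C : ℝ} {b p : ℂ} (hA : ‖b‖ < A) (hC : C < 0) (hR : R ≠ 0)
    {S : Set ℂ} (hS : S.Infinite)
    (h : ∀ ζ ∈ S, ζ * conj ζ = 1 ∧ p + R * ζ ≠ 0 ∧
      R * (gradPotential A b (p + R * ζ) * conj ζ).re + potential A b (p + R * ζ) + C = 0) :
    False := by
  have hP : circlePoly A R C b p = 0 :=
    Polynomial.eq_zero_of_infinite_isRoot _ (hS.mono fun ζ hζ =>
      eval_circlePoly_eq_zero (h ζ hζ).1 (h ζ hζ).2.1 (h ζ hζ).2.2)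
  have hev : ∀ ζ : ℂ, _ := fun ζ => (eval_circlePoly A R C b p ζ).symm.trans
    ((congrArg (Polynomial.eval ζ) hP).trans Polynomial.eval_zero)
  have hRc : (R : ℂ) ≠ 0 := by exact_mod_cast hR
  have hCc : (C : ℂ) ≠ 0 := by exact_mod_cast hC.ne
  -- For a circle around the target the value at 1 gives `A + Re b = C R²`, positive on the left and
  -- negative on the right. Otherwise the value at 0 gives `b = -2 C p²`, hence `b ≠ 0`; the value
  -- at `-p / R` gives `|p|² = R²`; and the value at `p / R` is then `64 C p³ R³`, which is not 0.
  by_cases hp : p = 0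
  · have h1 := hev 1
    subst hp
    simp only [map_zero] at h1
    have h2 : (R : ℂ) ^ 4 * (-A - (b + conj b) / 2 + C * R ^ 2) = 0 := by linear_combination h1
    rw [Complex.add_conj] at h2
    push_cast at h2
    have h3 := (mul_eq_zero.1 h2).resolve_left (pow_ne_zero 4 hRc)
    have h4 : -A - b.re + C * R ^ 2 = 0 := by
      apply Complex.ofReal_injective
      push_cast
      linear_combination h3
    have h5 := (abs_le.1 (Complex.abs_re_le_norm b)).1
    have h6 : 0 < R ^ 2 := by positivity
    nlinarith
  · have h1 := hev 0
    have hb : b = -2 * C * p ^ 2 := by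
      have h2 : p * (R : ℂ) ^ 3 * (b + 2 * C * p ^ 2) = 0 := by linear_combination 2 * h1
      have h3 := (mul_eq_zero.1 h2).resolve_left (mul_ne_zero hp (pow_ne_zero 3 hRc))
      linear_combination h3
    have hb0 : b ≠ 0 := by
      rw [hb]; exact mul_ne_zero (mul_ne_zero (by norm_num) hCc) (pow_ne_zero 2 hp)
    have h2 := hev (-p / R)
    have e1 : p + R * (-p / R) = 0 := by field_simp; ring
    have e2 : p - R * (-p / R) = 2 * p := by field_simp; ring
    rw [e1, e2] at h2
    have h3 : b * p * (conj p * (-p / R) + R) ^ 3 = 0 := by linear_combination h2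
    have h4 := pow_eq_zero_iff (n := 3) (by norm_num) |>.1
      ((mul_eq_zero.1 h3).resolve_left (mul_ne_zero hb0 hp))
    have h5 : p * conj p = (R : ℂ) ^ 2 := by
      field_simp at h4
      linear_combination -h4
    have h6 := hev (p / R)
    have e3 : p + R * (p / R) = 2 * p := by field_simp; ring
    have e4 : p - R * (p / R) = 0 := by field_simp; ring
    have e5 : conj p * (p / R) = R := by
      field_simp; linear_combination h5
    rw [e3, e4, e5, h5] at h6
    have h7 : (C : ℂ) * p ^ 3 * R ^ 3 = 0 := by linear_combination h6 / 64
    exact mul_ne_zero (mul_ne_zero hCc (pow_ne_zero 3 hp)) (pow_ne_zero 3 hRc) h7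

/-! ### Circular paths and their analytic covectors. -/

/-- A circular path through `z₀` with course `θ₀ + α s`. -/
noncomputable def circ (v α θ₀ : ℝ) (z₀ : ℂ) (s : ℝ) : ℂ :=
  z₀ - Complex.I * (v / α : ℝ) * (rot (-(θ₀ + α * s)) - rot (-θ₀))

theorem hasDerivAt_circ {v α θ₀ : ℝ} (hα : α ≠ 0) (z₀ : ℂ) (s : ℝ) :
    HasDerivAt (circ v α θ₀ z₀) (v * rot (-(θ₀ + α * s))) s := by
  have h1 : HasDerivAt (fun s => -(θ₀ + α * s)) (-(α * 1)) s :=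
    (((hasDerivAt_id s).const_mul α).const_add θ₀).neg
  have h2 := (hasDerivAt_rot (-(θ₀ + α * s))).scomp s h1
  refine (((h2.sub_const (rot (-θ₀))).const_mul
    (Complex.I * (v / α : ℝ))).const_sub z₀).congr_deriv ?_
  have : (α : ℂ) ≠ 0 := by exact_mod_cast hα
  push_cast
  simp only [Complex.real_smul]
  push_cast
  field_simp
  linear_combination (-(v : ℂ) * rot (-(θ₀ + α * s))) * Complex.I_sq

theorem circ_zero (v α θ₀ : ℝ) (z₀ : ℂ) : circ v α θ₀ z₀ 0 = z₀ := by simp [circ]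

/-- The covector along the circular path is analytic. -/
theorem exists_analytic_costate {A v α θ₀ : ℝ} {b z₀ : ℂ} (hz : z₀ ≠ 0) (l₀ : ℂ) :
    ∃ L : ℝ → ℂ, AnalyticAt ℝ L 0 ∧ L 0 = l₀ ∧
      ∀ᶠ s in 𝓝 (0 : ℝ), HasDerivAt L (gradPotential A b (circ v α θ₀ z₀ s)) s := by
  set k : ℂ := Complex.I * (v / α : ℝ) * rot (-θ₀) with hk
  set Z : ℂ → ℂ := fun s => z₀ - k * (Complex.exp (α * Complex.I * s) - 1) with hZ
  -- Conjugation is not holomorphic, so the conjugate of the path is replaced by an entire function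
  -- that agrees with it at real times. Then `H` extends the gradient along the path holomorphically
  -- near 0, and a primitive of `H` on a disc gives the covector.
  set W : ℂ → ℂ := fun s => conj z₀ - conj k * (Complex.exp (-(α * Complex.I) * s) - 1) with hW
  set H : ℂ → ℂ := fun s => -2 * (A * Z s ^ 2 * W s + conj b * Z s ^ 3) / (Z s * W s) ^ 3 with hH
  have hZ0 : Z 0 = z₀ := by simp [hZ]
  have hW0 : W 0 = conj z₀ := by simp [hW]
  have hHa : AnalyticAt ℂ H 0 := by
    have ne : (Z 0 * W 0) ^ 3 ≠ 0 := by
      rw [hZ0, hW0]; exact pow_ne_zero 3 (mul_conj_ne_zero hz)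
    have aZ : AnalyticAt ℂ Z 0 := by simp only [hZ]; fun_prop
    have aW : AnalyticAt ℂ W 0 := by simp only [hW]; fun_prop
    refine AnalyticAt.div ?_ ((aZ.mul aW).pow 3) ne
    exact analyticAt_const.mul (((analyticAt_const.mul (aZ.pow 2)).mul aW).add
      (analyticAt_const.mul (aZ.pow 3)))
  obtain ⟨r, hr, hball⟩ := Metric.eventually_nhds_iff_ball.1 hHa.eventually_analyticAt
  have hd : DifferentiableOn ℂ H (Metric.ball 0 r) := fun s hs =>
    (hball s hs).differentiableAt.differentiableWithinAt
  obtain ⟨F, hF⟩ := hd.isExactOn_ball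
  have hFa : AnalyticAt ℂ F 0 :=
    DifferentiableOn.analyticAt (s := Metric.ball 0 r)
      (fun s hs => (hF s hs).differentiableAt.differentiableWithinAt) (Metric.ball_mem_nhds _ hr)
  refine ⟨fun s => l₀ + (F s - F 0), ?_, by simp, ?_⟩
  · have h1 : AnalyticAt ℝ F ((0 : ℝ) : ℂ) := by simpa using hFa.restrictScalars (𝕜 := ℝ)
    have h2 : AnalyticAt ℝ (fun s : ℝ => F s) 0 :=
      h1.comp (Complex.ofRealCLM.analyticAt 0)
    exact analyticAt_const.add (h2.sub analyticAt_const)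
  · filter_upwards [Metric.ball_mem_nhds (0 : ℝ) hr] with s hs
    have hs' : (s : ℂ) ∈ Metric.ball (0 : ℂ) r := by
      simpa using hs
    have h1 : HasDerivAt (fun s : ℝ => F s) (H s) s := (hF s hs').comp_ofReal
    refine ((h1.sub_const (F 0)).const_add l₀).congr_deriv ?_
    have hneg : rot (-(θ₀ + α * s)) = rot (-θ₀) * Complex.exp (α * Complex.I * s) := by
      rw [rot, rot, ← Complex.exp_add]; congr 1; push_cast; ring
    have eZ : circ v α θ₀ z₀ s = Z s := by
      simp only [circ, hZ, hk, hneg]; ring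
    have eW : conj (circ v α θ₀ z₀ s) = W s := by
      rw [eZ]
      simp only [hZ, hW, map_sub, map_mul, ← Complex.exp_conj, map_one, Complex.conj_ofReal,
        Complex.conj_I]
      congr 4; ring
    rw [gradPotential, eW, eZ]

/-! ### Extremals: choice of the comparison circle. -/

/-- A path `z` with speed `v` and course `θ`, a covector `l` and the switching function `φ`, related
as in the maximum principle for the running cost `-potential A b`. -/
structure Extremal (v a A T : ℝ) (b : ℂ) (z l : ℝ → ℂ) (θ φ : ℝ → ℝ) : Prop where
  v_pos : 0 < v
  a_pos : 0 < a
  T_pos : 0 < T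
  z_deriv : ∀ t ∈ Icc 0 T, HasDerivWithinAt z (v * rot (-θ t)) (Icc 0 T) t
  l_deriv : ∀ t ∈ Icc 0 T, HasDerivWithinAt l (gradPotential A b (z t)) (Icc 0 T) t
  φ_deriv : ∀ t ∈ Icc 0 T, HasDerivWithinAt φ (sweep v l θ t) (Icc 0 T) t
  z_ne : ∀ t ∈ Icc 0 T, z t ≠ 0
  lip : ∀ s ∈ Icc 0 T, ∀ t ∈ Icc 0 T, |θ s - θ t| ≤ a * |s - t|
  neg : ∀ s t, 0 ≤ s → s < t → t ≤ T → (∀ r ∈ Ioo s t, φ r < 0) → θ t - θ s = a * (t - s)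
  pos : ∀ s t, 0 ≤ s → s < t → t ≤ T → (∀ r ∈ Ioo s t, 0 < φ r) → θ t - θ s = -a * (t - s)

theorem conj_rot (x : ℝ) : conj (rot x) = rot (-x) := by
  rw [rot, rot, ← Complex.exp_conj]
  congr 1; simp

theorem rot_mul_rot_neg (x : ℝ) : rot x * rot (-x) = 1 := by
  rw [← rot_add, add_neg_cancel]; simp [rot]

theorem conj_mul_rot_neg (w : ℂ) (x : ℝ) : conj w * rot (-x) = conj (w * rot x) := by
  rw [map_mul, conj_rot]

theorem HasSignGerm.of_neg {f : ℝ → ℝ} (h : HasSignGerm fun s => -f s) : HasSignGerm f := by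
  obtain ⟨ε, hε, h | h | h⟩ := h
  · exact ⟨ε, hε, Or.inr (Or.inl fun s hs => by linarith [h s hs])⟩
  · exact ⟨ε, hε, Or.inl fun s hs => by linarith [h s hs]⟩
  · exact ⟨ε, hε, Or.inr (Or.inr fun s hs => by linarith [h s hs])⟩

theorem hasSignGerm_of_deriv {f f' : ℝ → ℝ} {ε : ℝ} (hε : 0 < ε) (hc : ContinuousOn f (Icc 0 ε))
    (h0 : f 0 = 0) (hd : ∀ s ∈ Ioo 0 ε, HasDerivAt f (f' s) s)
    (hs : (∀ s ∈ Ioo 0 ε, f' s < 0) ∨ (∀ s ∈ Ioo 0 ε, 0 < f' s)) : HasSignGerm f := by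
  have hsl : ∀ s ∈ Ioo 0 ε, ∃ x ∈ Ioo 0 ε, f' x = f s / s := by
    intro s hs
    obtain ⟨x, hx, hx'⟩ := exists_hasDerivAt_eq_slope f f' hs.1
      (hc.mono (Icc_subset_Icc le_rfl hs.2.le)) (fun y hy => hd y ⟨hy.1, hy.2.trans hs.2⟩)
    exact ⟨x, ⟨hx.1, hx.2.trans hs.2⟩, by rw [hx', h0, sub_zero, sub_zero]⟩
  rcases hs with h | h
  · refine ⟨ε, hε, Or.inl fun s hs => ?_⟩
    obtain ⟨x, hx, hx'⟩ := hsl s hs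
    have := h x hx
    rw [hx'] at this
    by_contra! hcon
    exact absurd this (not_lt.2 (div_nonneg hcon hs.1.le))
  · refine ⟨ε, hε, Or.inr (Or.inl fun s hs => ?_)⟩
    obtain ⟨x, hx, hx'⟩ := hsl s hs
    have := h x hx
    rw [hx'] at this
    exact (div_pos_iff_of_pos_right hs.1).1 this

/-- Comparison of a covector `ℓ` along a path with the covector `L` along the circular path of
curvature `α`. -/
structure CovectorComparison (a C ε α : ℝ) (ℓ ℓ₁ ℓ₂ L : ℝ → ℂ) (θ : ℝ → ℝ) : Prop where
  C_nonneg : 0 ≤ C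
  analytic : AnalyticAt ℝ L 0
  comp : ∀ s ∈ Ioo 0 ε, ‖ℓ s - L s‖ ≤ C * (s * |θ s - (θ 0 + α * s)|)
  comp₁ : ∀ s ∈ Ioo 0 ε, ‖ℓ₁ s - deriv L s‖ ≤ C * |θ s - (θ 0 + α * s)|
  comp₂ : ∀ s ∈ Ioo 0 ε, s * ‖ℓ₂ s - deriv (deriv L) s‖ ≤ C * |θ s - (θ 0 + α * s)|
  nondegenerate : ¬ ∀ᶠ s in 𝓝[>] 0, (L s * rot (θ 0 + α * s)).im = 0

namespace Extremal

variable {v a A T : ℝ} {b : ℂ} {z l : ℝ → ℂ} {θ φ : ℝ → ℝ}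

theorem θ_cont (h : Extremal v a A T b z l θ φ) : ContinuousOn θ (Icc 0 T) := by
  have hL : LipschitzOnWith ⟨a, h.a_pos.le⟩ θ (Icc 0 T) := by
    refine LipschitzOnWith.of_dist_le_mul fun s hs t ht => ?_
    rw [Real.dist_eq, Real.dist_eq]; exact h.lip s hs t ht
  exact hL.continuousOn

theorem φ_cont (h : Extremal v a A T b z l θ φ) : ContinuousOn φ (Icc 0 T) :=
  fun t ht => (h.φ_deriv t ht).continuousWithinAt

theorem l_cont (h : Extremal v a A T b z l θ φ) : ContinuousOn l (Icc 0 T) :=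
  fun t ht => (h.l_deriv t ht).continuousWithinAt

theorem z_cont (h : Extremal v a A T b z l θ φ) : ContinuousOn z (Icc 0 T) :=
  fun t ht => (h.z_deriv t ht).continuousWithinAt

/-- The sign germ of `φ` at a zero, from a factorization of the covector and comparisons with the
circular paths of both orientations. -/
theorem hasSignGerm_of_comparison (h : Extremal v a A T b z l θ φ) (h0 : φ 0 = 0) {j : ℕ}
    {ℓ ℓ₁ ℓ₂ : ℝ → ℂ} {w m : ℂ} (hw : w ≠ 0)
    (hfac : ∀ s ∈ Ioo 0 T, l s = (s : ℂ) ^ j * ℓ s)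
    (hℓ : ∀ s ∈ Ioo 0 T, HasDerivAt ℓ (ℓ₁ s) s) (hℓ₁ : ∀ s ∈ Ioo 0 T, HasDerivAt ℓ₁ (ℓ₂ s) s)
    (hcmp : ∀ α, α = a ∨ α = -a → ∃ C ε L, 0 < ε ∧ ε ≤ T ∧ L 0 = w ∧ deriv L 0 = m ∧
      CovectorComparison a C ε α ℓ ℓ₁ ℓ₂ L θ) : HasSignGerm φ := by
  have ha := h.a_pos
  have hφd : ∀ s ∈ Ioo 0 T, HasDerivAt φ (s ^ j * sweep v ℓ θ s) s := by
    intro s hs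
    have h1 := (h.φ_deriv s (Ioo_subset_Icc_self hs)).hasDerivAt (Icc_mem_nhds hs.1 hs.2)
    refine h1.congr_deriv ?_
    rw [sweep, sweep, hfac s hs, mul_assoc, ← Complex.ofReal_pow, Complex.im_ofReal_mul]
    ring
  by_cases him : (w * rot (θ 0)).im = 0
  · have hre : (w * rot (θ 0)).re ≠ 0 := by
      intro hre
      have h1 : w * rot (θ 0) = 0 := Complex.ext hre him
      rcases mul_eq_zero.1 h1 with h2 | h2
      · exact hw h2
      · have := norm_rot (θ 0); rw [h2, norm_zero] at this; exact zero_ne_one this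
    -- This sign decides on the orientation of the circle. If it is nonnegative, the circle of
    -- turning rate `a` satisfies the sign condition of `CircleComparison.hasSignGerm`. Otherwise
    -- the circle of rate `-a` is used: complex conjugation reflects the plane, negates `θ` and `φ`,
    -- reverses the sign in question and turns the rate into `a`.
    rcases le_total 0 ((m * rot (θ 0)).im * (w * rot (θ 0)).re) with hs | hs
    · obtain ⟨C, ε, L, hε, hεT, hL0, hL1, hc⟩ := hcmp a (Or.inl rfl)
      have hI : Ioo 0 ε ⊆ Ioo 0 T := Ioo_subset_Ioo le_rfl hεT
      have hI' : Icc 0 ε ⊆ Icc 0 T := Icc_subset_Icc le_rfl hεT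
      have hD : ∀ s ∈ Ioo 0 ε, |θ s - (θ 0 + a * s)| = a * s - (θ s - θ 0) := by
        intro s hs
        have h1 := h.lip s (hI' (Ioo_subset_Icc_self hs)) 0 ⟨le_rfl, h.T_pos.le⟩
        rw [sub_zero, abs_of_pos hs.1] at h1
        rw [abs_of_nonpos (by linarith [(abs_le.1 h1).2])]; ring
      have hcc : CircleComparison ε v a C j ℓ ℓ₁ ℓ₂ L θ φ :=
        { ε_pos := hε, v_pos := h.v_pos, a_pos := ha, C_nonneg := hc.C_nonneg
          ℓ_deriv := fun s hs => hℓ s (hI hs)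
          ℓ₁_deriv := fun s hs => hℓ₁ s (hI hs)
          L_analytic := hc.analytic
          lip := fun s hs t ht => h.lip s (hI' hs) t (hI' ht)
          comp := fun s hs => by rw [← hD s hs]; exact hc.comp s hs
          comp₁ := fun s hs => by rw [← hD s hs]; exact hc.comp₁ s hs
          comp₂ := fun s hs => by rw [← hD s hs]; exact hc.comp₂ s hs
          zero := h0
          cont := h.φ_cont.mono hI'
          deriv := fun s hs => hφd s (hI hs)
          neg := fun s t h1 h2 h3 h4 => h.neg s t h1.le h2 (h3.le.trans hεT) h4
          pos := fun s t h1 h2 h3 h4 => h.pos s t h1.le h2 (h3.le.trans hεT) h4 }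
      refine hcc.hasSignGerm ?_ ?_ ?_ hc.nondegenerate
      · rw [hL0, him]
      · rwa [hL0]
      · rwa [hL0, hL1]
    · obtain ⟨C, ε, L, hε, hεT, hL0, hL1, hc⟩ := hcmp (-a) (Or.inr rfl)
      have hI : Ioo 0 ε ⊆ Ioo 0 T := Ioo_subset_Ioo le_rfl hεT
      have hI' : Icc 0 ε ⊆ Icc 0 T := Icc_subset_Icc le_rfl hεT
      have hD : ∀ s ∈ Ioo 0 ε, |θ s - (θ 0 + -a * s)| = a * s - (-θ s - -θ 0) := by
        intro s hs
        have h1 := h.lip s (hI' (Ioo_subset_Icc_self hs)) 0 ⟨le_rfl, h.T_pos.le⟩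
        rw [sub_zero, abs_of_pos hs.1] at h1
        rw [abs_of_nonneg (by linarith [(abs_le.1 h1).1])]; ring
      have hstar : ∀ w x : ℂ, ‖conj w - conj x‖ = ‖w - x‖ := fun w x => by
        rw [← map_sub, Complex.norm_conj]
      have hds : ∀ f : ℝ → ℂ, deriv (fun s => conj (f s)) = fun s => conj (deriv f s) := fun f => by
        funext s; exact deriv.star
      have hcc : CircleComparison ε v a C j (fun s => conj (ℓ s)) (fun s => conj (ℓ₁ s))
          (fun s => conj (ℓ₂ s)) (fun s => conj (L s)) (fun s => -θ s) (fun s => -φ s) :=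
        { ε_pos := hε, v_pos := h.v_pos, a_pos := ha, C_nonneg := hc.C_nonneg
          ℓ_deriv := fun s hs => (hℓ s (hI hs)).star
          ℓ₁_deriv := fun s hs => (hℓ₁ s (hI hs)).star
          L_analytic := (Complex.conjCLE.toContinuousLinearMap.analyticAt _).comp hc.analytic
          lip := fun s hs t ht => by
            have := h.lip s (hI' hs) t (hI' ht)
            rwa [← abs_neg, show -(-θ s - -θ t) = θ s - θ t by ring]
          comp := fun s hs => by rw [← hD s hs, hstar]; exact hc.comp s hs
          comp₁ := fun s hs => by rw [← hD s hs, hds, hstar]; exact hc.comp₁ s hs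
          comp₂ := fun s hs => by rw [← hD s hs, hds, hds, hstar]; exact hc.comp₂ s hs
          zero := by rw [h0, neg_zero]
          cont := (h.φ_cont.mono hI').neg
          deriv := fun s hs => by
            refine (hφd s (hI hs)).neg.congr_deriv ?_
            simp only [sweep, conj_mul_rot_neg, Complex.conj_im]; ring
          neg := fun s t h1 h2 h3 h4 => by
            have := h.pos s t h1.le h2 (h3.le.trans hεT) fun r hr => by linarith [h4 r hr]
            linarith
          pos := fun s t h1 h2 h3 h4 => by
            have := h.neg s t h1.le h2 (h3.le.trans hεT) fun r hr => by linarith [h4 r hr]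
            linarith }
      refine (hcc.hasSignGerm ?_ ?_ ?_ ?_).of_neg
      · rw [conj_mul_rot_neg, Complex.conj_im, hL0, him, neg_zero]
      · rwa [conj_mul_rot_neg, Complex.conj_re, hL0]
      · rw [hds, conj_mul_rot_neg, conj_mul_rot_neg, Complex.conj_re, Complex.conj_im, hL0, hL1]
        linarith
      · intro hev
        refine hc.nondegenerate ?_
        filter_upwards [hev] with s hs
        rw [show -θ 0 + a * s = -(θ 0 + -a * s) by ring, conj_mul_rot_neg, Complex.conj_im] at hs
        linarith
  -- Here `φ' / s ^ j` has a nonzero limit at 0, so `φ` is strictly monotone near 0. The comparison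
  -- serves only to show that `ℓ` tends to `w`.
  · obtain ⟨C, ε, L, hε, hεT, hL0, hL1, hc⟩ := hcmp a (Or.inl rfl)
    have hI : Ioo 0 ε ⊆ Ioo 0 T := Ioo_subset_Ioo le_rfl hεT
    have hθ : Tendsto θ (𝓝[>] 0) (𝓝 (θ 0)) :=
      (h.θ_cont 0 ⟨le_rfl, h.T_pos.le⟩).mono_left
        (nhdsWithin_le_of_mem (mem_of_superset (Ioo_mem_nhdsGT h.T_pos) Ioo_subset_Icc_self))
    have hid : Tendsto (fun s : ℝ => s) (𝓝[>] 0) (𝓝 0) := nhdsWithin_le_nhds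
    have hℓt : Tendsto ℓ (𝓝[>] 0) (𝓝 w) := by
      have h1 : Tendsto L (𝓝[>] 0) (𝓝 w) := by
        rw [← hL0]; exact hc.analytic.continuousAt.tendsto.mono_left nhdsWithin_le_nhds
      have h2 : Tendsto (fun s => ℓ s - L s) (𝓝[>] 0) (𝓝 0) := by
        refine squeeze_zero_norm' (a := fun s => C * (s * |θ s - (θ 0 + a * s)|)) ?_ ?_
        · filter_upwards [Ioo_mem_nhdsGT hε] with s hs using hc.comp s hs
        · have h3 := (hid.mul ((hθ.sub ((hid.const_mul a).const_add (θ 0))).abs)).const_mul C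
          simpa using h3
      simpa using h2.add h1
    have hsw : Tendsto (sweep v ℓ θ) (𝓝[>] 0) (𝓝 (-v * (w * rot (θ 0)).im)) := by
      have h1 := (Complex.continuous_im.tendsto _).comp
        (hℓt.mul ((continuous_rot.tendsto _).comp hθ))
      exact h1.const_mul (-v)
    have hne : -v * (w * rot (θ 0)).im ≠ 0 := mul_ne_zero (by linarith [h.v_pos]) him
    have hev : ∃ δ > 0, δ ≤ T ∧ ((∀ s ∈ Ioo 0 δ, s ^ j * sweep v ℓ θ s < 0) ∨
        (∀ s ∈ Ioo 0 δ, 0 < s ^ j * sweep v ℓ θ s)) := by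
      rcases lt_or_gt_of_ne hne with hlt | hlt
      · obtain ⟨δ, hδ, hsub⟩ := mem_nhdsGT_iff_exists_Ioo_subset.1 (hsw.eventually (gt_mem_nhds hlt))
        have hδ' : 0 < δ := hδ
        refine ⟨min δ T, lt_min hδ' h.T_pos, min_le_right _ _, Or.inl fun s hs => ?_⟩
        exact mul_neg_of_pos_of_neg (pow_pos hs.1 j) (hsub ⟨hs.1, hs.2.trans_le (min_le_left _ _)⟩)
      · obtain ⟨δ, hδ, hsub⟩ := mem_nhdsGT_iff_exists_Ioo_subset.1 (hsw.eventually (lt_mem_nhds hlt))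
        have hδ' : 0 < δ := hδ
        refine ⟨min δ T, lt_min hδ' h.T_pos, min_le_right _ _, Or.inr fun s hs => ?_⟩
        exact mul_pos (pow_pos hs.1 j) (hsub ⟨hs.1, hs.2.trans_le (min_le_left _ _)⟩)
    obtain ⟨δ, hδ, hδT, hsign⟩ := hev
    exact hasSignGerm_of_deriv hδ (h.φ_cont.mono (Icc_subset_Icc le_rfl hδT)) h0
      (fun s hs => hφd s ⟨hs.1, hs.2.trans_le hδT⟩) hsign

end Extremal

/-! ### Circular paths with negative energy, and the deviation of an extremal from them. -/

theorem rot_injOn {δ : ℝ} {α θ₀ : ℝ} (hα : α ≠ 0) (hδ : δ * |α| ≤ 1) :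
    InjOn (fun s => rot (-(θ₀ + α * s))) (Ioo 0 δ) := by
  intro s hs t ht hst
  have hst' : rot (-(θ₀ + α * s)) = rot (-(θ₀ + α * t)) := hst
  have h1 : rot (α * (t - s)) = 1 := by
    rw [show α * (t - s) = -(θ₀ + α * s) + (θ₀ + α * t) by ring, rot_add, hst',
      mul_comm, rot_mul_rot_neg]
  have h2 : Real.cos (α * (t - s)) = 1 := by
    have h3 := congrArg Complex.re h1
    have h4 : -((α * (t - s) : ℝ) * Complex.I) = ((-(α * (t - s)) : ℝ) : ℂ) * Complex.I := by
      push_cast; ring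
    rw [rot, h4, Complex.exp_ofReal_mul_I_re, Real.cos_neg] at h3
    simpa using h3
  have h5 : |α * (t - s)| < 1 := by
    rw [abs_mul]
    have h6 : |t - s| < δ := by rw [abs_lt]; constructor <;> linarith [hs.1, hs.2, ht.1, ht.2]
    have := mul_lt_mul_of_pos_left h6 (abs_pos.2 hα)
    linarith
  have h6 := abs_lt.1 h5
  have h7 := (Real.cos_eq_one_iff_of_lt_of_lt (by linarith [Real.pi_gt_three])
    (by linarith [Real.pi_gt_three])).1 h2
  have := (mul_eq_zero.1 h7).resolve_left hα
  linarith

/-- With a negative energy constant, no circular path is singular. -/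
theorem circ_not_singular {A v α θ₀ : ℝ} {b z₀ : ℂ} {L : ℝ → ℂ} (hA : ‖b‖ < A) (hα : α ≠ 0)
    (hv : 0 < v) (hz : z₀ ≠ 0)
    (hL : ∀ᶠ s in 𝓝 (0 : ℝ), HasDerivAt L (gradPotential A b (circ v α θ₀ z₀ s)) s)
    (hC : v * (L 0 * rot θ₀).re < potential A b z₀) :
    ¬ ∀ᶠ s in 𝓝[>] 0, (L s * rot (θ₀ + α * s)).im = 0 := by
  intro hev
  set G : ℝ → ℂ := fun s => gradPotential A b (circ v α θ₀ z₀ s) with hG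
  set W : ℝ → ℂ := fun s => L s * rot (θ₀ + α * s) with hW
  have hcd := fun s => hasDerivAt_circ (v := v) (θ₀ := θ₀) hα z₀ s
  have hne : ∀ᶠ s in 𝓝 (0 : ℝ), circ v α θ₀ z₀ s ≠ 0 :=
    (hcd 0).continuousAt.eventually_ne (by rwa [circ_zero])
  obtain ⟨δ₁, hδ₁, hball⟩ := Metric.eventually_nhds_iff.1 (hL.and hne)
  obtain ⟨δ₂, hδ₂, hsub⟩ := mem_nhdsGT_iff_exists_Ioo_subset.1 hev
  have hδ₂' : 0 < δ₂ := hδ₂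
  set δ := min (min δ₁ δ₂) (1 / |α|) with hδ
  have hαp : 0 < |α| := abs_pos.2 hα
  have hδp : 0 < δ := by positivity
  have hin : ∀ s ∈ Ico 0 δ, HasDerivAt L (G s) s ∧ circ v α θ₀ z₀ s ≠ 0 := fun s hs =>
    hball (by rw [Real.dist_eq, sub_zero, abs_of_nonneg hs.1]
              exact hs.2.trans_le ((min_le_left _ _).trans (min_le_left _ _)))
  have him : ∀ s ∈ Ioo 0 δ, (W s).im = 0 := fun s hs =>
    hsub ⟨hs.1, hs.2.trans_le ((min_le_left _ _).trans (min_le_right _ _))⟩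
  have hηd : ∀ s : ℝ, HasDerivAt (fun s => θ₀ + α * s) α s := fun s => by
    have := ((hasDerivAt_id s).const_mul α).const_add θ₀
    rw [mul_one] at this
    exact this
  have hWd : ∀ s ∈ Ico 0 δ,
      HasDerivAt W (G s * rot (θ₀ + α * s) - Complex.I * α * W s) s := fun s hs =>
    hasDerivWithinAt_univ.1 ((hin s hs).1.hasDerivWithinAt.mul_rot (hηd s).hasDerivWithinAt)
  have hI : ∀ w : ℂ, (Complex.I * α * w).im = α * w.re ∧ (Complex.I * α * w).re = -(α * w.im) :=
    fun w => by
      constructor <;> simp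
  -- This is the derivative of the identity `Im W = 0`, which singularity of the arc would supply.
  have hderiv : ∀ s ∈ Ioo 0 δ, (G s * rot (θ₀ + α * s)).im = α * (W s).re := by
    intro s hs
    have h1 := hasDerivWithinAt_univ.1
      (hasDerivWithinAt_im (hWd s (Ioo_subset_Ico_self hs)).hasDerivWithinAt (S := univ))
    have h2 : HasDerivAt (fun s => (W s).im) 0 s := by
      refine (hasDerivAt_const s (0 : ℝ)).congr_of_eventuallyEq ?_
      filter_upwards [isOpen_Ioo.mem_nhds hs] with y hy using him y hy
    have h3 := h1.unique h2
    rw [Complex.sub_im, (hI _).1] at h3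
    linarith
  -- The energy along the circle: its derivative is a multiple of `Im W`, so it keeps its negative
  -- initial value.
  set K : ℝ → ℝ := fun s => v * (W s).re - potential A b (circ v α θ₀ z₀ s) with hK
  have hKd : ∀ s ∈ Ico 0 δ, HasDerivAt K (v * ((G s * rot (θ₀ + α * s)).re + α * (W s).im)
      - (G s * conj (v * rot (-(θ₀ + α * s)))).re) s := by
    intro s hs
    have h1 := hasDerivWithinAt_re (hWd s hs).hasDerivWithinAt (S := univ)
    have h2 := hasDerivWithinAt_potential (A := A) (b := b) (hcd s).hasDerivWithinAt (S := univ)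
      (hin s hs).2
    have h3 := hasDerivWithinAt_univ.1 ((h1.const_mul v).sub h2)
    refine h3.congr_deriv ?_
    rw [Complex.sub_re, (hI _).2]; ring
  have hKc : ∀ s ∈ Ioo 0 δ, K s = K 0 := by
    intro s hs
    obtain ⟨x, hx, hx'⟩ := exists_hasDerivAt_eq_slope K _ hs.1
      (fun y hy => (hKd y ⟨hy.1, hy.2.trans_lt hs.2⟩).continuousAt.continuousWithinAt)
      (fun y hy => hKd y ⟨hy.1.le, hy.2.trans hs.2⟩)
    have hxI : x ∈ Ioo 0 δ := ⟨hx.1, hx.2.trans hs.2⟩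
    rw [him x hxI, mul_zero, add_zero, map_mul, conj_rot, neg_neg, Complex.conj_ofReal,
      mul_left_comm, Complex.re_ofReal_mul, sub_self, eq_comm, div_eq_zero_iff] at hx'
    rcases hx' with h1 | h1
    · linarith
    · linarith [hs.1]
  have hK0 : K 0 < 0 := by
    simp only [hK, hW, mul_zero, add_zero, circ_zero]; linarith
  -- The signed radius; `p` is the centre and `ζ = -i rot (-(θ₀ + α s))`. Inserting `hderiv` into `K
  -- s = K 0` gives the equation of `circle_not_singular` with energy constant `K 0`.
  set R := v / α with hR
  have hR0 : R ≠ 0 := div_ne_zero hv.ne' hα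
  set p : ℂ := z₀ + Complex.I * R * rot (-θ₀) with hp
  have hcirc : ∀ s, p + R * (-Complex.I * rot (-(θ₀ + α * s))) = circ v α θ₀ z₀ s := fun s => by
    rw [hp, circ]; ring
  have hinj : InjOn (fun s => -Complex.I * rot (-(θ₀ + α * s))) (Ioo 0 δ) := by
    intro s hs t ht hst
    refine rot_injOn (θ₀ := θ₀) hα ?_ hs ht ?_
    · rw [← le_div_iff₀ hαp]; exact min_le_right _ _
    · exact mul_left_cancel₀ (neg_ne_zero.2 Complex.I_ne_zero) hst
  refine circle_not_singular (p := p) hA hK0 hR0 ((Ioo_infinite hδp).image hinj) ?_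
  rintro _ ⟨s, hs, rfl⟩
  have hconj : conj (-Complex.I * rot (-(θ₀ + α * s))) = Complex.I * rot (θ₀ + α * s) := by
    rw [map_mul, conj_rot, neg_neg, map_neg, Complex.conj_I, neg_neg]
  refine ⟨?_, ?_, ?_⟩
  · simp only [hconj]
    have := rot_mul_rot_neg (θ₀ + α * s)
    linear_combination (-rot (θ₀ + α * s) * rot (-(θ₀ + α * s))) * Complex.I_sq + this
  · simp only [hcirc]; exact (hin s (Ioo_subset_Ico_self hs)).2
  · simp only [hcirc, hconj]
    have h1 := hderiv s hs
    have h2 : (gradPotential A b (circ v α θ₀ z₀ s) * (Complex.I * rot (θ₀ + α * s))).re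
        = -(G s * rot (θ₀ + α * s)).im := by
      rw [show gradPotential A b (circ v α θ₀ z₀ s) * (Complex.I * rot (θ₀ + α * s))
        = Complex.I * (G s * rot (θ₀ + α * s)) by simp only [hG]; ring]
      simp
    have h3 : K s = v * (W s).re - potential A b (circ v α θ₀ z₀ s) := rfl
    rw [h2, h1, ← hKc s hs, h3, hR]
    field_simp
    ring

namespace Extremal

variable {v a A T : ℝ} {b : ℂ} {z l : ℝ → ℂ} {θ φ : ℝ → ℝ}

/-- The turning rate is at most `a` in modulus, so `θ - θ 0 - α s` is monotone for an extreme rate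
`α`. Hence an integral of the deviation over `[0, s]` is at most `s` times its last value. -/
theorem deviation_mono (h : Extremal v a A T b z l θ φ) {α : ℝ} (hα : α = a ∨ α = -a) {r s : ℝ}
    (hr : 0 ≤ r) (hrs : r ≤ s) (hs : s ≤ T) :
    |θ r - (θ 0 + α * r)| ≤ |θ s - (θ 0 + α * s)| := by
  have h0 : (0 : ℝ) ∈ Icc 0 T := ⟨le_rfl, h.T_pos.le⟩
  have h1 := h.lip r ⟨hr, hrs.trans hs⟩ 0 h0
  have h2 := h.lip s ⟨hr.trans hrs, hs⟩ 0 h0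
  have h3 := h.lip s ⟨hr.trans hrs, hs⟩ r ⟨hr, hrs.trans hs⟩
  rw [sub_zero, abs_of_nonneg hr] at h1
  rw [sub_zero, abs_of_nonneg (hr.trans hrs)] at h2
  rw [abs_of_nonneg (by linarith : 0 ≤ s - r)] at h3
  rw [abs_le] at h1 h2 h3
  rcases hα with rfl | rfl
  · rw [abs_of_nonpos (by linarith), abs_of_nonpos (by linarith)]; linarith
  · rw [abs_of_nonneg (by linarith), abs_of_nonneg (by linarith)]; linarith

/-- Comparison of the covector with the covector along a circular path. -/
theorem exists_circle_comparison (h : Extremal v a A T b z l θ φ) (hA : ‖b‖ < A)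
    (ham : v * (l 0 * rot (θ 0)).re < potential A b (z 0)) {α : ℝ} (hα : α = a ∨ α = -a) :
    ∃ C ε L, 0 < ε ∧ ε ≤ T ∧ 0 ≤ C ∧ AnalyticAt ℝ L 0 ∧ L 0 = l 0 ∧
      deriv L 0 = gradPotential A b (z 0) ∧
      deriv (deriv L) 0 = fderiv ℝ (gradPotential A b) (z 0) (v * rot (-θ 0)) ∧
      (∀ s ∈ Ioo 0 ε, ‖l s - L s‖ ≤ C * (s ^ 2 * |θ s - (θ 0 + α * s)|) ∧
        ‖gradPotential A b (z s) - deriv L s‖ ≤ C * (s * |θ s - (θ 0 + α * s)|) ∧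
        ‖fderiv ℝ (gradPotential A b) (z s) (v * rot (-θ s)) - deriv (deriv L) s‖
          ≤ C * |θ s - (θ 0 + α * s)|) ∧
      ¬ ∀ᶠ s in 𝓝[>] 0, (L s * rot (θ 0 + α * s)).im = 0 := by
  have hv := h.v_pos
  have hα0 : α ≠ 0 := by
    rcases hα with rfl | rfl
    · exact h.a_pos.ne'
    · exact neg_ne_zero.2 h.a_pos.ne'
  have hT0 : (0 : ℝ) ∈ Icc 0 T := ⟨le_rfl, h.T_pos.le⟩
  have hz0 := h.z_ne 0 hT0
  set G := gradPotential A b with hG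
  set c : ℝ → ℂ := circ v α (θ 0) (z 0) with hc
  have hcd : ∀ s, HasDerivAt c (v * rot (-(θ 0 + α * s))) s := hasDerivAt_circ hα0 (z 0)
  obtain ⟨L, hLa, hL0, hLd⟩ := exists_analytic_costate (A := A) (v := v) (α := α) (θ₀ := θ 0)
    (b := b) hz0 (l 0)
  have hG1 : ContDiffAt ℝ 2 G (z 0) := contDiffAt_gradPotential hz0
  obtain ⟨K₁, t₁, ht₁, hK₁⟩ := (hG1.of_le (by norm_num : (1 : WithTop ℕ∞) ≤ 2)).exists_lipschitzOnWith
  have hG2 : ContDiffAt ℝ 1 (fderiv ℝ G) (z 0) := hG1.fderiv_right (by norm_num)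
  obtain ⟨K₂, t₂, ht₂, hK₂⟩ := hG2.exists_lipschitzOnWith
  set M := ‖fderiv ℝ G (z 0)‖ + 1 with hM
  have hMp : 0 < M := by positivity
  have hU : ∀ᶠ w in 𝓝 (z 0), w ∈ t₁ ∧ w ∈ t₂ ∧ ‖fderiv ℝ G w‖ ≤ M ∧ w ≠ 0 := by
    filter_upwards [ht₁, ht₂, hG2.continuousAt.norm.eventually (gt_mem_nhds (lt_add_one _)),
      isOpen_ne.mem_nhds hz0] with w h1 h2 h3 h4 using ⟨h1, h2, h3.le, h4⟩
  have hzt : Tendsto z (𝓝[≥] 0) (𝓝 (z 0)) := by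
    have := h.z_cont 0 hT0
    rwa [ContinuousWithinAt, nhdsWithin_Icc_eq_nhdsGE h.T_pos] at this
  have hct : Tendsto c (𝓝[≥] 0) (𝓝 (z 0)) := by
    have := (hcd 0).continuousAt.tendsto
    rw [hc, circ_zero] at this
    exact this.mono_left nhdsWithin_le_nhds
  have hev := ((hzt.eventually hU).and (hct.eventually hU)).and
    (hLd.eventually_nhds.filter_mono nhdsWithin_le_nhds)
  obtain ⟨u, hu, hsub⟩ := mem_nhdsGE_iff_exists_Icc_subset.1 hev
  have hε : 0 < min u T := lt_min hu h.T_pos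
  have hin : ∀ s ∈ Icc 0 (min u T), _ := fun s hs => hsub ⟨hs.1, hs.2.trans (min_le_left _ _)⟩
  have hT : ∀ s ∈ Icc 0 (min u T), s ∈ Icc 0 T := fun s hs => ⟨hs.1, hs.2.trans (min_le_right _ _)⟩
  set Δ : ℝ → ℝ := fun s => |θ s - (θ 0 + α * s)| with hΔ
  have hΔ0 : ∀ s, 0 ≤ Δ s := fun s => abs_nonneg _
  -- Monotonicity of `Δ` yields a factor `s` with each integration: one from courses to positions, a
  -- second from gradients to covectors. The resulting `s² Δ` leaves room for the later division by
  -- `s`.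
  have hdz : ∀ s ∈ Icc 0 (min u T), ‖z s - c s‖ ≤ v * (s * Δ s) := by
    intro s hs
    have hsT := hT s hs
    have h1 := norm_image_sub_le_of_norm_deriv_le_segment' (f := fun r => z r - c r)
      (f' := fun r => v * rot (-θ r) - v * rot (-(θ 0 + α * r))) (C := v * Δ s) (a := 0) (b := s)
      (fun x hx => ((h.z_deriv x ⟨hx.1, hx.2.trans hsT.2⟩).mono
        (Icc_subset_Icc le_rfl hsT.2)).sub (hcd x).hasDerivWithinAt)
      (fun x hx => by
        rw [← mul_sub, norm_mul, Complex.norm_real, Real.norm_eq_abs, abs_of_pos hv]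
        refine mul_le_mul_of_nonneg_left ((norm_rot_sub_le _ _).trans ?_) hv.le
        rw [← abs_neg, show -(-θ x - -(θ 0 + α * x)) = θ x - (θ 0 + α * x) by ring]
        exact h.deviation_mono hα hx.1 hx.2.le hsT.2) s ⟨hs.1, le_rfl⟩
    simp only [hc, circ_zero, sub_self, sub_zero] at h1 ⊢
    linarith
  have hdG : ∀ s ∈ Icc 0 (min u T), ‖G (z s) - G (c s)‖ ≤ K₁ * v * (s * Δ s) := by
    intro s hs
    have h1 := hK₁.dist_le_mul _ (hin s hs).1.1.1 _ (hin s hs).1.2.1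
    rw [dist_eq_norm, dist_eq_norm] at h1
    exact h1.trans ((mul_le_mul_of_nonneg_left (hdz s hs) K₁.coe_nonneg).trans_eq (by ring))
  have hdL1 : ∀ s ∈ Icc 0 (min u T), deriv L s = G (c s) := fun s hs =>
    (hin s hs).2.self_of_nhds.deriv
  have hdL2 : ∀ s ∈ Icc 0 (min u T),
      deriv (deriv L) s = fderiv ℝ G (c s) (v * rot (-(θ 0 + α * s))) := by
    intro s hs
    have h1 : deriv L =ᶠ[𝓝 s] fun s => G (c s) := by
      filter_upwards [(hin s hs).2] with y hy using hy.deriv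
    rw [h1.deriv_eq]
    have h2 : DifferentiableAt ℝ G (c s) :=
      (contDiffAt_gradPotential (n := 1) (hin s hs).1.2.2.2.2).differentiableAt (by norm_num)
    exact (h2.hasFDerivAt.comp_hasDerivAt s (hcd s)).deriv
  have h0I : (0 : ℝ) ∈ Icc 0 (min u T) := ⟨le_rfl, hε.le⟩
  refine ⟨K₁ * v + K₂ * v ^ 2 * T + M * v, min u T, L, hε, min_le_right _ _, ?_, hLa, hL0, ?_, ?_,
    ?_, ?_⟩
  · have := h.T_pos; positivity
  · rw [hdL1 0 h0I, hc, circ_zero]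
  · rw [hdL2 0 h0I, hc, circ_zero, mul_zero, add_zero]
  · intro s hs
    have hs' := Ioo_subset_Icc_self hs
    have hsT := hT s hs'
    have hTp := h.T_pos
    have hk1 : 0 ≤ (K₁ : ℝ) := K₁.2
    have hk2 : 0 ≤ (K₂ : ℝ) := K₂.2
    have hC1 : K₁ * v ≤ K₁ * v + K₂ * v ^ 2 * T + M * v := by
      have : 0 ≤ K₂ * v ^ 2 * T := by positivity
      have : 0 ≤ M * v := by positivity
      linarith
    have hΔs := hΔ0 s
    have hs0 := hs.1
    refine ⟨?_, ?_, ?_⟩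
    · have h1 := norm_image_sub_le_of_norm_deriv_le_segment' (f := fun r => l r - L r)
        (f' := fun r => G (z r) - G (c r)) (C := K₁ * v * (s * Δ s)) (a := 0) (b := s)
        (fun x hx => ((h.l_deriv x ⟨hx.1, hx.2.trans hsT.2⟩).mono
          (Icc_subset_Icc le_rfl hsT.2)).sub
          ((hin x ⟨hx.1, hx.2.trans hs'.2⟩).2.self_of_nhds.hasDerivWithinAt))
        (fun x hx => by
          refine (hdG x ⟨hx.1, hx.2.le.trans hs'.2⟩).trans ?_
          have h2 := h.deviation_mono hα hx.1 hx.2.le hsT.2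
          have h3 := hx.1
          have h4 := hx.2.le
          have h5 : Δ x ≤ Δ s := h2
          have h6 := hΔ0 x
          gcongr) s ⟨hs.1.le, le_rfl⟩
      simp only [hL0, sub_self, sub_zero] at h1
      refine h1.trans ?_
      have := mul_le_mul_of_nonneg_right hC1 (mul_nonneg (sq_nonneg s) hΔs)
      refine le_trans (le_of_eq ?_) this
      ring
    · rw [hdL1 s hs']
      exact (hdG s hs').trans (mul_le_mul_of_nonneg_right hC1 (mul_nonneg hs.1.le hΔs))
    · rw [hdL2 s hs']
      have e : fderiv ℝ G (z s) (v * rot (-θ s)) - fderiv ℝ G (c s) (v * rot (-(θ 0 + α * s)))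
          = (fderiv ℝ G (z s) - fderiv ℝ G (c s)) (v * rot (-θ s))
            + fderiv ℝ G (c s) (v * rot (-θ s) - v * rot (-(θ 0 + α * s))) := by
        rw [sub_apply, map_sub]; ring
      rw [e]
      have n1 : ‖(v : ℂ) * rot (-θ s)‖ = v := by
        rw [norm_mul, norm_rot, mul_one, Complex.norm_real, Real.norm_eq_abs, abs_of_pos hv]
      have n2 : ‖(v : ℂ) * rot (-θ s) - v * rot (-(θ 0 + α * s))‖ ≤ v * Δ s := by
        rw [← mul_sub, norm_mul, Complex.norm_real, Real.norm_eq_abs, abs_of_pos hv]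
        refine mul_le_mul_of_nonneg_left ((norm_rot_sub_le _ _).trans ?_) hv.le
        rw [← abs_neg, show -(-θ s - -(θ 0 + α * s)) = θ s - (θ 0 + α * s) by ring]
      have h1 := hK₂.dist_le_mul _ (hin s hs').1.1.2.1 _ (hin s hs').1.2.2.1
      rw [dist_eq_norm, dist_eq_norm] at h1
      have h2 : ‖fderiv ℝ G (z s) - fderiv ℝ G (c s)‖ ≤ K₂ * (v * (T * Δ s)) := by
        refine h1.trans (mul_le_mul_of_nonneg_left ((hdz s hs').trans ?_) hk2)
        have := hsT.2
        gcongr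
      refine (norm_add_le _ _).trans ?_
      have h3 := (ContinuousLinearMap.le_opNorm (fderiv ℝ G (z s) - fderiv ℝ G (c s))
        ((v : ℂ) * rot (-θ s)))
      have h4 := (ContinuousLinearMap.le_opNorm (fderiv ℝ G (c s))
        ((v : ℂ) * rot (-θ s) - v * rot (-(θ 0 + α * s))))
      rw [n1] at h3
      have h5 : ‖fderiv ℝ G (c s)‖ * ‖(v : ℂ) * rot (-θ s) - v * rot (-(θ 0 + α * s))‖
          ≤ M * (v * Δ s) := mul_le_mul (hin s hs').1.2.2.2.1 n2 (norm_nonneg _) hMp.le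
      have h6 := mul_le_mul_of_nonneg_right h2 hv.le
      have h7 : 0 ≤ K₁ * v * Δ s := by positivity
      have h8 : (K₁ * v + K₂ * v ^ 2 * T + M * v) * Δ s
          = K₁ * v * Δ s + K₂ * (v * (T * Δ s)) * v + M * (v * Δ s) := by ring
      rw [h8]
      linarith
  · exact circ_not_singular hA hα0 hv hz0 hLd (by rw [hL0]; exact ham)

/-- The switching function has a constant sign on some interval `(0, ε)`. -/
theorem hasSignGerm (h : Extremal v a A T b z l θ φ) (hA : ‖b‖ < A)
    (ham : φ 0 = 0 → v * (l 0 * rot (θ 0)).re < potential A b (z 0)) : HasSignGerm φ := by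
  have hTp := h.T_pos
  have hT0 : (0 : ℝ) ∈ Icc 0 T := ⟨le_rfl, hTp.le⟩
  by_cases h0 : φ 0 = 0
  swap
  · have hφt : Tendsto φ (𝓝[≥] 0) (𝓝 (φ 0)) := by
      have := h.φ_cont 0 hT0
      rwa [ContinuousWithinAt, nhdsWithin_Icc_eq_nhdsGE hTp] at this
    rcases lt_or_gt_of_ne h0 with h1 | h1
    · obtain ⟨u, hu, hsub⟩ := mem_nhdsGE_iff_exists_Icc_subset.1 (hφt.eventually (gt_mem_nhds h1))
      exact ⟨u, hu, Or.inl fun s hs => hsub ⟨hs.1.le, hs.2.le⟩⟩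
    · obtain ⟨u, hu, hsub⟩ := mem_nhdsGE_iff_exists_Icc_subset.1 (hφt.eventually (lt_mem_nhds h1))
      exact ⟨u, hu, Or.inr (Or.inl fun s hs => hsub ⟨hs.1.le, hs.2.le⟩)⟩
  have ham' := ham h0
  set G := gradPotential A b with hG
  set DG : ℝ → ℂ := fun s => fderiv ℝ G (z s) (v * rot (-θ s)) with hDG
  have hld : ∀ s ∈ Ioo 0 T, HasDerivAt l (G (z s)) s := fun s hs =>
    (h.l_deriv s (Ioo_subset_Icc_self hs)).hasDerivAt (Icc_mem_nhds hs.1 hs.2)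
  have hGd : ∀ s ∈ Ioo 0 T, HasDerivAt (fun s => G (z s)) (DG s) s := by
    intro s hs
    have h1 := (h.z_deriv s (Ioo_subset_Icc_self hs)).hasDerivAt (Icc_mem_nhds hs.1 hs.2)
    have h2 : DifferentiableAt ℝ G (z s) := (contDiffAt_gradPotential (n := 1)
      (h.z_ne s (Ioo_subset_Icc_self hs))).differentiableAt (by norm_num)
    exact h2.hasFDerivAt.comp_hasDerivAt s h1
  by_cases hl : l 0 = 0
  · -- the covector vanishes: divide it by `s`
    have hsd : ∀ (f : ℝ → ℂ) (f' : ℂ) (s : ℝ), s ≠ 0 → HasDerivAt f f' s →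
        HasDerivAt (fun s : ℝ => f s / s) ((f' - f s / s) / s) s := by
      intro f f' s hs hf
      have hsc : (s : ℂ) ≠ 0 := by exact_mod_cast hs
      refine (hf.div (Complex.ofRealCLM.hasDerivAt (x := s)) hsc).congr_deriv ?_
      simp only [Complex.ofRealCLM_apply, Complex.ofReal_one, mul_one]
      field_simp
    -- The quotient tends to `G (z 0)`, which is not 0, and `m` is its slope at 0, half the second
    -- derivative of `l`. The comparison covector vanishes at 0 as well and is divided by means of
    -- `dslope`, which keeps it analytic.
    refine h.hasSignGerm_of_comparison h0 (j := 1) (ℓ := fun s => l s / s)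
      (ℓ₁ := fun s => (G (z s) - l s / s) / s)
      (ℓ₂ := fun s => ((DG s - (G (z s) - l s / s) / s) - (G (z s) - l s / s) / s) / s)
      (w := G (z 0)) (m := DG 0 / 2)
      (gradPotential_ne_zero hA (h.z_ne 0 hT0)) ?_ ?_ ?_ ?_
    · intro s hs
      have hsc : (s : ℂ) ≠ 0 := by exact_mod_cast hs.1.ne'
      rw [pow_one]; field_simp
    · exact fun s hs => hsd l _ s hs.1.ne' (hld s hs)
    · intro s hs
      exact hsd (fun s => G (z s) - l s / s) _ s hs.1.ne'
        ((hGd s hs).sub (hsd l _ s hs.1.ne' (hld s hs)))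
    · intro α hα
      obtain ⟨C, ε, L, hε, hεT, hC, hLa, hL0, hL1, hL2, hcmp, hnd⟩ :=
        h.exists_circle_comparison hA ham' hα
      rw [hl] at hL0
      set E := dslope L 0 with hE
      have hEa : AnalyticAt ℝ E 0 := by
        obtain ⟨p, hp⟩ := hLa
        exact hp.has_fpower_series_dslope_fslope.analyticAt
      have hLE : ∀ s : ℝ, L s = s * E s := by
        intro s
        have := sub_smul_dslope L 0 s
        rw [hL0, sub_zero, sub_zero, Complex.real_smul] at this
        exact this.symm
      have hofR : ∀ s : ℝ, HasDerivAt (fun s : ℝ => (s : ℂ)) 1 s := fun s => by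
        exact (hasDerivAt_id s).ofReal_comp
      have hd1 : ∀ᶠ s in 𝓝 (0 : ℝ), deriv L s = E s + s * deriv E s := by
        filter_upwards [hEa.eventually_analyticAt] with s hs
        have h1 : HasDerivAt (fun s : ℝ => (s : ℂ) * E s) _ s :=
          (hofR s).mul hs.differentiableAt.hasDerivAt
        rw [show L = fun s : ℝ => (s : ℂ) * E s from funext hLE, h1.deriv, one_mul]
      have hd2 : ∀ᶠ s in 𝓝 (0 : ℝ), deriv (deriv L) s = 2 * deriv E s + s * deriv (deriv E) s := by
        filter_upwards [hd1.eventually_nhds, hEa.eventually_analyticAt] with s h1 hs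
        have h2 : HasDerivAt (fun s : ℝ => E s + (s : ℂ) * deriv E s) _ s :=
          hs.differentiableAt.hasDerivAt.add ((hofR s).mul hs.deriv.differentiableAt.hasDerivAt)
        rw [EventuallyEq.deriv_eq h1, h2.deriv]; ring
      obtain ⟨δ, hδ, hball⟩ := Metric.eventually_nhds_iff.1 (hd1.and hd2)
      refine ⟨5 * C, min ε δ, E, lt_min hε hδ, (min_le_left _ _).trans hεT, ?_, ?_, ?_⟩
      · have := hd1.self_of_nhds
        rw [Complex.ofReal_zero, zero_mul, add_zero, hL1] at this
        exact this.symm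
      · have := hd2.self_of_nhds
        rw [Complex.ofReal_zero, zero_mul, add_zero, hL2] at this
        simp only [hDG]; rw [this]; ring
      have hb : ∀ s ∈ Ioo 0 (min ε δ), s ∈ Ioo 0 ε ∧ deriv L s = E s + s * deriv E s ∧
          deriv (deriv L) s = 2 * deriv E s + s * deriv (deriv E) s := fun s hs =>
        ⟨⟨hs.1, hs.2.trans_le (min_le_left _ _)⟩, hball (by
          rw [Real.dist_eq, sub_zero, abs_of_pos hs.1]; exact hs.2.trans_le (min_le_right _ _))⟩
      have hnorm : ∀ (s : ℝ), 0 < s → ∀ (w : ℂ) (x : ℝ), ‖(s : ℂ) * w‖ ≤ s * x → ‖w‖ ≤ x := by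
        intro s hs w x hw
        rw [norm_mul, Complex.norm_real, Real.norm_eq_abs, abs_of_pos hs] at hw
        exact le_of_mul_le_mul_left hw hs
      have c0 : ∀ s ∈ Ioo 0 (min ε δ), ‖l s / s - E s‖ ≤ C * (s * |θ s - (θ 0 + α * s)|) := by
        intro s hs
        obtain ⟨hsε, e1, e2⟩ := hb s hs
        have hsc : (s : ℂ) ≠ 0 := by exact_mod_cast hs.1.ne'
        refine hnorm s hs.1 _ _ ?_
        have : (s : ℂ) * (l s / s - E s) = l s - L s := by rw [hLE s]; field_simp
        rw [this]
        refine (hcmp s hsε).1.trans_eq (by ring)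
      have c1 : ∀ s ∈ Ioo 0 (min ε δ), ‖(G (z s) - l s / s) / s - deriv E s‖
          ≤ 2 * C * |θ s - (θ 0 + α * s)| := by
        intro s hs
        obtain ⟨hsε, e1, e2⟩ := hb s hs
        have hsc : (s : ℂ) ≠ 0 := by exact_mod_cast hs.1.ne'
        refine hnorm s hs.1 _ _ ?_
        have : (s : ℂ) * ((G (z s) - l s / s) / s - deriv E s)
            = (G (z s) - deriv L s) - (l s / s - E s) := by rw [e1]; field_simp; ring
        rw [this]
        refine (norm_sub_le _ _).trans ((add_le_add (hcmp s hsε).2.1 (c0 s hs)).trans_eq (by ring))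
      refine
        { C_nonneg := by positivity
          analytic := hEa
          comp := fun s hs => (c0 s hs).trans ?_
          comp₁ := fun s hs => (c1 s hs).trans ?_
          comp₂ := ?_
          nondegenerate := ?_ }
      · have := mul_nonneg hC (mul_nonneg hs.1.le (abs_nonneg (θ s - (θ 0 + α * s))))
        linarith
      · have := mul_nonneg hC (abs_nonneg (θ s - (θ 0 + α * s)))
        linarith
      · intro s hs
        obtain ⟨hsε, e1, e2⟩ := hb s hs
        have hsc : (s : ℂ) ≠ 0 := by exact_mod_cast hs.1.ne'
        have e3 : (s : ℂ) * (((DG s - (G (z s) - l s / s) / s) - (G (z s) - l s / s) / s) / s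
            - deriv (deriv E) s)
            = (DG s - deriv (deriv L) s) - 2 * ((G (z s) - l s / s) / s - deriv E s) := by
          rw [e2]; field_simp; ring
        have e4 : s * ‖((DG s - (G (z s) - l s / s) / s) - (G (z s) - l s / s) / s) / s
            - deriv (deriv E) s‖ = ‖(s : ℂ) * (((DG s - (G (z s) - l s / s) / s)
            - (G (z s) - l s / s) / s) / s - deriv (deriv E) s)‖ := by
          rw [norm_mul, Complex.norm_real, Real.norm_eq_abs, abs_of_pos hs.1]
        rw [e4, e3]
        refine (norm_sub_le _ _).trans ?_
        rw [norm_mul, Complex.norm_ofNat]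
        have := (hcmp s hsε).2.2
        have := c1 s hs
        linarith
      · intro hev
        refine hnd ?_
        filter_upwards [hev] with s hs
        rw [hLE s, mul_assoc, Complex.im_ofReal_mul, hs, mul_zero]
  · refine h.hasSignGerm_of_comparison h0 (j := 0) (ℓ := l) (ℓ₁ := fun s => G (z s)) (ℓ₂ := DG)
      (w := l 0) (m := G (z 0)) hl (by simp) hld hGd ?_
    intro α hα
    obtain ⟨C, ε, L, hε, hεT, hC, hLa, hL0, hL1, hL2, hcmp, hnd⟩ :=
      h.exists_circle_comparison hA ham' hα
    refine ⟨C * (T + 1), ε, L, hε, hεT, hL0, hL1, ?_⟩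
    have hCT : C * T ≤ C * (T + 1) := by nlinarith
    refine
      { C_nonneg := by positivity
        analytic := hLa
        comp := fun s hs => (hcmp s hs).1.trans ?_
        comp₁ := fun s hs => (hcmp s hs).2.1.trans ?_
        comp₂ := fun s hs => (mul_le_mul_of_nonneg_left (hcmp s hs).2.2 hs.1.le).trans ?_
        nondegenerate := hnd }
    all_goals
      have hΔ := abs_nonneg (θ s - (θ 0 + α * s))
      set Δ := |θ s - (θ 0 + α * s)|
      have hsT : s ≤ T + 1 := by linarith [hs.2]
      have hs0 := hs.1
    · calc C * (s ^ 2 * Δ) = C * (s * (s * Δ)) := by ring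
        _ ≤ C * ((T + 1) * (s * Δ)) := by gcongr
        _ = _ := by ring
    · calc C * (s * Δ) ≤ C * ((T + 1) * Δ) := by gcongr
        _ = _ := by ring
    · calc s * (C * Δ) ≤ (T + 1) * (C * Δ) := by gcongr
        _ = _ := by ring

end Extremal

/-! ### Conservation of the Hamiltonian; shift and reversal of time. -/

theorem potential_eq (A : ℝ) (b z : ℂ) : potential A b z =
    (A * Complex.normSq z + (b * conj z ^ 2).re) / Complex.normSq z ^ 2 := by
  rw [potential, Complex.mul_conj, ← Complex.ofReal_pow, Complex.div_ofReal_re, Complex.add_re,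
    ← Complex.ofReal_mul, Complex.ofReal_re]

theorem potential_pos {A : ℝ} {b z : ℂ} (hA : ‖b‖ < A) (hz : z ≠ 0) : 0 < potential A b z := by
  have hn : 0 < Complex.normSq z := Complex.normSq_pos.2 hz
  rw [potential_eq]
  refine div_pos ?_ (pow_pos hn 2)
  have h2 : |(b * conj z ^ 2).re| ≤ ‖b‖ * Complex.normSq z := by
    refine (Complex.abs_re_le_norm _).trans_eq ?_
    rw [norm_mul, norm_pow, Complex.norm_conj, Complex.normSq_eq_norm_sq]
  have := (abs_le.1 h2).1
  nlinarith

theorem hasDerivWithinAt_abs_of_zero {f : ℝ → ℝ} {S : Set ℝ} {t : ℝ} (h0 : f t = 0)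
    (h : HasDerivWithinAt f 0 S t) : HasDerivWithinAt (fun s => |f s|) 0 S t := by
  rw [hasDerivWithinAt_iff_isLittleO] at h ⊢
  simp only [h0, abs_zero, sub_zero, smul_zero] at h ⊢
  exact h.abs_left

theorem HasDerivWithinAt.eventually_sign {f : ℝ → ℝ} {f' t : ℝ} (h : HasDerivWithinAt f f' (Ici t) t)
    (h0 : f t = 0) (hf : 0 < f') : ∀ᶠ s in 𝓝[>] t, 0 < f s := by
  have h1 := (hasDerivWithinAt_iff_tendsto_slope' self_notMem_Ioi).1 h.Ioi_of_Ici
  filter_upwards [h1.eventually (lt_mem_nhds hf), self_mem_nhdsWithin] with s hs hst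
  rw [slope_def_field, h0, sub_zero] at hs
  exact (div_pos_iff_of_pos_right (sub_pos.2 hst)).1 hs

namespace Extremal

variable {v a A T : ℝ} {b : ℂ} {z l : ℝ → ℂ} {θ φ : ℝ → ℝ}

/-- The Hamiltonian, maximized over the control. -/
noncomputable def ham (v a A : ℝ) (b : ℂ) (z l : ℝ → ℂ) (θ φ : ℝ → ℝ) (t : ℝ) : ℝ :=
  v * (l t * rot (θ t)).re - potential A b (z t) - a * |φ t|

theorem hasDerivWithinAt_potential_comp (h : Extremal v a A T b z l θ φ) {t : ℝ} (ht : t ∈ Ico 0 T) :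
    HasDerivWithinAt (fun s => potential A b (z s))
      (v * (gradPotential A b (z t) * rot (θ t)).re) (Ici t) t := by
  have hm : Icc 0 T ∈ 𝓝[≥] t := mem_of_superset (Icc_mem_nhdsGE ht.2) (Icc_subset_Icc ht.1 le_rfl)
  have h1 := hasDerivWithinAt_potential (A := A) (b := b)
    ((h.z_deriv t (Ico_subset_Icc_self ht)).mono_of_mem_nhdsWithin hm)
    (h.z_ne t (Ico_subset_Icc_self ht))
  refine h1.congr_deriv ?_
  rw [map_mul, conj_rot, neg_neg, Complex.conj_ofReal, ← Complex.re_ofReal_mul]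
  congr 1; ring

/-- Turning at the rate `α` changes `v Re (l rot θ)` by `α v Im (l rot θ) = -α φ'`, which cancels
the change of `-a |φ| = α φ`. The gradient terms cancel against the change of the potential. -/
theorem ham_deriv_of_affine (h : Extremal v a A T b z l θ φ) {t α : ℝ} (ht : t ∈ Ico 0 T)
    (hθ : ∀ᶠ s in 𝓝[≥] t, θ s = θ t + α * (s - t)) (hφ : ∀ᶠ s in 𝓝[≥] t, a * |φ s| = -α * φ s) :
    HasDerivWithinAt (ham v a A b z l θ φ) 0 (Ici t) t := by
  have hm : Icc 0 T ∈ 𝓝[≥] t := mem_of_superset (Icc_mem_nhdsGE ht.2) (Icc_subset_Icc ht.1 le_rfl)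
  have hI := Ico_subset_Icc_self ht
  have hθ' : HasDerivWithinAt θ α (Ici t) t := by
    have h1 : HasDerivWithinAt (fun s => θ t + α * (s - t)) α (Ici t) t := by
      simpa using ((((hasDerivAt_id t).sub_const t).const_mul α).const_add (θ t)).hasDerivWithinAt
    exact h1.congr_of_eventuallyEq hθ (by simp)
  have h1 := (hasDerivWithinAt_re
    (((h.l_deriv t hI).mono_of_mem_nhdsWithin hm).mul_rot hθ')).const_mul v
  have h2 := ((h.φ_deriv t hI).mono_of_mem_nhdsWithin hm).const_mul (-α)
  have h3 := (h1.sub (h.hasDerivWithinAt_potential_comp ht)).sub h2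
  refine (h3.congr_of_eventuallyEq ?_ ?_).congr_deriv ?_
  · filter_upwards [hφ] with s hs
    simp only [ham, Pi.sub_apply, hs]
  · simp only [ham, Pi.sub_apply, hφ.self_of_nhdsWithin (mem_Ici.2 le_rfl)]
  · simp only [sweep, Complex.sub_re, Complex.mul_re, Complex.I_re, Complex.I_im,
      Complex.mul_im, Complex.ofReal_re, Complex.ofReal_im]
    ring

/-- The course need not be differentiable at such a time. But `l t * rot (θ t)` is real, so the
turning enters only through `cos (θ s - θ t)`, which is `1 + O((s - t)²)` by the Lipschitz bound;
and `|φ|` has derivative 0. -/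
theorem ham_deriv_of_zero (h : Extremal v a A T b z l θ φ) {t : ℝ} (ht : t ∈ Ico 0 T)
    (h0 : φ t = 0) (h1 : sweep v l θ t = 0) :
    HasDerivWithinAt (ham v a A b z l θ φ) 0 (Ici t) t := by
  have hm : Icc 0 T ∈ 𝓝[≥] t := mem_of_superset (Icc_mem_nhdsGE ht.2) (Icc_subset_Icc ht.1 le_rfl)
  have hI := Ico_subset_Icc_self ht
  have hφ : HasDerivWithinAt (fun s => |φ s|) 0 (Ici t) t :=
    hasDerivWithinAt_abs_of_zero h0 (h1 ▸ (h.φ_deriv t hI).mono_of_mem_nhdsWithin hm)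
  have him : (l t * rot (θ t)).im = 0 := by
    rw [sweep] at h1
    exact (mul_eq_zero.1 h1).resolve_left (by linarith [h.v_pos])
  have hre : HasDerivWithinAt (fun s => (l s * rot (θ s)).re)
      (gradPotential A b (z t) * rot (θ t)).re (Ici t) t := by
    rw [← hasDerivWithinAt_Ioi_iff_Ici, hasDerivWithinAt_iff_tendsto_slope' self_notMem_Ioi]
    have hs1 : Tendsto (slope l t) (𝓝[>] t) (𝓝 (gradPotential A b (z t))) :=
      (hasDerivWithinAt_iff_tendsto_slope' self_notMem_Ioi).1
        ((h.l_deriv t hI).mono_of_mem_nhdsWithin hm).Ioi_of_Ici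
    have hs2 : Tendsto θ (𝓝[>] t) (𝓝 (θ t)) :=
      (h.θ_cont t hI).mono_left (nhdsWithin_le_of_mem
        (nhdsWithin_mono t Ioi_subset_Ici_self hm))
    have hs3 := (Complex.continuous_re.tendsto _).comp
      (hs1.mul ((continuous_rot.tendsto _).comp hs2))
    have hs4 : Tendsto (fun s => (l t * rot (θ t)).re * (Real.cos (θ s - θ t) - 1) / (s - t))
        (𝓝[>] t) (𝓝 0) := by
      refine squeeze_zero_norm' (a := fun s => |(l t * rot (θ t)).re| * (a ^ 2 / 2) * (s - t)) ?_ ?_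
      · filter_upwards [nhdsWithin_mono t Ioi_subset_Ici_self hm, self_mem_nhdsWithin] with s hs hst
        have hst' : 0 < s - t := sub_pos.2 hst
        rw [Real.norm_eq_abs, abs_div, abs_of_pos hst', div_le_iff₀ hst', abs_mul, mul_assoc,
          mul_assoc]
        refine mul_le_mul_of_nonneg_left ?_ (abs_nonneg _)
        have hL := h.lip s hs t hI
        rw [abs_of_pos hst'] at hL
        have hsq : (θ s - θ t) ^ 2 ≤ (a * (s - t)) ^ 2 := sq_le_sq' (abs_le.1 hL).1 (abs_le.1 hL).2
        rw [abs_le]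
        constructor
        · linarith [Real.one_sub_sq_div_two_le_cos (x := θ s - θ t)]
        · have : 0 ≤ a ^ 2 / 2 * (s - t) * (s - t) := by positivity
          linarith [Real.cos_le_one (θ s - θ t)]
      · have : Tendsto (fun s => |(l t * rot (θ t)).re| * (a ^ 2 / 2) * (s - t)) (𝓝 t)
            (𝓝 (|(l t * rot (θ t)).re| * (a ^ 2 / 2) * (t - t))) :=
          Continuous.tendsto (by fun_prop) t
        rw [sub_self, mul_zero] at this
        exact this.mono_left nhdsWithin_le_nhds
    have hs5 := hs3.add hs4
    rw [add_zero] at hs5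
    refine hs5.congr' ?_
    filter_upwards [self_mem_nhdsWithin] with s hst
    have hst' : (s - t) ≠ 0 := (sub_pos.2 hst).ne'
    have e1 : rot (θ s) = rot (θ t) * rot (θ s - θ t) := by rw [← rot_add, add_sub_cancel]
    have e2 : (l t * rot (θ s)).re = (l t * rot (θ t)).re * Real.cos (θ s - θ t) := by
      rw [e1, ← mul_assoc, Complex.mul_re, him, zero_mul, sub_zero]
      congr 1
      rw [← Real.cos_neg (θ s - θ t)]; simp [rot, Complex.exp_re]
    simp only [Function.comp, slope_def_module]
    rw [smul_mul_assoc, Complex.smul_re, sub_mul, Complex.sub_re, e2]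
    simp only [smul_eq_mul]
    field_simp
    ring
  have h3 := ((hre.const_mul v).sub (h.hasDerivWithinAt_potential_comp ht)).sub (hφ.const_mul a)
  refine h3.congr_deriv ?_
  ring

/-- Unless `φ` and `φ'` vanish together, the sign of `φ` directly after `t` is determined, and the
course is affine there. -/
theorem ham_deriv (h : Extremal v a A T b z l θ φ) {t : ℝ} (ht : t ∈ Ico 0 T) :
    HasDerivWithinAt (ham v a A b z l θ φ) 0 (Ici t) t := by
  have hm : Icc 0 T ∈ 𝓝[≥] t := mem_of_superset (Icc_mem_nhdsGE ht.2) (Icc_subset_Icc ht.1 le_rfl)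
  have hI := Ico_subset_Icc_self ht
  have hcφ : Tendsto φ (𝓝[>] t) (𝓝 (φ t)) :=
    (h.φ_cont t hI).mono_left (nhdsWithin_le_of_mem (nhdsWithin_mono t Ioi_subset_Ici_self hm))
  have hd := (h.φ_deriv t hI).mono_of_mem_nhdsWithin hm
  have hneg : φ t ≤ 0 → (∀ᶠ s in 𝓝[>] t, φ s < 0) →
      HasDerivWithinAt (ham v a A b z l θ φ) 0 (Ici t) t := by
    intro h0 hev
    obtain ⟨c, hc, hsub⟩ := (mem_nhdsGT_iff_exists_Ioo_subset' ht.2).1 hev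
    have hIco : Ico t (min c T) ∈ 𝓝[≥] t := Ico_mem_nhdsGE (lt_min hc ht.2)
    refine h.ham_deriv_of_affine (α := a) ht ?_ ?_
    · filter_upwards [hIco] with s hs
      rcases hs.1.eq_or_lt with rfl | hlt
      · simp
      · have := h.neg t s ht.1 hlt (hs.2.le.trans (min_le_right _ _)) fun r hr =>
          hsub ⟨hr.1, hr.2.trans (hs.2.trans_le (min_le_left _ _))⟩
        linarith
    · filter_upwards [hIco] with s hs
      have : φ s ≤ 0 := by
        rcases hs.1.eq_or_lt with rfl | hlt
        · exact h0
        · exact le_of_lt (hsub ⟨hlt, hs.2.trans_le (min_le_left _ _)⟩)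
      rw [abs_of_nonpos this]; ring
  have hpos : 0 ≤ φ t → (∀ᶠ s in 𝓝[>] t, 0 < φ s) →
      HasDerivWithinAt (ham v a A b z l θ φ) 0 (Ici t) t := by
    intro h0 hev
    obtain ⟨c, hc, hsub⟩ := (mem_nhdsGT_iff_exists_Ioo_subset' ht.2).1 hev
    have hIco : Ico t (min c T) ∈ 𝓝[≥] t := Ico_mem_nhdsGE (lt_min hc ht.2)
    refine h.ham_deriv_of_affine (α := -a) ht ?_ ?_
    · filter_upwards [hIco] with s hs
      rcases hs.1.eq_or_lt with rfl | hlt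
      · simp
      · have := h.pos t s ht.1 hlt (hs.2.le.trans (min_le_right _ _)) fun r hr =>
          hsub ⟨hr.1, hr.2.trans (hs.2.trans_le (min_le_left _ _))⟩
        linarith
    · filter_upwards [hIco] with s hs
      have : 0 ≤ φ s := by
        rcases hs.1.eq_or_lt with rfl | hlt
        · exact h0
        · exact le_of_lt (hsub ⟨hlt, hs.2.trans_le (min_le_left _ _)⟩)
      rw [abs_of_nonneg this]; ring
  rcases lt_trichotomy (φ t) 0 with h0 | h0 | h0
  · exact hneg h0.le (hcφ.eventually (gt_mem_nhds h0))
  · rcases lt_trichotomy (sweep v l θ t) 0 with h1 | h1 | h1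
    · refine hneg h0.le ?_
      filter_upwards [hd.neg.eventually_sign (by simp [h0]) (by linarith)] with s hs
      simpa using hs
    · exact h.ham_deriv_of_zero ht h0 h1
    · exact hpos h0.ge (hd.eventually_sign h0 h1)
  · exact hpos h0.le (hcφ.eventually (lt_mem_nhds h0))

theorem ham_cont (h : Extremal v a A T b z l θ φ) :
    ContinuousOn (ham v a A b z l θ φ) (Icc 0 T) := by
  have h1 : ContinuousOn (fun t => potential A b (z t)) (Icc 0 T) := fun t ht =>
    (hasDerivWithinAt_potential (h.z_deriv t ht) (h.z_ne t ht)).continuousWithinAt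
  have h2 : ContinuousOn (fun t => rot (θ t)) (Icc 0 T) := continuous_rot.comp_continuousOn h.θ_cont
  exact ((continuousOn_const.mul (Complex.continuous_re.comp_continuousOn (h.l_cont.mul h2))).sub
    h1).sub (continuousOn_const.mul h.φ_cont.abs)

/-- Conservation of the Hamiltonian and the transversality conditions. -/
theorem re_lt_potential (h : Extremal v a A T b z l θ φ) (hA : ‖b‖ < A) (hl : l T = 0)
    (hφ : φ T = 0) {t : ℝ} (ht : t ∈ Icc 0 T) (h0 : φ t = 0) :
    v * (l t * rot (θ t)).re < potential A b (z t) := by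
  -- At the terminal time `l` and `φ` vanish, so the constant is minus the potential at the terminal
  -- point.
  have h1 := constant_of_has_deriv_right_zero h.ham_cont fun t ht => h.ham_deriv ht
  have h2 := (h1 t ht).trans (h1 T ⟨h.T_pos.le, le_rfl⟩).symm
  have h3 := potential_pos hA (h.z_ne T ⟨h.T_pos.le, le_rfl⟩)
  simp only [ham, hl, hφ, h0, zero_mul, Complex.zero_re, abs_zero, mul_zero] at h2
  linarith

theorem shift (h : Extremal v a A T b z l θ φ) {c : ℝ} (hc : c ∈ Ico 0 T) :
    Extremal v a A (T - c) b (fun s => z (c + s)) (fun s => l (c + s)) (fun s => θ (c + s))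
      (fun s => φ (c + s)) := by
  have hI : ∀ s ∈ Icc 0 (T - c), c + s ∈ Icc 0 T := fun s hs =>
    ⟨by linarith [hs.1, hc.1], by linarith [hs.2]⟩
  have hid : ∀ s, HasDerivWithinAt (fun s => c + s) 1 (Icc 0 (T - c)) s := fun s =>
    ((hasDerivAt_id s).const_add c).hasDerivWithinAt
  refine ⟨h.v_pos, h.a_pos, by linarith [hc.2], fun t ht => ?_, fun t ht => ?_, fun t ht => ?_,
    fun t ht => h.z_ne _ (hI t ht), fun s hs t ht => ?_, fun s t h1 h2 h3 h4 => ?_,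
    fun s t h1 h2 h3 h4 => ?_⟩
  · exact ((h.z_deriv _ (hI t ht)).scomp t (hid t) hI).congr_deriv (one_smul _ _)
  · exact ((h.l_deriv _ (hI t ht)).scomp t (hid t) hI).congr_deriv (one_smul _ _)
  · exact ((h.φ_deriv _ (hI t ht)).scomp t (hid t) hI).congr_deriv (one_smul _ _)
  · simpa using h.lip _ (hI s hs) _ (hI t ht)
  · rw [h.neg (c + s) (c + t) (by linarith [hc.1]) (by linarith) (by linarith) fun r hr => ?_]
    · ring
    · have := h4 (r - c) ⟨by linarith [hr.1], by linarith [hr.2]⟩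
      rwa [add_sub_cancel] at this
  · rw [h.pos (c + s) (c + t) (by linarith [hc.1]) (by linarith) (by linarith) fun r hr => ?_]
    · ring
    · have := h4 (r - c) ⟨by linarith [hr.1], by linarith [hr.2]⟩
      rwa [add_sub_cancel] at this

theorem _root_.rot_add_pi (x : ℝ) : rot (x + Real.pi) = -rot x := by
  rw [rot_add]
  have : rot Real.pi = -1 := by
    rw [rot, Complex.exp_neg, Complex.exp_pi_mul_I]; norm_num
  rw [this]; ring

theorem _root_.rot_neg_add_pi (x : ℝ) : rot (-(x + Real.pi)) = -rot (-x) := by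
  rw [← conj_rot, rot_add_pi, map_neg, conj_rot]

/-- Running backwards reverses the velocity, hence the shift of the course by π, and the turning
rate. The signs of `l` and `φ` are changed so that a negative switching function again goes with the
rate `a`. Left germs thereby become right germs. -/
theorem reverse (h : Extremal v a A T b z l θ φ) {c : ℝ} (hc : c ∈ Ioc 0 T) :
    Extremal v a A c b (fun s => z (c - s)) (fun s => -l (c - s)) (fun s => θ (c - s) + Real.pi)
      (fun s => -φ (c - s)) := by
  have hI : ∀ s ∈ Icc 0 c, c - s ∈ Icc 0 T := fun s hs =>
    ⟨by linarith [hs.2], by linarith [hs.1, hc.2]⟩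
  have hid : ∀ s, HasDerivWithinAt (fun s => c - s) (-1) (Icc 0 c) s := fun s =>
    ((hasDerivAt_id s).const_sub c).hasDerivWithinAt
  refine ⟨h.v_pos, h.a_pos, hc.1, fun t ht => ?_, fun t ht => ?_, fun t ht => ?_,
    fun t ht => h.z_ne _ (hI t ht), fun s hs t ht => ?_, fun s t h1 h2 h3 h4 => ?_,
    fun s t h1 h2 h3 h4 => ?_⟩
  · refine ((h.z_deriv _ (hI t ht)).scomp t (hid t) hI).congr_deriv ?_
    rw [rot_neg_add_pi]; simp
  · refine ((h.l_deriv _ (hI t ht)).scomp t (hid t) hI).neg.congr_deriv ?_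
    simp
  · refine ((h.φ_deriv _ (hI t ht)).scomp t (hid t) hI).neg.congr_deriv ?_
    simp [sweep, rot_add_pi]
  · have := h.lip _ (hI s hs) _ (hI t ht)
    rw [show c - s - (c - t) = -(s - t) by ring, abs_neg] at this
    simpa using this
  · have := h.pos (c - t) (c - s) (by linarith) (by linarith) (by linarith [hc.2]) fun r hr => by
      have := h4 (c - r) ⟨by linarith [hr.2], by linarith [hr.1]⟩
      rw [sub_sub_cancel] at this; linarith
    linarith
  · have := h.neg (c - t) (c - s) (by linarith) (by linarith) (by linarith [hc.2]) fun r hr => by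
      have := h4 (c - r) ⟨by linarith [hr.2], by linarith [hr.1]⟩
      rw [sub_sub_cancel] at this; linarith
    linarith

theorem hasSignGerm_right (h : Extremal v a A T b z l θ φ) (hA : ‖b‖ < A) (hl : l T = 0)
    (hφ : φ T = 0) {t : ℝ} (ht : t ∈ Ico 0 T) : HasSignGerm fun s => φ (t + s) := by
  refine (h.shift ht).hasSignGerm hA fun h0 => ?_
  simp only [add_zero] at h0 ⊢
  exact h.re_lt_potential hA hl hφ (Ico_subset_Icc_self ht) h0

theorem hasSignGerm_left (h : Extremal v a A T b z l θ φ) (hA : ‖b‖ < A) (hl : l T = 0)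
    (hφ : φ T = 0) {t : ℝ} (ht : t ∈ Ioc 0 T) : HasSignGerm fun s => φ (t - s) := by
  have := (h.reverse ht).hasSignGerm hA fun h0 => by
    simp only [sub_zero, neg_eq_zero] at h0 ⊢
    rw [rot_add_pi, neg_mul_neg]
    exact h.re_lt_potential hA hl hφ (Ioc_subset_Icc_self ht) h0
  exact HasSignGerm.of_neg this

end Extremal

/-! ### From sign germs to a finite partition. -/

/-- `φ` is negative, positive, or zero throughout `S`. -/
def ConstSignOn (φ : ℝ → ℝ) (S : Set ℝ) : Prop :=
  (∀ s ∈ S, φ s < 0) ∨ (∀ s ∈ S, 0 < φ s) ∨ (∀ s ∈ S, φ s = 0)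

theorem ConstSignOn.mono {φ : ℝ → ℝ} {S S' : Set ℝ} (h : ConstSignOn φ S) (hs : S' ⊆ S) :
    ConstSignOn φ S' :=
  h.imp (fun h s hs' => h s (hs hs')) (Or.imp (fun h s hs' => h s (hs hs')) fun h s hs' => h s (hs hs'))

/-- A function with one-sided sign germs on a compact interval has finitely many sign changes. -/
theorem exists_sign_partition {φ : ℝ → ℝ} {T : ℝ} (hT : 0 < T)
    (hr : ∀ t ∈ Ico 0 T, HasSignGerm fun s => φ (t + s))
    (hl : ∀ t ∈ Ioc 0 T, HasSignGerm fun s => φ (t - s)) :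
    ∃ (N : ℕ) (τ : ℕ → ℝ), τ 0 = 0 ∧ τ N = T ∧
      ∀ i < N, τ i < τ (i + 1) ∧ ConstSignOn φ (Ioo (τ i) (τ (i + 1))) := by
  set P : ℝ → Prop := fun t => ∃ (N : ℕ) (τ : ℕ → ℝ), τ 0 = 0 ∧ τ N = t ∧
    ∀ i < N, τ i < τ (i + 1) ∧ ConstSignOn φ (Ioo (τ i) (τ (i + 1))) with hP
  have hr' : ∀ t ∈ Ico 0 T, ∃ ε > 0, ConstSignOn φ (Ioo t (t + ε)) := by
    intro t ht
    obtain ⟨ε, hε, h⟩ := hr t ht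
    refine ⟨ε, hε, ?_⟩
    have key : ∀ s ∈ Ioo t (t + ε), s - t ∈ Ioo 0 ε := fun s hs =>
      ⟨by linarith [hs.1], by linarith [hs.2]⟩
    refine h.imp (fun h s hs => ?_) (Or.imp (fun h s hs => ?_) fun h s hs => ?_) <;>
      simpa using h _ (key s hs)
  have hl' : ∀ t ∈ Ioc 0 T, ∃ ε > 0, ConstSignOn φ (Ioo (t - ε) t) := by
    intro t ht
    obtain ⟨ε, hε, h⟩ := hl t ht
    refine ⟨ε, hε, ?_⟩
    have key : ∀ s ∈ Ioo (t - ε) t, t - s ∈ Ioo 0 ε := fun s hs =>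
      ⟨by linarith [hs.2], by linarith [hs.1]⟩
    refine h.imp (fun h s hs => ?_) (Or.imp (fun h s hs => ?_) fun h s hs => ?_) <;>
      simpa using h _ (key s hs)
  have hext : ∀ s t, s < t → P s → ConstSignOn φ (Ioo s t) → P t := by
    rintro s t hst ⟨N, τ, h0, hN, h⟩ hc
    refine ⟨N + 1, fun i => if i ≤ N then τ i else t, by simp [h0], by simp, fun i hi => ?_⟩
    rcases (Nat.lt_succ_iff.1 hi).lt_or_eq with hlt | rfl
    · simpa [hlt.le, Nat.succ_le_of_lt hlt] using h i hlt
    · simpa [hN] using ⟨hst, hc⟩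
  have h0 : P 0 := ⟨0, fun _ => 0, rfl, rfl, fun i hi => absurd hi (Nat.not_lt_zero i)⟩
  -- The left germ at the supremum shows that it is attained, the right germ that it is `T`.
  set S : Set ℝ := {t | t ∈ Icc 0 T ∧ P t} with hS
  have hb : BddAbove S := ⟨T, fun t ht => ht.1.2⟩
  have h0S : (0 : ℝ) ∈ S := ⟨⟨le_rfl, hT.le⟩, h0⟩
  set m := sSup S with hm
  have hm0 : 0 ≤ m := le_csSup hb h0S
  have hmT : m ≤ T := csSup_le ⟨0, h0S⟩ fun t ht => ht.1.2
  have hmP : P m := by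
    rcases hm0.eq_or_lt with h | h
    · rwa [← h]
    · obtain ⟨ε, hε, hc⟩ := hl' m ⟨h, hmT⟩
      obtain ⟨t, ht, htm⟩ := exists_lt_of_lt_csSup ⟨0, h0S⟩ (show m - ε < sSup S by linarith)
      rcases (le_csSup hb ht).eq_or_lt with h1 | h1
      · rw [hm, ← h1]; exact ht.2
      · exact hext t m h1 ht.2 (hc.mono (Ioo_subset_Ioo htm.le le_rfl))
  rcases hmT.eq_or_lt with h | h
  · rw [h] at hmP; exact hmP
  · obtain ⟨ε, hε, hc⟩ := hr' m ⟨hm0, h⟩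
    have hlt : m < min (m + ε) T := lt_min (by linarith) h
    have h2 : min (m + ε) T ∈ S := ⟨⟨hm0.trans hlt.le, min_le_right _ _⟩,
      hext m _ hlt hmP (hc.mono (Ioo_subset_Ioo le_rfl (min_le_left _ _)))⟩
    exact absurd (le_csSup hb h2) (not_le.2 hlt)

/-! ### Regularity of feasible pairs. -/

/-- The retraction of the line onto `[0, T]`. -/
def clamp (T t : ℝ) : ℝ := max 0 (min t T)

theorem clamp_mem {T : ℝ} (hT : 0 ≤ T) (t : ℝ) : clamp T t ∈ Icc 0 T :=
  ⟨le_max_left _ _, max_le hT (min_le_right _ _)⟩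

theorem clamp_of_mem {T t : ℝ} (ht : t ∈ Icc 0 T) : clamp T t = t := by
  rw [clamp, min_eq_left ht.2, max_eq_right ht.1]

theorem continuous_clamp (T : ℝ) : Continuous (clamp T) := by unfold clamp; fun_prop

theorem ContinuousOn.comp_clamp {E : Type*} [TopologicalSpace E] {f : ℝ → E} {T : ℝ} (hT : 0 ≤ T)
    (hf : ContinuousOn f (Icc 0 T)) : Continuous fun t => f (clamp T t) :=
  hf.comp_continuous (continuous_clamp T) (clamp_mem hT)

theorem integral_comp_clamp {E : Type*} [NormedAddCommGroup E] [NormedSpace ℝ E] {f : ℝ → E}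
    {T t : ℝ} (ht : t ∈ Icc 0 T) : ∫ r in (0 : ℝ)..t, f (clamp T r) = ∫ r in (0 : ℝ)..t, f r := by
  refine intervalIntegral.integral_congr fun r hr => ?_
  rw [uIcc_of_le ht.1] at hr
  simp only [clamp_of_mem (T := T) ⟨hr.1, hr.2.trans ht.2⟩]

theorem hasDerivWithinAt_complex_mk {x y : ℝ → ℝ} {x' y' t : ℝ} {S : Set ℝ}
    (hx : HasDerivWithinAt x x' S t) (hy : HasDerivWithinAt y y' S t) :
    HasDerivWithinAt (fun t => Complex.mk (x t) (y t)) (Complex.mk x' y') S t := by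
  simp only [Complex.mk_eq_add_mul_I]
  exact hx.ofReal_comp.add (hy.ofReal_comp.mul_const Complex.I)

theorem mul_rot_neg_eq_mk (v θ : ℝ) : v * rot (-θ) = Complex.mk (v * Real.cos θ) (v * Real.sin θ) := by
  rw [rot]
  apply Complex.ext <;> simp [Complex.exp_re, Complex.exp_im]

namespace HasW12Deriv

variable {T : ℝ} {f g : ℝ → ℝ}

theorem integrableOn (h : HasW12Deriv T f g) : IntegrableOn g (Icc 0 T) :=
  h.1.integrable one_le_two

theorem intervalIntegrable (h : HasW12Deriv T f g) {s t : ℝ} (hs : s ∈ Icc 0 T)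
    (ht : t ∈ Icc 0 T) : IntervalIntegrable g volume s t := by
  rw [intervalIntegrable_iff]
  exact h.integrableOn.mono_set (uIoc_subset_uIcc.trans ((convex_Icc 0 T).ordConnected.uIcc_subset hs ht))

theorem sub_eq (h : HasW12Deriv T f g) {s t : ℝ} (hs : s ∈ Icc 0 T) (ht : t ∈ Icc 0 T) :
    f t - f s = ∫ r in s..t, g r := by
  have h0 : (0 : ℝ) ∈ Icc 0 T := ⟨le_rfl, hs.1.trans hs.2⟩
  rw [h.2 t ht, h.2 s hs, add_sub_add_left_eq_sub,
    intervalIntegral.integral_interval_sub_left (h.intervalIntegrable h0 ht)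
      (h.intervalIntegrable h0 hs)]

theorem continuousOn (h : HasW12Deriv T f g) (hT : 0 ≤ T) : ContinuousOn f (Icc 0 T) := by
  have h1 : ContinuousOn (fun t => ∫ r in (0 : ℝ)..t, g r) (Icc 0 T) := by
    have := intervalIntegral.continuousOn_primitive_interval (a := 0) (b := T) (f := g)
      (μ := volume) (by rw [uIcc_of_le hT]; exact h.integrableOn)
    rwa [uIcc_of_le hT] at this
  exact (continuousOn_const.add h1).congr h.2

theorem hasDerivWithinAt (h : HasW12Deriv T f g) (hT : 0 ≤ T) (hg : ContinuousOn g (Icc 0 T))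
    {t : ℝ} (ht : t ∈ Icc 0 T) : HasDerivWithinAt f (g t) (Icc 0 T) t := by
  have hc := hg.comp_clamp hT
  have h1 : HasDerivAt (fun t => f 0 + ∫ r in (0 : ℝ)..t, g (clamp T r)) (g (clamp T t)) t :=
    (intervalIntegral.integral_hasDerivAt_right (hc.intervalIntegrable _ _)
      hc.stronglyMeasurable.stronglyMeasurableAtFilter hc.continuousAt).const_add (f 0)
  rw [clamp_of_mem ht] at h1
  refine h1.hasDerivWithinAt.congr_of_mem (fun s hs => ?_) ht
  rw [h.2 s hs, integral_comp_clamp hs]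

end HasW12Deriv

namespace IsFeasible

variable {P : ObserverData} {s : ObserverState} {u : ℝ → ℝ}

theorem θ_cont (h : IsFeasible P s u) : ContinuousOn s.θ (Icc 0 P.tf) :=
  h.θ_ode.continuousOn P.tf_pos.le

theorem path_deriv (h : IsFeasible P s u) {t : ℝ} (ht : t ∈ Icc 0 P.tf) :
    HasDerivWithinAt (fun t => Complex.mk (s.x t) (s.y t)) (P.v * rot (-s.θ t)) (Icc 0 P.tf) t := by
  rw [mul_rot_neg_eq_mk]
  exact hasDerivWithinAt_complex_mk
    (h.x_ode.hasDerivWithinAt P.tf_pos.le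
      (continuousOn_const.mul (Real.continuous_cos.comp_continuousOn h.θ_cont)) ht)
    (h.y_ode.hasDerivWithinAt P.tf_pos.le
      (continuousOn_const.mul (Real.continuous_sin.comp_continuousOn h.θ_cont)) ht)

/-- If the path met the target at time `t`, bounded speed would give `|z r| ≤ v |r - t|`, and the
integrable function `z₁' + z₂' = 1 / |z|²` would dominate a multiple of `1 / |r - t|`. -/
theorem path_ne_zero (h : IsFeasible P s u) {t : ℝ} (ht : t ∈ Icc 0 P.tf) :
    Complex.mk (s.x t) (s.y t) ≠ 0 := by
  intro h0
  set z : ℝ → ℂ := fun t => Complex.mk (s.x t) (s.y t) with hz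
  have hnorm : ∀ r, ‖(P.v : ℂ) * rot (-s.θ r)‖ = P.v := fun r => by
    rw [norm_mul, norm_rot, mul_one, Complex.norm_real, Real.norm_eq_abs, abs_of_pos P.v_pos]
  have hlip : ∀ r ∈ Icc 0 P.tf, ‖z r‖ ≤ P.v * |r - t| := by
    intro r hr
    have := (convex_Icc 0 P.tf).norm_image_sub_le_of_norm_hasDerivWithin_le
      (fun r hr => h.path_deriv hr) (fun r _ => (hnorm r).le) ht hr
    rwa [h0, sub_zero, Real.norm_eq_abs] at this
  -- At the target the quotients have the default value 0, so a path resting there would not be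
  -- excluded by integrability. The nonzero velocity makes the meeting time isolated.
  have hne : ∀ᶠ r in 𝓝[≠] t, r ∈ Icc 0 P.tf → z r ≠ 0 := by
    have := (h.path_deriv ht).eventually_ne (c := 0)
      (fun h => by have := hnorm t; rw [h, norm_zero] at this; exact P.v_pos.ne this)
    rw [eventually_nhdsWithin_iff] at this ⊢
    filter_upwards [this] with r hr hrt hrI using hr ⟨hrI, hrt⟩
  set g : ℝ → ℝ := fun t => s.x t ^ 2 / (s.x t ^ 2 + s.y t ^ 2) ^ 2 +
    s.y t ^ 2 / (s.x t ^ 2 + s.y t ^ 2) ^ 2 with hg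
  classical
  -- The values outside the time interval do not affect integrability; they make the lower bound
  -- hold in a full punctured neighbourhood even if `t` is an end point.
  set f : ℝ → ℝ := fun r => if r ∈ Icc 0 P.tf then g r else (r - t)⁻¹ with hf
  have h0m : (0 : ℝ) ∈ Icc 0 P.tf := ⟨le_rfl, P.tf_pos.le⟩
  have hTm : P.tf ∈ Icc 0 P.tf := ⟨P.tf_pos.le, le_rfl⟩
  have hint : IntervalIntegrable f volume 0 P.tf := by
    refine ((h.z₁_ode.intervalIntegrable h0m hTm).add
      (h.z₂_ode.intervalIntegrable h0m hTm)).congr fun r hr => ?_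
    rw [uIoc_of_le P.tf_pos.le] at hr
    simp only [hf, if_pos (Ioc_subset_Icc_self hr), hg]
  refine not_intervalIntegrable_of_sub_inv_isBigO_punctured (c := t) ?_ P.tf_pos.ne
    (by rwa [uIcc_of_le P.tf_pos.le]) hint
  refine Asymptotics.IsBigO.of_bound (P.v ^ 2 + 1) ?_
  have hnear : ∀ᶠ r in 𝓝[≠] t, r ∈ Ioo (t - 1) (t + 1) :=
    nhdsWithin_le_nhds (Ioo_mem_nhds (by linarith) (by linarith))
  filter_upwards [hne, hnear, self_mem_nhdsWithin] with r hr hr1 hrt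
  have hrt' : 0 < |r - t| := abs_pos.2 (sub_ne_zero.2 hrt)
  have hr1' : |r - t| ≤ 1 := by rw [abs_le]; constructor <;> linarith [hr1.1, hr1.2]
  by_cases hI : r ∈ Icc 0 P.tf
  · have hq : 0 < s.x r ^ 2 + s.y r ^ 2 := by
      have := Complex.normSq_pos.2 (hr hI)
      rw [Complex.normSq_apply] at this
      simpa [sq] using this
    have hq2 : s.x r ^ 2 + s.y r ^ 2 ≤ P.v ^ 2 * |r - t| := by
      have h1 := pow_le_pow_left₀ (norm_nonneg _) (hlip r hI) 2
      rw [← Complex.normSq_eq_norm_sq, Complex.normSq_apply] at h1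
      have h2 : s.x r ^ 2 + s.y r ^ 2 ≤ (P.v * |r - t|) ^ 2 := by simpa [hz, sq] using h1
      have h3 : |r - t| ^ 2 ≤ |r - t| := by nlinarith
      have : (P.v * |r - t|) ^ 2 = P.v ^ 2 * |r - t| ^ 2 := by ring
      nlinarith [sq_nonneg P.v]
    have hfg : f r = (s.x r ^ 2 + s.y r ^ 2)⁻¹ := by
      simp only [hf, if_pos hI, hg]
      field_simp
    rw [hfg, norm_inv, Real.norm_eq_abs, norm_inv, Real.norm_eq_abs, abs_of_pos hq,
      ← div_eq_mul_inv, le_div_iff₀ hq, ← div_eq_inv_mul, div_le_iff₀ hrt']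
    nlinarith
  · simp only [hf, if_neg hI]
    have : 0 ≤ ‖(r - t)⁻¹‖ := norm_nonneg _
    nlinarith [sq_nonneg P.v]

theorem abs_control_le (h : IsFeasible P s u) :
    ∀ᵐ t, t ∈ Icc 0 P.tf → |u t / P.v| ≤ P.a := by
  rw [← ae_restrict_iff' measurableSet_Icc]
  filter_upwards [h.control_bound] with t ht
  rw [abs_div, abs_of_pos P.v_pos, div_le_iff₀ P.v_pos, abs_le]
  constructor <;> linarith

theorem θ_lip (h : IsFeasible P s u) {r t : ℝ} (hr : r ∈ Icc 0 P.tf) (ht : t ∈ Icc 0 P.tf) :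
    |s.θ r - s.θ t| ≤ P.a * |r - t| := by
  rw [h.θ_ode.sub_eq ht hr, ← Real.norm_eq_abs]
  refine intervalIntegral.norm_integral_le_of_norm_le_const_ae ?_
  filter_upwards [h.abs_control_le] with x hx hxI
  exact hx ((convex_Icc 0 P.tf).ordConnected.uIcc_subset ht hr (uIoc_subset_uIcc hxI))

theorem θ_sub_of_control_eq (h : IsFeasible P s u) {r t c : ℝ} (hr : 0 ≤ r) (hrt : r < t)
    (ht : t ≤ P.tf) (hu : ∀ᵐ τ, τ ∈ Ioo r t → u τ = P.v * c) : s.θ t - s.θ r = c * (t - r) := by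
  rw [h.θ_ode.sub_eq ⟨hr, hrt.le.trans ht⟩ ⟨hr.trans hrt.le, ht⟩]
  have h1 : ∫ τ in r..t, u τ / P.v = ∫ τ in r..t, c := by
    refine intervalIntegral.integral_congr_ae ?_
    have hne : ∀ᵐ τ : ℝ, τ ≠ t := by simp [ae_iff]
    filter_upwards [hu, hne] with τ h1 h2 h3
    rw [uIoc_of_le hrt.le] at h3
    rw [h1 ⟨h3.1, lt_of_le_of_ne h3.2 h2⟩, mul_div_cancel_left₀ _ P.v_pos.ne']
  rw [h1]; simp [mul_comm]

end IsFeasible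

/-! ### First variation of an integrated potential. -/

theorem hasDerivAt_integral_of_continuousOn {E : Type*} [NormedAddCommGroup E] [NormedSpace ℝ E]
    {f f' : ℝ → ℝ → E} {ε₀ δ T : ℝ} (hT : 0 ≤ T) (hδ : 0 < δ)
    (hf : ∀ ε ∈ Metric.closedBall ε₀ δ, ContinuousOn (f ε) (Icc 0 T))
    (hf' : ContinuousOn (Function.uncurry f') (Metric.closedBall ε₀ δ ×ˢ Icc 0 T))
    (hd : ∀ ε ∈ Metric.closedBall ε₀ δ, ∀ t ∈ Icc 0 T, HasDerivAt (fun ε => f ε t) (f' ε t) ε) :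
    HasDerivAt (fun ε => ∫ t in (0 : ℝ)..T, f ε t) (∫ t in (0 : ℝ)..T, f' ε₀ t) ε₀ := by
  obtain ⟨C, hC⟩ := ((isCompact_closedBall ε₀ δ).prod isCompact_Icc).exists_bound_of_continuousOn hf'
  have hsub : uIoc 0 T ⊆ Icc 0 T := by rw [uIoc_of_le hT]; exact Ioc_subset_Icc_self
  have h0 : ε₀ ∈ Metric.closedBall ε₀ δ := Metric.mem_closedBall_self hδ.le
  have hf0 : ContinuousOn (f' ε₀) (Icc 0 T) :=
    hf'.comp (f := fun t => (ε₀, t)) (by fun_prop) fun t ht => ⟨h0, ht⟩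
  refine (intervalIntegral.hasDerivAt_integral_of_dominated_loc_of_deriv_le (F' := f')
    (bound := fun _ => C) (Metric.closedBall_mem_nhds ε₀ hδ) ?_ ?_ ?_ ?_ ?_ ?_).2
  · filter_upwards [Metric.closedBall_mem_nhds ε₀ hδ] with ε hε
    exact ((hf ε hε).mono hsub).aestronglyMeasurable measurableSet_uIoc
  · exact ContinuousOn.intervalIntegrable (by rw [uIcc_of_le hT]; exact hf ε₀ h0)
  · exact (hf0.mono hsub).aestronglyMeasurable measurableSet_uIoc
  · exact ae_of_all _ fun t ht ε hε => hC (ε, t) ⟨hε, hsub ht⟩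
  · exact intervalIntegrable_const
  · exact ae_of_all _ fun t ht ε hε => hd ε hε t (hsub ht)

/-- The path from `z₀` with speed `v` and course `θ + ε Θ`. -/
noncomputable def varPath (v : ℝ) (z₀ : ℂ) (θ Θ : ℝ → ℝ) (ε t : ℝ) : ℂ :=
  z₀ + ∫ r in (0 : ℝ)..t, v * rot (-(θ r + ε * Θ r))

/-- The derivative of `varPath` with respect to `ε`. -/
noncomputable def varField (v : ℝ) (θ Θ : ℝ → ℝ) (ε t : ℝ) : ℂ :=
  ∫ r in (0 : ℝ)..t, v * (Complex.I * Θ r * rot (-(θ r + ε * Θ r)))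

section

variable {v T : ℝ} {z₀ : ℂ} {θ Θ : ℝ → ℝ}

theorem continuous_varPath (hθ : Continuous θ) (hΘ : Continuous Θ) :
    Continuous (Function.uncurry (varPath v z₀ θ Θ)) := by
  have h : Continuous (Function.uncurry fun (p : ℝ × ℝ) (r : ℝ) =>
      (v : ℂ) * rot (-(θ r + p.1 * Θ r))) :=
    continuous_const.mul (continuous_rot.comp (by fun_prop))
  exact continuous_const.add
    (intervalIntegral.continuous_parametric_intervalIntegral_of_continuous h continuous_snd)

theorem continuous_varField (hθ : Continuous θ) (hΘ : Continuous Θ) :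
    Continuous (Function.uncurry (varField v θ Θ)) := by
  have h : Continuous (Function.uncurry fun (p : ℝ × ℝ) (r : ℝ) =>
      (v : ℂ) * (Complex.I * Θ r * rot (-(θ r + p.1 * Θ r)))) :=
    continuous_const.mul (Continuous.mul (by fun_prop) (continuous_rot.comp (by fun_prop)))
  exact intervalIntegral.continuous_parametric_intervalIntegral_of_continuous h continuous_snd

theorem hasDerivAt_varPath_time (hθ : Continuous θ) (hΘ : Continuous Θ) (ε t : ℝ) :
    HasDerivAt (varPath v z₀ θ Θ ε) (v * rot (-(θ t + ε * Θ t))) t := by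
  have h : Continuous fun r => (v : ℂ) * rot (-(θ r + ε * Θ r)) :=
    continuous_const.mul (continuous_rot.comp (by fun_prop))
  exact (intervalIntegral.integral_hasDerivAt_right (h.intervalIntegrable _ _)
    h.stronglyMeasurable.stronglyMeasurableAtFilter h.continuousAt).const_add z₀

theorem hasDerivAt_varField_time (hθ : Continuous θ) (hΘ : Continuous Θ) (ε t : ℝ) :
    HasDerivAt (varField v θ Θ ε) (v * (Complex.I * Θ t * rot (-(θ t + ε * Θ t)))) t := by
  have h : Continuous fun r => (v : ℂ) * (Complex.I * Θ r * rot (-(θ r + ε * Θ r))) :=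
    continuous_const.mul (Continuous.mul (by fun_prop) (continuous_rot.comp (by fun_prop)))
  exact intervalIntegral.integral_hasDerivAt_right (h.intervalIntegrable _ _)
    h.stronglyMeasurable.stronglyMeasurableAtFilter h.continuousAt

theorem hasDerivAt_varPath (hθ : Continuous θ) (hΘ : Continuous Θ) (ε : ℝ) {t : ℝ} (ht : 0 ≤ t) :
    HasDerivAt (fun ε => varPath v z₀ θ Θ ε t) (varField v θ Θ ε t) ε := by
  refine (hasDerivAt_integral_of_continuousOn
    (f := fun ε r => (v : ℂ) * rot (-(θ r + ε * Θ r)))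
    (f' := fun ε r => (v : ℂ) * (Complex.I * Θ r * rot (-(θ r + ε * Θ r)))) ht one_pos
    (fun ε _ => Continuous.continuousOn
      (continuous_const.mul (continuous_rot.comp (by fun_prop))))
    (Continuous.continuousOn (continuous_const.mul
      (Continuous.mul (by fun_prop) (continuous_rot.comp (by fun_prop)))))
    fun ε _ r _ => ?_).const_add z₀
  have h1 : HasDerivAt (fun ε : ℝ => -(θ r + ε * Θ r)) (-Θ r) ε := by
    exact ((((hasDerivAt_id ε).mul_const (Θ r)).const_add (θ r)).neg).congr_deriv (by simp)
  refine (((hasDerivAt_rot _).scomp ε h1).const_mul (v : ℂ)).congr_deriv ?_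
  rw [Complex.real_smul]; push_cast; ring

theorem exists_varPath_ne_zero (hθ : Continuous θ) (hΘ : Continuous Θ)
    (hne : ∀ t ∈ Icc 0 T, varPath v z₀ θ Θ 0 t ≠ 0) :
    ∃ δ > 0, ∀ ε ∈ Metric.closedBall (0 : ℝ) δ, ∀ t ∈ Icc 0 T, varPath v z₀ θ Θ ε t ≠ 0 := by
  have ho : IsOpen {p : ℝ × ℝ | varPath v z₀ θ Θ p.1 p.2 ≠ 0} :=
    isOpen_ne.preimage (continuous_varPath hθ hΘ)
  obtain ⟨U, V, hU, -, h0U, hTV, hUV⟩ := generalized_tube_lemma (isCompact_singleton (x := (0 : ℝ)))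
    (isCompact_Icc (a := 0) (b := T)) ho fun p hp => by
      have h0 : p.1 = 0 := mem_singleton_iff.1 hp.1
      rw [mem_ofPred_eq, h0]
      exact hne _ hp.2
  obtain ⟨δ, hδ, hsub⟩ := Metric.nhds_basis_closedBall.mem_iff.1 (hU.mem_nhds (h0U (mem_singleton _)))
  exact ⟨δ, hδ, fun ε hε t ht => by
    have h := hUV (mk_mem_prod (hsub hε) (hTV ht))
    rwa [mem_ofPred_eq] at h⟩

theorem hasDerivAt_integral_potential {A : ℝ} {b : ℂ} (hT : 0 ≤ T) (hθ : Continuous θ)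
    (hΘ : Continuous Θ) (hne : ∀ t ∈ Icc 0 T, varPath v z₀ θ Θ 0 t ≠ 0) :
    HasDerivAt (fun ε => ∫ t in (0 : ℝ)..T, potential A b (varPath v z₀ θ Θ ε t))
      (∫ t in (0 : ℝ)..T,
        (gradPotential A b (varPath v z₀ θ Θ 0 t) * conj (varField v θ Θ 0 t)).re) 0 := by
  obtain ⟨δ, hδ, h⟩ := exists_varPath_ne_zero hθ hΘ hne
  have hcont := continuous_varPath (v := v) (z₀ := z₀) hθ hΘ
  refine hasDerivAt_integral_of_continuousOn (f := fun ε t => potential A b (varPath v z₀ θ Θ ε t))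
    (f' := fun ε t => (gradPotential A b (varPath v z₀ θ Θ ε t) * conj (varField v θ Θ ε t)).re)
    hT hδ ?_ ?_ ?_
  · intro ε hε t ht
    exact (hasDerivWithinAt_potential (hasDerivAt_varPath_time hθ hΘ ε t).hasDerivWithinAt
      (h ε hε t ht)).continuousWithinAt
  · refine Complex.continuous_re.comp_continuousOn (ContinuousOn.mul ?_ ?_)
    · rintro ⟨ε, t⟩ ⟨hε, ht⟩
      have h1 : ContinuousAt (gradPotential A b) (Function.uncurry (varPath v z₀ θ Θ) (ε, t)) :=
        (contDiffAt_gradPotential (n := 0) (h ε hε t ht)).continuousAt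
      exact (h1.comp hcont.continuousAt).continuousWithinAt
    · exact (Complex.continuous_conj.comp (continuous_varField hθ hΘ)).continuousOn
  · intro ε hε t ht
    rw [← hasDerivWithinAt_univ]
    exact hasDerivWithinAt_potential (hasDerivAt_varPath hθ hΘ ε ht.1).hasDerivWithinAt
      (h ε hε t ht)

/-- The first variation of the integrated potential, in terms of the switching function. -/
theorem integral_grad_varField {A : ℝ} {b : ℂ} {l : ℝ → ℂ} {φ δ : ℝ → ℝ} (hT : 0 ≤ T)
    (hθ : Continuous θ) (hΘ : Continuous Θ)
    (hδ : IntervalIntegrable δ volume 0 T)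
    (hΘδ : ∀ t ∈ Icc 0 T, Θ t = ∫ r in (0 : ℝ)..t, δ r)
    (hG : ContinuousOn (fun t => gradPotential A b (varPath v z₀ θ Θ 0 t)) (Icc 0 T))
    (hl : ∀ t ∈ Icc 0 T, HasDerivAt l (gradPotential A b (varPath v z₀ θ Θ 0 t)) t)
    (hφ : ∀ t ∈ Icc 0 T, HasDerivAt φ (sweep v l θ t) t) (hlT : l T = 0) (hφT : φ T = 0) :
    ∫ t in (0 : ℝ)..T,
        (gradPotential A b (varPath v z₀ θ Θ 0 t) * conj (varField v θ Θ 0 t)).re =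
      -∫ t in (0 : ℝ)..T, φ t * δ t := by
  have hu : uIcc 0 T = Icc 0 T := uIcc_of_le hT
  have hlc : ContinuousOn l (Icc 0 T) := fun t ht => (hl t ht).continuousAt.continuousWithinAt
  have hφc : ContinuousOn φ (Icc 0 T) := fun t ht => (hφ t ht).continuousAt.continuousWithinAt
  have hrθ : Continuous fun t => rot (θ t) := continuous_rot.comp hθ
  have hsw : ContinuousOn (sweep v l θ) (Icc 0 T) :=
    continuousOn_const.mul (Complex.continuous_im.comp_continuousOn (hlc.mul hrθ.continuousOn))
  set W := varField v θ Θ 0 with hW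
  have hWd : ∀ t, HasDerivAt W (v * (Complex.I * Θ t * rot (-θ t))) t := fun t => by
    simpa using hasDerivAt_varField_time (v := v) hθ hΘ 0 t
  have hWc : Continuous W := continuous_iff_continuousAt.2 fun t => (hWd t).continuousAt
  -- The first of two integrations by parts: since `l T = 0` and `W 0 = 0`, the variation equals `∫
  -- Θ φ'`.
  have hd : ∀ t ∈ Icc 0 T, HasDerivAt (fun t => (l t * conj (W t)).re)
      ((gradPotential A b (varPath v z₀ θ Θ 0 t) * conj (W t)).re - Θ t * sweep v l θ t) t := by
    intro t ht
    have h1 := (hl t ht).mul (hWd t).star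
    have h2 := Complex.reCLM.hasFDerivAt.comp_hasDerivAt t h1
    refine HasDerivAt.congr_deriv (f' := _) h2 ?_
    have h3 : l t * conj (v * (Complex.I * Θ t * rot (-θ t))) =
        -(Complex.I * ((v * Θ t : ℝ) : ℂ) * (l t * rot (θ t))) := by
      rw [map_mul, map_mul, map_mul, Complex.conj_ofReal, Complex.conj_ofReal, conj_rot, neg_neg,
        Complex.conj_I]
      push_cast; ring
    have h4 : (l t * conj (v * (Complex.I * Θ t * rot (-θ t)))).re = -(Θ t * sweep v l θ t) := by
      rw [h3, sweep]
      simp only [Complex.neg_re, Complex.mul_re, Complex.mul_im, Complex.I_re, Complex.I_im,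
        Complex.ofReal_re, Complex.ofReal_im]
      ring
    rw [Complex.reCLM_apply, Complex.add_re, sub_eq_add_neg, ← h4]
    rfl
  have hint1 : IntervalIntegrable (fun t => (gradPotential A b (varPath v z₀ θ Θ 0 t) *
      conj (W t)).re) volume 0 T :=
    ContinuousOn.intervalIntegrable (by
      rw [hu]
      exact Complex.continuous_re.comp_continuousOn
        (hG.mul (Complex.continuous_conj.comp hWc).continuousOn))
  have hint2 : IntervalIntegrable (fun t => Θ t * sweep v l θ t) volume 0 T :=
    ContinuousOn.intervalIntegrable (by rw [hu]; exact hΘ.continuousOn.mul hsw)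
  have h1 := intervalIntegral.integral_eq_sub_of_hasDerivAt (a := 0) (b := T)
    (fun t ht => hd t (hu ▸ ht)) (hint1.sub hint2)
  have hW0 : W 0 = 0 := by simp [hW, varField]
  rw [intervalIntegral.integral_sub hint1 hint2, hlT, hW0] at h1
  simp only [zero_mul, map_zero, mul_zero, sub_self, Complex.zero_re] at h1
  obtain ⟨C, hC⟩ := isCompact_Icc.exists_bound_of_continuousOn hsw
  -- The second integration by parts moves the derivative from `φ` to `Θ`. As `δ` is merely
  -- integrable, `Θ` is differentiable only almost everywhere, and the absolutely continuous version
  -- of the rule is needed.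
  have hφac : AbsolutelyContinuousOnInterval φ 0 T := by
    refine LipschitzOnWith.absolutelyContinuousOnInterval (K := C.toNNReal) ?_
    rw [hu]
    refine (convex_Icc 0 T).lipschitzOnWith_of_nnnorm_hasDerivWithin_le
      (fun t ht => (hφ t ht).hasDerivWithinAt) fun t ht => ?_
    rw [← NNReal.coe_le_coe, coe_nnnorm]
    exact (hC t ht).trans (Real.le_coe_toNNReal C)
  have h2 := hφac.integral_mul_deriv_eq_deriv_mul
    (hδ.absolutelyContinuousOnInterval_intervalIntegral (c := 0) (by simp))
  have hd1 : ∫ t in (0 : ℝ)..T, φ t * deriv (fun t => ∫ r in (0 : ℝ)..t, δ r) t =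
      ∫ t in (0 : ℝ)..T, φ t * δ t := by
    refine intervalIntegral.integral_congr_ae ?_
    filter_upwards [hδ.ae_hasDerivAt_integral] with t ht htI
    rw [(ht (uIoc_subset_uIcc htI) 0 (by simp)).deriv]
  have hd2 : ∫ t in (0 : ℝ)..T, deriv φ t * ∫ r in (0 : ℝ)..t, δ r =
      ∫ t in (0 : ℝ)..T, Θ t * sweep v l θ t := by
    refine intervalIntegral.integral_congr fun t ht => ?_
    simp only [(hφ t (hu ▸ ht)).deriv, ← hΘδ t (hu ▸ ht)]; ring
  rw [hd1, hd2, hφT, intervalIntegral.integral_same] at h2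
  linarith

end

/-! ### Information integrals as potentials, and feasible perturbations. -/

theorem potential_x (z : ℂ) : potential (1 / 2) (1 / 2) z = z.re ^ 2 / (z.re ^ 2 + z.im ^ 2) ^ 2 := by
  rw [potential_eq, Complex.normSq_apply, ← sq, ← sq]
  congr 1
  simp [sq, Complex.mul_re]; ring

theorem potential_y (z : ℂ) :
    potential (1 / 2) (-1 / 2) z = z.im ^ 2 / (z.re ^ 2 + z.im ^ 2) ^ 2 := by
  rw [potential_eq, Complex.normSq_apply, ← sq, ← sq]
  congr 1
  simp [sq, Complex.mul_re]; ring

theorem potential_xy (z : ℂ) :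
    potential 0 (Complex.I / 2) z = z.re * z.im / (z.re ^ 2 + z.im ^ 2) ^ 2 := by
  rw [potential_eq, Complex.normSq_apply, ← sq, ← sq]
  congr 1
  simp [sq, Complex.mul_re]; ring

/-- The coefficients are minus the partial derivatives of `z₃² - z₁ z₂`, so the linearized cost is
an integral of a single gradient. -/
theorem gradPotential_combination (z₁ z₂ z₃ : ℝ) (z : ℂ) :
    gradPotential ((z₁ + z₂) / 2) (((z₂ - z₁) / 2 : ℝ) - z₃ * Complex.I) z =
      z₂ * gradPotential (1 / 2) (1 / 2) z + z₁ * gradPotential (1 / 2) (-1 / 2) z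
        - 2 * z₃ * gradPotential 0 (Complex.I / 2) z := by
  simp only [gradPotential, map_sub, map_mul, map_div₀, map_neg, map_one, map_ofNat, Complex.conj_I,
    Complex.conj_ofReal]
  push_cast
  ring

theorem HasW12Deriv.of_hasDerivAt {T : ℝ} {f g : ℝ → ℝ} (hg : ContinuousOn g (Icc 0 T))
    (h : ∀ t ∈ Icc 0 T, HasDerivAt f (g t) t) : HasW12Deriv T f g := by
  constructor
  · obtain ⟨C, hC⟩ := isCompact_Icc.exists_bound_of_continuousOn hg
    exact MemLp.of_bound (hg.aestronglyMeasurable measurableSet_Icc) C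
      ((ae_restrict_iff' measurableSet_Icc).2 (ae_of_all _ hC))
  · intro t ht
    have hsub : uIcc 0 t ⊆ Icc 0 T := by
      rw [uIcc_of_le ht.1]; exact Icc_subset_Icc le_rfl ht.2
    rw [intervalIntegral.integral_eq_sub_of_hasDerivAt (fun r hr => h r (hsub hr))
      (hg.mono hsub).intervalIntegrable]
    ring

/-- The state along a path `z` with course `θ`. -/
noncomputable def pathState (z : ℝ → ℂ) (θ : ℝ → ℝ) : ObserverState where
  x t := (z t).re
  y t := (z t).im
  θ := θ
  z₁ t := ∫ r in (0 : ℝ)..t, potential (1 / 2) (1 / 2) (z r)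
  z₂ t := ∫ r in (0 : ℝ)..t, potential (1 / 2) (-1 / 2) (z r)
  z₃ t := ∫ r in (0 : ℝ)..t, potential 0 (Complex.I / 2) (z r)

theorem continuousOn_potential_comp {A : ℝ} {b : ℂ} {z : ℝ → ℂ} {S : Set ℝ} (hz : ContinuousOn z S)
    (h0 : ∀ t ∈ S, z t ≠ 0) : ContinuousOn (fun t => potential A b (z t)) S := by
  have hc := Complex.continuous_conj.comp_continuousOn hz
  refine Complex.continuous_re.comp_continuousOn (ContinuousOn.div ?_ ?_ fun t ht =>
    pow_ne_zero 2 (mul_conj_ne_zero (h0 t ht)))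
  · exact (continuousOn_const.mul (hz.mul hc)).add (continuousOn_const.mul (hc.pow 2))
  · exact (hz.mul hc).pow 2

theorem isFeasible_pathState {P : ObserverData} {z : ℝ → ℂ} {θ u : ℝ → ℝ} (hθc : Continuous θ)
    (hu : MemLp u ⊤ (volume.restrict (Icc 0 P.tf)))
    (hub : ∀ᵐ t ∂(volume.restrict (Icc 0 P.tf)), -(P.v * P.a) ≤ u t ∧ u t ≤ P.v * P.a)
    (hθ : HasW12Deriv P.tf θ (fun t => u t / P.v))
    (hz : ∀ t, HasDerivAt z (P.v * rot (-θ t)) t) (hne : ∀ t ∈ Icc 0 P.tf, z t ≠ 0)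
    (hz0 : z 0 = ⟨P.x₀, P.y₀⟩) (hθ0 : θ 0 = P.θ₀) : IsFeasible P (pathState z θ) u := by
  have hzc : Continuous z := continuous_iff_continuousAt.2 fun t => (hz t).continuousAt
  have hW : ∀ (A : ℝ) (b : ℂ), HasW12Deriv P.tf
      (fun t => ∫ r in (0 : ℝ)..t, potential A b (z r)) (fun t => potential A b (z t)) := by
    intro A b
    have hc : ContinuousOn (fun t => potential A b (z t)) (Icc 0 P.tf) :=
      continuousOn_potential_comp hzc.continuousOn hne
    obtain ⟨C, hC⟩ := isCompact_Icc.exists_bound_of_continuousOn hc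
    refine ⟨MemLp.of_bound (hc.aestronglyMeasurable measurableSet_Icc) C
      ((ae_restrict_iff' measurableSet_Icc).2 (ae_of_all _ hC)), fun t _ => ?_⟩
    simp
  refine ⟨hu, hub, ?_, ?_, hθ, ?_, ?_, ?_, ?_, ?_, hθ0, ?_, ?_, ?_⟩
  · refine HasW12Deriv.of_hasDerivAt (Continuous.continuousOn (by simp only [pathState]; fun_prop))
      fun t _ => ?_
    have := Complex.reCLM.hasFDerivAt.comp_hasDerivAt t (hz t)
    rw [mul_rot_neg_eq_mk] at this
    exact this
  · refine HasW12Deriv.of_hasDerivAt (Continuous.continuousOn (by simp only [pathState]; fun_prop))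
      fun t _ => ?_
    have := Complex.imCLM.hasFDerivAt.comp_hasDerivAt t (hz t)
    rw [mul_rot_neg_eq_mk] at this
    exact this
  · have := hW (1 / 2) (1 / 2)
    simp only [potential_x] at this
    simpa only [pathState, potential_x] using this
  · have := hW (1 / 2) (-1 / 2)
    simp only [potential_y] at this
    simpa only [pathState, potential_y] using this
  · have := hW 0 (Complex.I / 2)
    simp only [potential_xy] at this
    simpa only [pathState, potential_xy] using this
  · simp [pathState, hz0]
  · simp [pathState, hz0]
  all_goals simp [pathState]

namespace IsFeasible

variable {P : ObserverData} {s : ObserverState} {u w : ℝ → ℝ}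

/-- The primitive of `(w - u) / v`, extended to the line. -/
noncomputable def courseVar (P : ObserverData) (u w : ℝ → ℝ) (t : ℝ) : ℝ :=
  ∫ r in (0 : ℝ)..clamp P.tf t, (w r - u r) / P.v

/-- The path steered by `u + ε (w - u)`. -/
noncomputable def pathVar (P : ObserverData) (s : ObserverState) (u w : ℝ → ℝ) : ℝ → ℝ → ℂ :=
  varPath P.v ⟨P.x₀, P.y₀⟩ (fun t => s.θ (clamp P.tf t)) (courseVar P u w)

theorem memLp_diff (h : IsFeasible P s u) (hw : MemLp w ⊤ (volume.restrict (Icc 0 P.tf))) :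
    MemLp (fun r => (w r - u r) / P.v) ⊤ (volume.restrict (Icc 0 P.tf)) := by
  refine ((hw.sub h.control_memLp).const_mul P.v⁻¹).congr_norm ?_ (ae_of_all _ fun r => ?_)
  · exact (((hw.sub h.control_memLp).1.aemeasurable).div_const P.v).aestronglyMeasurable
  · rw [Pi.sub_apply, div_eq_inv_mul]

theorem hasW12Deriv_courseVar (h : IsFeasible P s u)
    (hw : MemLp w ⊤ (volume.restrict (Icc 0 P.tf))) :
    HasW12Deriv P.tf (courseVar P u w) (fun r => (w r - u r) / P.v) := by
  refine ⟨(h.memLp_diff hw).mono_exponent le_top, fun t ht => ?_⟩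
  rw [courseVar, courseVar, clamp_of_mem ht, clamp_of_mem ⟨le_rfl, P.tf_pos.le⟩]
  simp

theorem continuous_courseVar (h : IsFeasible P s u)
    (hw : MemLp w ⊤ (volume.restrict (Icc 0 P.tf))) : Continuous (courseVar P u w) := by
  have h1 := ((h.hasW12Deriv_courseVar hw).continuousOn P.tf_pos.le).comp_clamp P.tf_pos.le
  refine h1.congr fun t => ?_
  rw [courseVar, courseVar, clamp_of_mem (clamp_mem P.tf_pos.le t)]

theorem continuous_θ (h : IsFeasible P s u) : Continuous fun t => s.θ (clamp P.tf t) :=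
  h.θ_cont.comp_clamp P.tf_pos.le

theorem pathVar_zero (h : IsFeasible P s u) {t : ℝ} (ht : t ∈ Icc 0 P.tf) :
    pathVar P s u w 0 t = ⟨s.x t, s.y t⟩ := by
  have hsub : Icc 0 t ⊆ Icc 0 P.tf := Icc_subset_Icc le_rfl ht.2
  have h1 := intervalIntegral.integral_eq_sub_of_hasDerivAt_of_le ht.1
    (f := fun t => Complex.mk (s.x t) (s.y t)) (f' := fun t => P.v * rot (-s.θ t))
    (fun r hr => ((h.path_deriv (hsub hr)).mono hsub).continuousWithinAt)
    (fun r hr => (h.path_deriv (hsub (Ioo_subset_Icc_self hr))).hasDerivAt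
      (mem_of_superset (Icc_mem_nhds hr.1 hr.2) hsub))
    (ContinuousOn.intervalIntegrable (by
      rw [uIcc_of_le ht.1]
      exact continuousOn_const.mul (continuous_rot.comp_continuousOn (h.θ_cont.mono hsub).neg)))
  have h2 : ∫ r in (0 : ℝ)..t, P.v * rot (-(s.θ (clamp P.tf r) + 0 * courseVar P u w r)) =
      ∫ r in (0 : ℝ)..t, P.v * rot (-s.θ r) := by
    simp only [zero_mul, add_zero]
    exact integral_comp_clamp (f := fun r => P.v * rot (-s.θ r)) ht
  rw [pathVar, varPath, h2, h1, ← h.x_init, ← h.y_init, add_sub_cancel]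

/-- The perturbed pairs are feasible. -/
theorem exists_perturbation (h : IsFeasible P s u)
    (hw : MemLp w ⊤ (volume.restrict (Icc 0 P.tf)))
    (hwb : ∀ᵐ t ∂(volume.restrict (Icc 0 P.tf)), -(P.v * P.a) ≤ w t ∧ w t ≤ P.v * P.a) :
    ∃ δ > 0, ∀ ε ∈ Ico 0 δ, IsFeasible P (pathState (pathVar P s u w ε)
      fun t => s.θ (clamp P.tf t) + ε * courseVar P u w t) fun t => u t + ε * (w t - u t) := by
  have hΘc := h.continuous_courseVar hw
  obtain ⟨δ, hδ, hne⟩ := exists_varPath_ne_zero (v := P.v) (z₀ := ⟨P.x₀, P.y₀⟩) (T := P.tf)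
    h.continuous_θ hΘc fun t ht => by
      have := h.pathVar_zero (w := w) ht
      rw [pathVar] at this
      rw [this]; exact h.path_ne_zero ht
  -- `δ` keeps the varied path away from the target, and `ε ≤ 1` keeps the control a convex
  -- combination of admissible ones.
  refine ⟨min δ 1, lt_min hδ one_pos, fun ε hε => ?_⟩
  have h0m : (0 : ℝ) ∈ Icc 0 P.tf := ⟨le_rfl, P.tf_pos.le⟩
  have hε1 : ε ≤ 1 := hε.2.le.trans (min_le_right _ _)
  have hεδ : ε ∈ Metric.closedBall (0 : ℝ) δ := by
    rw [mem_closedBall_zero_iff, Real.norm_eq_abs, abs_of_nonneg hε.1]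
    exact hε.2.le.trans (min_le_left _ _)
  have hΘ := h.hasW12Deriv_courseVar hw
  have hΘ0 : courseVar P u w 0 = 0 := by
    rw [courseVar, clamp_of_mem h0m, intervalIntegral.integral_same]
  refine isFeasible_pathState (h.continuous_θ.add (continuous_const.mul hΘc))
    (h.control_memLp.add ((hw.sub h.control_memLp).const_mul ε)) ?_ ?_
    (hasDerivAt_varPath_time h.continuous_θ hΘc ε) (hne ε hεδ) (by simp [pathVar, varPath]) ?_
  · filter_upwards [h.control_bound, hwb] with t h1 h2
    constructor <;> nlinarith [hε.1]
  · have hd : (fun t => (u t + ε * (w t - u t)) / P.v) =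
        fun t => u t / P.v + ε * ((w t - u t) / P.v) := by
      funext t; ring
    rw [hd]
    refine ⟨h.θ_ode.1.add (hΘ.1.const_mul ε), fun t ht => ?_⟩
    beta_reduce
    rw [clamp_of_mem ht, clamp_of_mem h0m, h.θ_ode.2 t ht, hΘ.2 t ht, hΘ0,
      intervalIntegral.integral_add (h.θ_ode.intervalIntegrable h0m ht)
        ((hΘ.intervalIntegrable h0m ht).const_mul ε), intervalIntegral.integral_const_mul]
    ring
  · rw [clamp_of_mem h0m, hΘ0, h.θ_init, mul_zero, add_zero]

end IsFeasible

/-! ### Positive definiteness of the information matrix. -/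

theorem eqOn_zero_of_sin_eq_zero {g : ℝ → ℝ} {T : ℝ} (hg : ContinuousOn g (Icc 0 T)) (h0 : g 0 = 0)
    (hs : ∀ t ∈ Icc 0 T, Real.sin (g t) = 0) : ∀ t ∈ Icc 0 T, g t = 0 := by
  intro t ht
  by_contra hne
  have hpos : 0 < |g t| := abs_pos.2 hne
  have hc : ContinuousOn (fun r => |g r|) (Icc 0 t) := (hg.mono (Icc_subset_Icc le_rfl ht.2)).abs
  have hmem : min |g t| 1 ∈ Icc |g 0| |g t| := by
    rw [h0, abs_zero]
    exact ⟨(lt_min hpos one_pos).le, min_le_left _ _⟩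
  obtain ⟨r, hr, hr' : |g r| = min |g t| 1⟩ := intermediate_value_Icc ht.1 hc hmem
  have h1 : 0 < Real.sin |g r| := by
    refine Real.sin_pos_of_pos_of_lt_pi ?_ ?_ <;> rw [hr']
    · exact lt_min hpos one_pos
    · exact (min_le_right _ _).trans_lt (by linarith [Real.pi_gt_three])
  have h2 := hs r ⟨hr.1, hr.2.trans ht.2⟩
  rcases abs_choice (g r) with h | h <;> rw [h] at h1
  · exact h1.ne' h2
  · rw [Real.sin_neg, h2, neg_zero] at h1; exact lt_irrefl _ h1

namespace IsFeasible

variable {P : ObserverData} {s : ObserverState} {u w : ℝ → ℝ}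

theorem sq_pos (h : IsFeasible P s u) {t : ℝ} (ht : t ∈ Icc 0 P.tf) :
    0 < s.x t ^ 2 + s.y t ^ 2 := by
  have := Complex.normSq_pos.2 (h.path_ne_zero ht)
  rw [Complex.normSq_apply] at this
  simpa [sq] using this

/-- The information matrix is positive definite along a path that is not straight. -/
theorem cost_neg_of_course_ne (h : IsFeasible P s u) {t₁ : ℝ} (ht₁ : t₁ ∈ Icc 0 P.tf)
    (hne : s.θ t₁ ≠ s.θ 0) : observerCost P s < 0 := by
  have h0m : (0 : ℝ) ∈ Icc 0 P.tf := ⟨le_rfl, P.tf_pos.le⟩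
  have hTm : P.tf ∈ Icc 0 P.tf := ⟨P.tf_pos.le, le_rfl⟩
  have hxd := fun t ht => h.x_ode.hasDerivWithinAt P.tf_pos.le (t := t)
      (continuousOn_const.mul (Real.continuous_cos.comp_continuousOn h.θ_cont)) ht
  have hyd := fun t ht => h.y_ode.hasDerivWithinAt P.tf_pos.le (t := t)
      (continuousOn_const.mul (Real.continuous_sin.comp_continuousOn h.θ_cont)) ht
  have hxc : ContinuousOn s.x (Icc 0 P.tf) := fun t ht => (hxd t ht).continuousWithinAt
  have hyc : ContinuousOn s.y (Icc 0 P.tf) := fun t ht => (hyd t ht).continuousWithinAt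
  -- The quadratic form is the integral of `(ξ y - η x)² / |z|⁴`. It vanishes only if the path lies
  -- on a line through the target; then the velocity is always parallel to `(ξ, η)`, and by
  -- continuity the course is constant.
  have key : ∀ ξ η : ℝ, (ξ ≠ 0 ∨ η ≠ 0) →
      0 < ξ ^ 2 * s.z₂ P.tf - 2 * ξ * η * s.z₃ P.tf + η ^ 2 * s.z₁ P.tf := by
    intro ξ η hξη
    set q : ℝ → ℝ := fun t => (ξ * s.y t - η * s.x t) ^ 2 / (s.x t ^ 2 + s.y t ^ 2) ^ 2 with hq
    have hqc : ContinuousOn q (Icc 0 P.tf) :=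
      (((continuousOn_const.mul hyc).sub (continuousOn_const.mul hxc)).pow 2).div
        (((hxc.pow 2).add (hyc.pow 2)).pow 2) fun t ht => pow_ne_zero 2 (h.sq_pos ht).ne'
    have hint : ∫ t in (0 : ℝ)..P.tf, q t =
        ξ ^ 2 * s.z₂ P.tf - 2 * ξ * η * s.z₃ P.tf + η ^ 2 * s.z₁ P.tf := by
      rw [h.z₁_ode.2 _ hTm, h.z₂_ode.2 _ hTm, h.z₃_ode.2 _ hTm, h.z₁_init, h.z₂_init, h.z₃_init,
        zero_add, zero_add, zero_add, ← intervalIntegral.integral_const_mul,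
        ← intervalIntegral.integral_const_mul, ← intervalIntegral.integral_const_mul,
        ← intervalIntegral.integral_sub, ← intervalIntegral.integral_add]
      · congr 1; funext t; simp only [hq]; ring
      · exact ((h.z₂_ode.intervalIntegrable h0m hTm).const_mul _).sub
          ((h.z₃_ode.intervalIntegrable h0m hTm).const_mul _)
      · exact (h.z₁_ode.intervalIntegrable h0m hTm).const_mul _
      · exact (h.z₂_ode.intervalIntegrable h0m hTm).const_mul _
      · exact (h.z₃_ode.intervalIntegrable h0m hTm).const_mul _
    rw [← hint]
    refine intervalIntegral.integral_pos P.tf_pos hqc (fun t _ => by positivity) ?_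
    by_contra! hcon
    have hzero : ∀ t ∈ Icc 0 P.tf, ξ * s.y t - η * s.x t = 0 := by
      intro t ht
      have h1 : q t = 0 := le_antisymm (hcon t ht) (by positivity)
      have h2 : (ξ * s.y t - η * s.x t) ^ 2 = 0 :=
        (div_eq_zero_iff.1 h1).resolve_right (pow_ne_zero 2 (h.sq_pos ht).ne')
      exact pow_eq_zero_iff (two_ne_zero) |>.1 h2
    have hdir : ∀ t ∈ Icc 0 P.tf, ξ * Real.sin (s.θ t) - η * Real.cos (s.θ t) = 0 := by
      intro t ht
      have h1 := ((hyd t ht).const_mul ξ).sub ((hxd t ht).const_mul η)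
      have h2 : HasDerivWithinAt (fun t => ξ * s.y t - η * s.x t) 0 (Icc 0 P.tf) t :=
        (hasDerivWithinAt_const t (Icc 0 P.tf) (0 : ℝ)).congr_of_mem (fun r hr => hzero r hr) ht
      have h3 := (uniqueDiffOn_Icc P.tf_pos t ht).eq_deriv _ h1 h2
      have h4 : P.v * (ξ * Real.sin (s.θ t) - η * Real.cos (s.θ t)) = 0 := by linarith
      exact (mul_eq_zero.1 h4).resolve_left P.v_pos.ne'
    refine hne (sub_eq_zero.1 (eqOn_zero_of_sin_eq_zero (g := fun t => s.θ t - s.θ 0)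
      (h.θ_cont.sub continuousOn_const) (sub_self _) (fun t ht => ?_) t₁ ht₁))
    rw [Real.sin_sub]
    have h1 := hdir t ht
    have h2 := hdir 0 h0m
    rcases hξη with hξ | hη
    · refine (mul_eq_zero.1 ?_).resolve_left hξ
      linear_combination Real.cos (s.θ 0) * h1 - Real.cos (s.θ t) * h2
    · refine (mul_eq_zero.1 ?_).resolve_left hη
      linear_combination Real.sin (s.θ 0) * h1 - Real.sin (s.θ t) * h2
  have hz₁ : 0 < s.z₁ P.tf := by simpa using key 0 1 (Or.inr one_ne_zero)
  -- On this vector the form takes the value `z₁ (z₁ z₂ - z₃²)`.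
  have h1 := key (s.z₁ P.tf) (s.z₃ P.tf) (Or.inl hz₁.ne')
  have h2 : s.z₁ P.tf * observerCost P s < 0 := by rw [observerCost]; nlinarith
  exact neg_of_mul_neg_right h2 hz₁.le

theorem z₁_nonneg (h : IsFeasible P s u) : 0 ≤ s.z₁ P.tf := by
  rw [h.z₁_ode.2 _ ⟨P.tf_pos.le, le_rfl⟩, h.z₁_init, zero_add]
  exact intervalIntegral.integral_nonneg P.tf_pos.le fun t _ => by positivity

theorem z₂_nonneg (h : IsFeasible P s u) : 0 ≤ s.z₂ P.tf := by
  rw [h.z₂_ode.2 _ ⟨P.tf_pos.le, le_rfl⟩, h.z₂_init, zero_add]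
  exact intervalIntegral.integral_nonneg P.tf_pos.le fun t _ => by positivity

end IsFeasible

/-! ### First-order condition at the optimum. -/

namespace IsOptimal

variable {P : ObserverData} {s : ObserverState} {u w : ℝ → ℝ}

/-- If the terminal course equals the initial one, mixing a little of the constant control `v a`
into `u` separates them, and the competitor has negative cost. Otherwise the optimal path is itself
not straight. -/
theorem cost_neg (h : IsOptimal P s u) : observerCost P s < 0 := by
  have hf := h.1
  have h0m : (0 : ℝ) ∈ Icc 0 P.tf := ⟨le_rfl, P.tf_pos.le⟩
  have hTm : P.tf ∈ Icc 0 P.tf := ⟨P.tf_pos.le, le_rfl⟩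
  by_cases hθ : s.θ P.tf = s.θ 0
  · have hva : 0 ≤ P.v * P.a := (mul_pos P.v_pos P.a_pos).le
    have hw : MemLp (fun _ : ℝ => P.v * P.a) ⊤ (volume.restrict (Icc 0 P.tf)) := memLp_const _
    obtain ⟨δ, hδ, hp⟩ := hf.exists_perturbation hw (ae_of_all _ fun t => ⟨by linarith, le_rfl⟩)
    have hp' := hp (δ / 2) ⟨by linarith, by linarith⟩
    refine (h.2 _ _ hp').trans_lt (hp'.cost_neg_of_course_ne hTm ?_)
    have h1 : IsFeasible.courseVar P u (fun _ => P.v * P.a) P.tf = P.a * P.tf := by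
      rw [IsFeasible.courseVar, clamp_of_mem hTm]
      have h2 : ∀ r, (P.v * P.a - u r) / P.v = P.a - u r / P.v := fun r => by
        rw [sub_div, mul_div_cancel_left₀ _ P.v_pos.ne']
      simp only [h2]
      rw [intervalIntegral.integral_sub intervalIntegrable_const
        (hf.θ_ode.intervalIntegrable h0m hTm), ← hf.θ_ode.sub_eq h0m hTm, hθ]
      simp [mul_comm]
    have h3 : IsFeasible.courseVar P u (fun _ => P.v * P.a) 0 = 0 := by
      rw [IsFeasible.courseVar, clamp_of_mem h0m, intervalIntegral.integral_same]
    simp only [pathState, clamp_of_mem h0m, clamp_of_mem hTm, h1, h3, hθ, mul_zero, add_zero]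
    have : 0 < δ / 2 * (P.a * P.tf) := mul_pos (by linarith) (mul_pos P.a_pos P.tf_pos)
    linarith
  · exact hf.cost_neg_of_course_ne hTm hθ

/-- `A` in the representation of the terminal quadratic form as a `potential`. -/
noncomputable def _root_.ObserverState.formA (s : ObserverState) (T : ℝ) : ℝ :=
  (s.z₁ T + s.z₂ T) / 2

/-- `b` in the representation of the terminal quadratic form as a `potential`. -/
noncomputable def _root_.ObserverState.formb (s : ObserverState) (T : ℝ) : ℂ :=
  ((s.z₂ T - s.z₁ T) / 2 : ℝ) - s.z₃ T * Complex.I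

/-- `A² - |b|² = z₁ z₂ - z₃²`, which is minus the cost. -/
theorem norm_formb_lt (h : IsOptimal P s u) : ‖s.formb P.tf‖ < s.formA P.tf := by
  have h1 := h.cost_neg
  have h2 := h.1.z₁_nonneg
  have h3 := h.1.z₂_nonneg
  refine lt_of_pow_lt_pow_left₀ 2 (by rw [ObserverState.formA]; linarith) ?_
  rw [← Complex.normSq_eq_norm_sq, Complex.normSq_apply, ObserverState.formA, ObserverState.formb]
  rw [observerCost] at h1
  simp only [Complex.sub_re, Complex.sub_im, Complex.mul_re, Complex.mul_im, Complex.ofReal_re,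
    Complex.ofReal_im, Complex.I_re, Complex.I_im]
  nlinarith

/-- The first-order condition. -/
theorem integral_switching_nonneg (h : IsOptimal P s u) {l : ℝ → ℂ} {φ : ℝ → ℝ}
    (hl : ∀ t ∈ Icc 0 P.tf, HasDerivAt l
      (gradPotential (s.formA P.tf) (s.formb P.tf) ⟨s.x t, s.y t⟩) t)
    (hφ : ∀ t ∈ Icc 0 P.tf, HasDerivAt φ (sweep P.v l (fun t => s.θ (clamp P.tf t)) t) t)
    (hlT : l P.tf = 0) (hφT : φ P.tf = 0) (hw : MemLp w ⊤ (volume.restrict (Icc 0 P.tf)))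
    (hwb : ∀ᵐ t ∂(volume.restrict (Icc 0 P.tf)), -(P.v * P.a) ≤ w t ∧ w t ≤ P.v * P.a) :
    0 ≤ ∫ t in (0 : ℝ)..P.tf, φ t * ((w t - u t) / P.v) := by
  have hf := h.1
  have hT := P.tf_pos.le
  have hTm : P.tf ∈ Icc 0 P.tf := ⟨hT, le_rfl⟩
  have h0m : (0 : ℝ) ∈ Icc 0 P.tf := ⟨le_rfl, hT⟩
  have hΘc := hf.continuous_courseVar hw
  have hθc := hf.continuous_θ
  have hZ0 : ∀ t ∈ Icc 0 P.tf, varPath P.v ⟨P.x₀, P.y₀⟩ (fun t => s.θ (clamp P.tf t))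
      (IsFeasible.courseVar P u w) 0 t = ⟨s.x t, s.y t⟩ := fun t ht => hf.pathVar_zero ht
  have hne : ∀ t ∈ Icc 0 P.tf, varPath P.v ⟨P.x₀, P.y₀⟩ (fun t => s.θ (clamp P.tf t))
      (IsFeasible.courseVar P u w) 0 t ≠ 0 := fun t ht => by
    rw [hZ0 t ht]; exact hf.path_ne_zero ht
  have hZc : Continuous (varPath P.v ⟨P.x₀, P.y₀⟩ (fun t => s.θ (clamp P.tf t))
      (IsFeasible.courseVar P u w) 0) := continuous_iff_continuousAt.2 fun t =>
    (hasDerivAt_varPath_time hθc hΘc 0 t).continuousAt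
  set Z := varPath P.v ⟨P.x₀, P.y₀⟩ (fun t => s.θ (clamp P.tf t)) (IsFeasible.courseVar P u w)
    with hZ
  set V := varField P.v (fun t => s.θ (clamp P.tf t)) (IsFeasible.courseVar P u w) 0 with hV
  have hVc : Continuous V := continuous_iff_continuousAt.2 fun t =>
    (hasDerivAt_varField_time hθc hΘc 0 t).continuousAt
  have hGc : ∀ (A : ℝ) (b : ℂ), ContinuousOn (fun t => gradPotential A b (Z 0 t)) (Icc 0 P.tf) := by
    intro A b t ht
    exact ((contDiffAt_gradPotential (n := 0) (hne t ht)).continuousAt.comp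
      hZc.continuousAt).continuousWithinAt
  have hint : ∀ (A : ℝ) (b : ℂ), IntervalIntegrable
      (fun t => (gradPotential A b (Z 0 t) * conj (V t)).re) volume 0 P.tf := by
    intro A b
    refine ContinuousOn.intervalIntegrable ?_
    rw [uIcc_of_le hT]
    exact Complex.continuous_re.comp_continuousOn
      ((hGc A b).mul (Complex.continuous_conj.comp hVc).continuousOn)
  have hd : ∀ (A : ℝ) (b : ℂ), HasDerivAt
      (fun ε => ∫ t in (0 : ℝ)..P.tf, potential A b (Z ε t))
      (∫ t in (0 : ℝ)..P.tf, (gradPotential A b (Z 0 t) * conj (V t)).re) 0 := fun A b =>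
    hasDerivAt_integral_potential hT hθc hΘc hne
  have hz1 : ∫ t in (0 : ℝ)..P.tf, potential (1 / 2) (1 / 2) (Z 0 t) = s.z₁ P.tf := by
    rw [hf.z₁_ode.2 _ hTm, hf.z₁_init, zero_add]
    refine intervalIntegral.integral_congr fun t ht => ?_
    simp only [hZ0 t (uIcc_of_le hT ▸ ht), potential_x]
  have hz2 : ∫ t in (0 : ℝ)..P.tf, potential (1 / 2) (-1 / 2) (Z 0 t) = s.z₂ P.tf := by
    rw [hf.z₂_ode.2 _ hTm, hf.z₂_init, zero_add]
    refine intervalIntegral.integral_congr fun t ht => ?_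
    simp only [hZ0 t (uIcc_of_le hT ▸ ht), potential_y]
  have hz3 : ∫ t in (0 : ℝ)..P.tf, potential 0 (Complex.I / 2) (Z 0 t) = s.z₃ P.tf := by
    rw [hf.z₃_ode.2 _ hTm, hf.z₃_init, zero_add]
    refine intervalIntegral.integral_congr fun t ht => ?_
    simp only [hZ0 t (uIcc_of_le hT ▸ ht), potential_xy]
  -- The derivative of the cost of the varied pair at `ε = 0`. Feasibility is known for `ε ≥ 0`
  -- only, so minimality gives a sign of the derivative from the right.
  have hJ := ((hd 0 (Complex.I / 2)).pow 2).sub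
    ((hd (1 / 2) (1 / 2)).mul (hd (1 / 2) (-1 / 2)))
  obtain ⟨δ, hδ, hp⟩ := hf.exists_perturbation hw hwb
  have hmin : ∀ ε ∈ Ico 0 δ, observerCost P s ≤
      (∫ t in (0 : ℝ)..P.tf, potential 0 (Complex.I / 2) (Z ε t)) ^ 2 -
      (∫ t in (0 : ℝ)..P.tf, potential (1 / 2) (1 / 2) (Z ε t)) *
      ∫ t in (0 : ℝ)..P.tf, potential (1 / 2) (-1 / 2) (Z ε t) := fun ε hε => h.2 _ _ (hp ε hε)
  have hD : 0 ≤ -∫ t in (0 : ℝ)..P.tf,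
      (gradPotential (s.formA P.tf) (s.formb P.tf) (Z 0 t) * conj (V t)).re := by
    have hslope := ((hasDerivWithinAt_iff_tendsto_slope' self_notMem_Ioi).1
      (hJ.hasDerivWithinAt (s := Ioi 0)))
    have hnn := ge_of_tendsto hslope (b := 0) (by
      filter_upwards [Ioo_mem_nhdsGT hδ] with ε hε
      have h1 := hmin ε ⟨hε.1.le, hε.2⟩
      rw [slope_def_field]
      refine div_nonneg ?_ (by linarith [hε.1])
      simp only [Pi.sub_apply, Pi.mul_apply, Pi.pow_apply, hz1, hz2, hz3]
      rw [observerCost] at h1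
      linarith)
    rw [hz1, hz2, hz3] at hnn
    have hcomb : ∫ t in (0 : ℝ)..P.tf,
        (gradPotential (s.formA P.tf) (s.formb P.tf) (Z 0 t) * conj (V t)).re =
        s.z₂ P.tf * (∫ t in (0 : ℝ)..P.tf,
          (gradPotential (1 / 2) (1 / 2) (Z 0 t) * conj (V t)).re) +
        s.z₁ P.tf * (∫ t in (0 : ℝ)..P.tf,
          (gradPotential (1 / 2) (-1 / 2) (Z 0 t) * conj (V t)).re) -
        2 * s.z₃ P.tf * ∫ t in (0 : ℝ)..P.tf,
          (gradPotential 0 (Complex.I / 2) (Z 0 t) * conj (V t)).re := by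
      rw [← intervalIntegral.integral_const_mul, ← intervalIntegral.integral_const_mul,
        ← intervalIntegral.integral_const_mul, ← intervalIntegral.integral_add,
        ← intervalIntegral.integral_sub]
      · congr 1; funext t
        rw [ObserverState.formA, ObserverState.formb, gradPotential_combination]
        simp only [Complex.mul_re, Complex.sub_re, Complex.add_re, Complex.sub_im, Complex.add_im,
          Complex.mul_im, Complex.ofReal_re, Complex.ofReal_im, Complex.re_ofNat, Complex.im_ofNat]
        ring
      · exact ((hint _ _).const_mul _).add ((hint _ _).const_mul _)
      · exact (hint _ _).const_mul _
      · exact (hint _ _).const_mul _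
      · exact (hint _ _).const_mul _
    rw [hcomb]
    norm_num at hnn ⊢
    linarith
  rwa [integral_grad_varField (l := l) (φ := φ) hT hθc hΘc
    ((hf.hasW12Deriv_courseVar hw).intervalIntegrable h0m hTm)
    (fun t ht => by rw [IsFeasible.courseVar, clamp_of_mem ht]) (hGc _ _)
    (fun t ht => by rw [← hZ, hZ0 t ht]; exact hl t ht) hφ hlT hφT, neg_neg] at hD

end IsOptimal

/-! ### Costate, bang-bang law and assembly of the arcs. -/

theorem finite_zeros_of_hasDerivAt {f f' : ℝ → ℂ} {S : Set ℝ} (hS : IsCompact S)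
    (hf : ∀ t ∈ S, HasDerivAt f (f' t) t) (h0 : ∀ t ∈ S, f' t ≠ 0) : {t ∈ S | f t = 0}.Finite := by
  by_contra hinf
  obtain ⟨x, hx, hacc⟩ := Set.Infinite.exists_accPt_of_subset_isCompact hinf hS (sep_subset _ _)
  rw [accPt_iff_frequently_nhdsNE] at hacc
  obtain ⟨y, hy, hy'⟩ := (hacc.and_eventually ((hf x hx).eventually_ne (c := 0) (h0 x hx))).exists
  exact hy' hy.2

theorem isArctanValue_of_mul_sin_eq {p q α : ℝ} (h : p * Real.sin α = q * Real.cos α)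
    (h0 : ¬(p = 0 ∧ q = 0)) : IsArctanValue α q p := by
  by_cases hp : p = 0
  · have hq : q ≠ 0 := fun hq => h0 ⟨hp, hq⟩
    rw [hp, zero_mul] at h
    obtain ⟨k, hk⟩ := Real.cos_eq_zero_iff.1 ((mul_eq_zero.1 h.symm).resolve_left hq)
    exact Or.inr ⟨hp, hq, k, by rw [hk]; ring⟩
  · refine Or.inl ⟨hp, ?_⟩
    have h1 : Real.sin (Real.arctan (q / p)) = q / p * Real.cos (Real.arctan (q / p)) := by
      conv_rhs => rw [← Real.tan_arctan (q / p), Real.arctan_tan (Real.neg_pi_div_two_lt_arctan _)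
        (Real.arctan_lt_pi_div_two _)]
      rw [Real.tan_mul_cos (Real.cos_arctan_pos _).ne']
    have h2 : Real.sin (α - Real.arctan (q / p)) = 0 := by
      rw [Real.sin_sub, h1]
      field_simp
      linear_combination Real.cos (Real.arctan (q / p)) * h
    obtain ⟨k, hk⟩ := Real.sin_eq_zero_iff.1 h2
    exact ⟨k, by linarith⟩

theorem gradPotential_form (s : ObserverState) (T x y : ℝ) :
    gradPotential (s.formA T) (s.formb T) ⟨x, y⟩ =
      ⟨(-2 * s.z₂ T * x ^ 3 + 6 * s.z₃ T * x ^ 2 * y + 2 * (s.z₂ T - 2 * s.z₁ T) * x * y ^ 2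
          - 2 * s.z₃ T * y ^ 3) / (x ^ 2 + y ^ 2) ^ 3,
        (-2 * s.z₁ T * y ^ 3 + 6 * s.z₃ T * y ^ 2 * x + 2 * (s.z₁ T - 2 * s.z₂ T) * y * x ^ 2
          - 2 * s.z₃ T * x ^ 3) / (x ^ 2 + y ^ 2) ^ 3⟩ := by
  have hn : Complex.normSq ⟨x, y⟩ = x ^ 2 + y ^ 2 := by rw [Complex.normSq_mk]; ring
  rw [gradPotential, Complex.mul_conj, hn, ← Complex.ofReal_pow, ObserverState.formb]
  generalize hm : (s.z₂ T - s.z₁ T) / 2 = m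
  have hz : s.z₂ T = s.z₁ T + 2 * m := by rw [← hm]; ring
  apply Complex.ext
  · rw [Complex.div_ofReal_re]
    congr 1
    simp [pow_succ, ObserverState.formA, hz]
    ring
  · rw [Complex.div_ofReal_im]
    congr 1
    simp [pow_succ, ObserverState.formA, hz]
    ring

theorem sweep_eq (v : ℝ) (l : ℝ → ℂ) (θ : ℝ → ℝ) (t : ℝ) :
    sweep v l θ t = v * ((l t).re * Real.sin (θ t) - (l t).im * Real.cos (θ t)) := by
  rw [sweep]
  simp [rot, Complex.exp_re, Complex.exp_im]
  ring

/-- The adjoint system is triangular: `l'` depends on the path alone and `φ'` on `l` and the course,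
so both are integrals from the terminal time. Clamping the time extends the integrands continuously
to the line, which gives two-sided derivatives at the end points too. -/
theorem IsFeasible.exists_costate {P : ObserverData} {s : ObserverState} {u : ℝ → ℝ}
    (h : IsFeasible P s u) : ∃ (l : ℝ → ℂ) (φ : ℝ → ℝ), Continuous φ ∧
      (∀ t ∈ Icc 0 P.tf, HasDerivAt l
        (gradPotential (s.formA P.tf) (s.formb P.tf) ⟨s.x t, s.y t⟩) t) ∧
      (∀ t ∈ Icc 0 P.tf, HasDerivAt φ (sweep P.v l (fun t => s.θ (clamp P.tf t)) t) t) ∧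
      l P.tf = 0 ∧ φ P.tf = 0 := by
  have hT := P.tf_pos.le
  have hzc : Continuous fun t => Complex.mk (s.x (clamp P.tf t)) (s.y (clamp P.tf t)) :=
    ContinuousOn.comp_clamp (f := fun t => Complex.mk (s.x t) (s.y t)) hT fun t ht =>
      (h.path_deriv ht).continuousWithinAt
  set G : ℝ → ℂ := fun t => gradPotential (s.formA P.tf) (s.formb P.tf)
    (Complex.mk (s.x (clamp P.tf t)) (s.y (clamp P.tf t))) with hG
  have hGc : Continuous G := continuous_iff_continuousAt.2 fun t =>
    ((contDiffAt_gradPotential (n := 0) (h.path_ne_zero (clamp_mem hT t))).continuousAt).comp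
      (f := fun t => Complex.mk (s.x (clamp P.tf t)) (s.y (clamp P.tf t))) hzc.continuousAt
  set l : ℝ → ℂ := fun t => ∫ r in P.tf..t, G r with hl
  have hld : ∀ t, HasDerivAt l (G t) t := fun t =>
    intervalIntegral.integral_hasDerivAt_right (hGc.intervalIntegrable _ _)
      hGc.stronglyMeasurable.stronglyMeasurableAtFilter hGc.continuousAt
  have hlc : Continuous l := continuous_iff_continuousAt.2 fun t => (hld t).continuousAt
  have hsc : Continuous (sweep P.v l fun t => s.θ (clamp P.tf t)) :=
    continuous_const.mul (Complex.continuous_im.comp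
      (hlc.mul (continuous_rot.comp h.continuous_θ)))
  have hφd : ∀ t, HasDerivAt (fun t => ∫ r in P.tf..t, sweep P.v l (fun t => s.θ (clamp P.tf t)) r)
      (sweep P.v l (fun t => s.θ (clamp P.tf t)) t) t := fun t =>
    intervalIntegral.integral_hasDerivAt_right (hsc.intervalIntegrable _ _)
      hsc.stronglyMeasurable.stronglyMeasurableAtFilter hsc.continuousAt
  refine ⟨l, _, continuous_iff_continuousAt.2 fun t => (hφd t).continuousAt, fun t ht => ?_,
    fun t _ => hφd t, intervalIntegral.integral_same, intervalIntegral.integral_same⟩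
  have := hld t
  simpa only [hG, clamp_of_mem ht] using this

/-- The optimal control is bang-bang off the zeros of the switching function. -/
theorem IsOptimal.control_eq {P : ObserverData} {s : ObserverState} {u : ℝ → ℝ}
    (h : IsOptimal P s u) {l : ℝ → ℂ} {φ : ℝ → ℝ} (hφc : Continuous φ)
    (hl : ∀ t ∈ Icc 0 P.tf, HasDerivAt l
      (gradPotential (s.formA P.tf) (s.formb P.tf) ⟨s.x t, s.y t⟩) t)
    (hφ : ∀ t ∈ Icc 0 P.tf, HasDerivAt φ (sweep P.v l (fun t => s.θ (clamp P.tf t)) t) t)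
    (hlT : l P.tf = 0) (hφT : φ P.tf = 0) :
    ∀ᵐ t, t ∈ Icc 0 P.tf → (φ t < 0 → u t = P.v * P.a) ∧ (0 < φ t → u t = -(P.v * P.a)) := by
  have hT := P.tf_pos.le
  have hva : 0 < P.v * P.a := mul_pos P.v_pos P.a_pos
  have hm1 : MeasurableSet {t | φ t < 0} := measurableSet_lt hφc.measurable measurable_const
  have hm2 : MeasurableSet {t | 0 < φ t} := measurableSet_lt measurable_const hφc.measurable
  have hm3 : MeasurableSet {t | φ t = 0} := measurableSet_eq_fun hφc.measurable measurable_const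
  -- The competitor minimizes `φ w` pointwise and copies `u` where `φ = 0`. Then `φ (w - u) ≤ 0`
  -- almost everywhere while its integral is nonnegative, so it vanishes almost everywhere.
  obtain ⟨w, hwm, hwn, hwz, hwp⟩ : ∃ w : ℝ → ℝ, MemLp w ⊤ (volume.restrict (Icc 0 P.tf)) ∧
      (∀ t, φ t < 0 → w t = P.v * P.a) ∧ (∀ t, φ t = 0 → w t = u t) ∧
      ∀ t, 0 < φ t → w t = -(P.v * P.a) := by
    refine ⟨_, (((memLp_const (P.v * P.a)).indicator hm1).add
      ((memLp_const (-(P.v * P.a))).indicator hm2)).add (h.1.control_memLp.indicator hm3),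
      fun t ht => ?_, fun t ht => ?_, fun t ht => ?_⟩ <;>
    simp only [Pi.add_apply, indicator_apply, mem_ofPred_eq]
    · rw [if_pos ht, if_neg ht.not_gt, if_neg ht.ne, add_zero, add_zero]
    · rw [if_neg ht.not_lt, if_neg ht.not_gt, if_pos ht, zero_add, zero_add]
    · rw [if_neg ht.not_gt, if_pos ht, if_neg ht.ne', zero_add, add_zero]
  have hwb : ∀ᵐ t ∂(volume.restrict (Icc 0 P.tf)), -(P.v * P.a) ≤ w t ∧ w t ≤ P.v * P.a := by
    filter_upwards [h.1.control_bound] with t ht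
    rcases lt_trichotomy (φ t) 0 with h0 | h0 | h0
    · rw [hwn t h0]; constructor <;> linarith
    · rwa [hwz t h0]
    · rw [hwp t h0]; constructor <;> linarith
  have hnn := h.integral_switching_nonneg hl hφ hlT hφT hwm hwb
  have hle : ∀ᵐ t ∂(volume.restrict (Icc 0 P.tf)), 0 ≤ -(φ t * ((w t - u t) / P.v)) := by
    filter_upwards [h.1.control_bound] with t ht
    rw [← mul_neg, ← neg_div, neg_sub, ← mul_div_assoc]
    refine div_nonneg ?_ P.v_pos.le
    rcases lt_trichotomy (φ t) 0 with h0 | h0 | h0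
    · rw [hwn t h0]; exact mul_nonneg_of_nonpos_of_nonpos h0.le (by linarith)
    · rw [h0, zero_mul]
    · rw [hwp t h0]; exact mul_nonneg h0.le (by linarith)
  have hint : IntegrableOn (fun t => φ t * ((w t - u t) / P.v)) (Icc 0 P.tf) := by
    rw [← intervalIntegrable_iff_integrableOn_Icc_of_le hT]
    exact ((h.1.hasW12Deriv_courseVar hwm).intervalIntegrable ⟨le_rfl, hT⟩
      ⟨hT, le_rfl⟩).continuousOn_mul hφc.continuousOn
  rw [intervalIntegral.integral_of_le hT, ← integral_Icc_eq_integral_Ioc] at hnn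
  have hz : ∫ t in Icc 0 P.tf, -(φ t * ((w t - u t) / P.v)) = 0 := by
    refine le_antisymm ?_ (integral_nonneg_of_ae hle)
    rw [integral_neg]; linarith
  have hae := (integral_eq_zero_iff_of_nonneg_ae hle hint.neg).1 hz
  rw [← ae_restrict_iff' measurableSet_Icc]
  filter_upwards [hae] with t ht
  have h1 : φ t * ((w t - u t) / P.v) = 0 := neg_eq_zero.1 ht
  have h2 : φ t ≠ 0 → u t = w t := fun h0 => by
    have := ((mul_eq_zero.1 h1).resolve_left h0)
    have := (div_eq_zero_iff.1 this).resolve_right P.v_pos.ne'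
    linarith
  exact ⟨fun h0 => by rw [h2 h0.ne, hwn t h0], fun h0 => by rw [h2 h0.ne', hwp t h0]⟩

theorem corollary1 (P : ObserverData) (s : ObserverState) (u : ℝ → ℝ) (hopt : IsOptimal P s u) :
    ∃ lx ly lθ : ℝ → ℝ, IsAdjoint P s lx ly lθ ∧
      ∃ (N : ℕ) (τ : ℕ → ℝ), τ 0 = 0 ∧ τ N = P.tf ∧
        ∀ i < N, τ i < τ (i + 1) ∧
          (IsBangArc P s u lθ (τ i) (τ (i + 1)) ∨
            IsInteriorArc s lx ly lθ (τ i) (τ (i + 1))) := by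
  have hf := hopt.1
  obtain ⟨l, φ, hφc, hl, hφ, hlT, hφT⟩ := hf.exists_costate
  have hu := hopt.control_eq hφc hl hφ hlT hφT
  have hA := hopt.norm_formb_lt
  have hsw : ∀ t ∈ Icc 0 P.tf, sweep P.v l (fun t => s.θ (clamp P.tf t)) t = sweep P.v l s.θ t :=
    fun t ht => by rw [sweep, sweep, clamp_of_mem ht]
  have hE : Extremal P.v P.a (s.formA P.tf) P.tf (s.formb P.tf)
      (fun t => Complex.mk (s.x t) (s.y t)) l s.θ φ :=
    { v_pos := P.v_pos
      a_pos := P.a_pos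
      T_pos := P.tf_pos
      z_deriv := fun t ht => hf.path_deriv ht
      l_deriv := fun t ht => (hl t ht).hasDerivWithinAt
      φ_deriv := fun t ht => hsw t ht ▸ (hφ t ht).hasDerivWithinAt
      z_ne := fun t ht => hf.path_ne_zero ht
      lip := fun r hr t ht => hf.θ_lip hr ht
      neg := fun r t hr hrt ht hneg => hf.θ_sub_of_control_eq hr hrt ht (by
        filter_upwards [hu] with τ hτ hτI
        exact (hτ ⟨hr.trans hτI.1.le, hτI.2.le.trans ht⟩).1 (hneg τ hτI))
      pos := fun r t hr hrt ht hpos => hf.θ_sub_of_control_eq hr hrt ht (by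
        filter_upwards [hu] with τ hτ hτI
        rw [(hτ ⟨hr.trans hτI.1.le, hτI.2.le.trans ht⟩).2 (hpos τ hτI)]; ring) }
  obtain ⟨N, τ, h0, hN, hτ⟩ := exists_sign_partition P.tf_pos
    (fun t ht => hE.hasSignGerm_right hA hlT hφT ht)
    (fun t ht => hE.hasSignGerm_left hA hlT hφT ht)
  have hmono : ∀ i ≤ N, 0 ≤ τ i := by
    intro i
    induction i with
    | zero => intro _; exact h0.ge
    | succ k ih => intro hk; exact (ih (by omega)).trans (hτ k hk).1.le
  have hanti : ∀ j i, i + j = N → τ i ≤ P.tf := by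
    intro j
    induction j with
    | zero => intro i hi; rw [← hN, ← hi, add_zero]
    | succ k ih => intro i hi; exact (hτ i (by omega)).1.le.trans (ih (i + 1) (by omega))
  refine ⟨fun t => (l t).re, fun t => (l t).im, φ, ?_, N, τ, h0, hN, fun i hi => ⟨(hτ i hi).1, ?_⟩⟩
  · refine ⟨fun t ht => ?_, fun t ht => ?_, fun t ht => ?_, ?_, ?_, hφT⟩
    · refine (hasDerivWithinAt_re (hE.l_deriv t ht)).congr_deriv ?_
      rw [gradPotential_form]
    · refine (hasDerivWithinAt_im (hE.l_deriv t ht)).congr_deriv ?_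
      rw [gradPotential_form]
    · exact (hE.φ_deriv t ht).congr_deriv (sweep_eq _ _ _ _)
    · simp [hlT]
    · simp [hlT]
  · obtain ⟨hlt, hsign⟩ := hτ i hi
    have hc := hmono i hi.le
    have hd := hanti (N - (i + 1)) (i + 1) (by omega)
    have hI : Icc (τ i) (τ (i + 1)) ⊆ Icc 0 P.tf := Icc_subset_Icc hc hd
    have haff : ∀ α : ℝ, (∀ r ∈ Ioo (τ i) (τ (i + 1)), s.θ r - s.θ (τ i) = α * (r - τ i)) →
        ∀ t ∈ Ioo (τ i) (τ (i + 1)), HasDerivAt s.θ α t := by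
      intro α hα t ht
      have h1 : HasDerivAt (fun r => s.θ (τ i) + α * (r - τ i)) α t :=
        ((((hasDerivAt_id t).sub_const (τ i)).const_mul α).const_add (s.θ (τ i))).congr_deriv
          (by simp)
      refine h1.congr_of_eventuallyEq ?_
      filter_upwards [Ioo_mem_nhds ht.1 ht.2] with r hr
      linarith [hα r hr]
    rcases hsign with h | h | h
    · refine Or.inl (Or.inl ⟨h, haff _ fun r hr => ?_, ?_⟩)
      · exact hE.neg _ _ hc hr.1 (hr.2.le.trans hd) fun x hx => h x ⟨hx.1, hx.2.trans hr.2⟩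
      · rw [ae_restrict_iff' measurableSet_Ioo]
        filter_upwards [hu] with t ht htI
        exact (ht (hI (Ioo_subset_Icc_self htI))).1 (h t htI)
    · refine Or.inl (Or.inr ⟨h, haff _ fun r hr => ?_, ?_⟩)
      · exact hE.pos _ _ hc hr.1 (hr.2.le.trans hd) fun x hx => h x ⟨hx.1, hx.2.trans hr.2⟩
      · rw [ae_restrict_iff' measurableSet_Ioo]
        filter_upwards [hu] with t ht htI
        exact (ht (hI (Ioo_subset_Icc_self htI))).2 (h t htI)
    · have hz : ∀ t ∈ Icc (τ i) (τ (i + 1)), φ t = 0 := by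
        intro t ht
        have h1 : EqOn φ 0 (closure (Ioo (τ i) (τ (i + 1)))) :=
          EqOn.closure (fun r hr => h r hr) hφc continuous_const
        rw [closure_Ioo hlt.ne] at h1
        exact h1 ht
      refine Or.inr ⟨hz, ?_, fun t ht hne => isArctanValue_of_mul_sin_eq ?_ hne⟩
      -- Common zeros of the two components are zeros of `l`, whose derivative never vanishes
      -- because the form is positive definite.
      · refine (finite_zeros_of_hasDerivAt isCompact_Icc (fun t ht => hl t (hI ht)) fun t ht =>
          gradPotential_ne_zero hA (hf.path_ne_zero (hI ht))).subset fun t ht => ?_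
        exact ⟨ht.1, Complex.ext ht.2.1 ht.2.2⟩
      -- Constancy of `φ` on the closed arc makes its derivative vanish at the end points as well,
      -- so the relation `λ_x sin θ = λ_y cos θ` holds on the whole arc.
      · have h1 : HasDerivWithinAt φ 0 (Icc (τ i) (τ (i + 1))) t :=
          (hasDerivWithinAt_const t _ (0 : ℝ)).congr_of_mem hz ht
        have h2 := (uniqueDiffOn_Icc hlt t ht).eq_deriv _ h1 ((hE.φ_deriv t (hI ht)).mono hI)
        rw [sweep_eq] at h2
        have := (mul_eq_zero.1 h2.symm).resolve_left P.v_pos.ne'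
        linarith
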